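/- **Setting.** Let agents $0$ (leader) and $1,\dots,N$ (followers) communicate over a digraph; put $a_{ij}=1$ if agent $i$ receives information from agent $j$ and $a_{ij}=0$ otherwise, and assume that every follower is reachable from the leader by a directed path (along the direction of information flow). The input delays $\tau_{u_i}$ are differentiable on $[0,\infty)$ with $0\le\tau_{u_i}(t)\le\bar\tau$ and $\dot\tau_{u_i}(t)\le\hat\tau$; the communication delays $\tau_{c_{ij}}$ (from $j$ to $i$) are measurable with $0\le\tau_{c_{ij}}(t)\le\bar\tau_c$ for some constant $\bar\tau_c$. Fix $\bar\tau\ge0$, $\hat\tau\ge0$, $\delta>0$, $\gamma>0$, $\varepsilon\in\mathbb R$ and an observer gain $\epsilon>0$. Differential equations hold for almost every $t\ge0$, with locally absolutely continuous solutions. For $A\in\mathbb R^{n\times n}$, $B\in\mathbb R^{n\times p}$ say that $(\bar P,\bar Q,\bar R,\bar S,\bar S_{12},M,Y)$, with $Y\in\mathbb R^{p\times n}$ and the other matrices in $\mathbb R^{n\times n}$, solves $\mathrm{LMI}(A,B)$ if $\bar P,\bar R,\bar S\succ0$, $\bar Q\succ0$ when $\hat\tau<1$ and $\bar Q=0$ when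 $\hat\tau\ge1$, and $$\Phi_2=\begin{bmatrix}\Phi_{11}&\Phi_{12}&e^{-2\delta\bar\tau}\bar S_{12}&\Phi_{14}&I_n\\ *&\Phi_{22}&0&\varepsilon BY&\varepsilon I_n\\ *&*&\Phi_{33}&\Phi_{34}&0\\ *&*&*&\Phi_{44}&0\\ *&*&*&*&-\gamma I_n\end{bmatrix}\prec0,\qquad \Phi_2'=\begin{bmatrix}\bar R&\bar S_{12}\\ *&\bar R\end{bmatrix}\succeq0,$$ where $*$ denotes the symmetric blocks and $\Phi_{11}=2\delta\bar P+\bar S+\bar Q-e^{-2\delta\bar\tau}\bar R+AM+M^TA^T$, $\Phi_{12}=\bar P-M+\varepsilon M^TA^T$, $\Phi_{14}=BY+e^{-2\delta\bar\tau}(\bar R-\bar S_{12})$, $\Phi_{22}=\bar\tau^2\bar R-\varepsilon M^T-\varepsilon M$, $\Phi_{33}=-e^{-2\delta\bar\tau}(\bar S+\bar R)$, $\Phi_{34}=e^{-2\delta\bar\tau}(\bar R-\bar S_{12}^T)$, $\Phi_{44}=-(1-\hat\tau)e^{-2\delta\bar\tau}\bar Q+e^{-2\delta\bar\tau}(-2\bar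 R+\bar S_{12}+\bar S_{12}^T)$. Write $P=M^{-T}\bar PM^{-1}$. For a leader matrix $A_0$, the observers are $\xi_i(t)=0$ for $t\le0$ and $$\dot\xi_i(t)=A_0\xi_i(t)+\epsilon\sum_{j\in\{1,\dots,N\},\,j\ne i}a_{ij}\bigl[e^{A_0\tau_{c_{ij}}(t)}\xi_j(t-\tau_{c_{ij}}(t))-\xi_i(t)\bigr]+\epsilon a_{i0}\bigl[e^{A_0\tau_{c_{i0}}(t)}x_0(t-\tau_{c_{i0}}(t))-\xi_i(t)\bigr].$$ The initial data are $x_i(0)$, the values of $u_i$ on $[-\bar\tau,0)$ and of $x_0$ on $[-\bar\tau_c,0]$; $D$ denotes any bound for the norms of all of them. **I (homogeneous agents).** Consider $\dot x_0=Ax_0$ and $\dot x_i(t)=Ax_i(t)+Bu_i(t-\tau_{u_i}(t))+v_i(t)$, where $A$ has no eigenvalue with positive real part. Suppose that $(\bar P,\dots,M,Y)$ solves $\mathrm{LMI}(A,B)$ and apply $u_i(t)=K(x_i(t)-\xi_i(t))$, $t\ge0$, with $K=YM^{-1}$ and the observer with $A_0=A$. Then the tracking errors $\tilde x_i=x_i-x_0$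 satisfy: (a) there are $c,\kappa>0$, independent of the initial data, such that $\|\tilde x_i(t)\|\le cDe^{-\kappa t}$ for all $t\ge0$ whenever $v_i\equiv0$; (b) there is $c>0$, independent of the initial data and of the disturbances, such that $\|\tilde x_i(t)\|\le c(D+\Delta_i)$ for all $t\ge0$ whenever $v_i\in L_\infty[0,\infty)$ with $\|v_i\|_\infty\le\Delta_i$; (c) in the situation of (b), $\limsup_{t\to\infty}\|\tilde x_i(t)\|^2\le\frac{\gamma}{2\delta\lambda_{\min}(P)}\Delta_i^2$. **II (heterogeneous agents).** Consider $\dot x_0=A_0x_0$, $y_0=C_0x_0$ and $\dot x_i(t)=A_ix_i(t)+B_iu_i(t-\tau_{u_i}(t))+v_i(t)$, $y_i=C_ix_i$, with $x_i(t)\in\mathbb R^{n_i}$, $u_i(t)\in\mathbb R^{p_i}$, where every eigenvalue of $A_0$ has negative real part, or has zero real part and is simple. Let $(X_i,U_i)$ satisfy $X_iA_0=A_iX_i+B_iU_i$ and $C_0=C_iX_i$, let $(\bar P_i,\dots,M_i,Y_i)$ solve $\mathrm{LMI}(A_i,B_i)$ for each $i$, put $P_i=M_i^{-T}\bar P_iM_i^{-1}$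 and $K_i^1=Y_iM_i^{-1}$, and apply $u_i(t)=K_i^1x_i(t)-K_i^2\xi_i(t)$, $t\ge0$. Then the output consensus errors $\tilde x_i=y_i-y_0$ satisfy: (a) both if $K_i^2=K_i^1X_i-U_i$ for all $i$ and if $K_i^2=U_i-K_i^1X_i$ for all $i$, there is $c>0$, independent of the initial data and of the disturbances, such that $\|\tilde x_i(t)\|\le c(D+\Delta_i)$ for all $t\ge0$ whenever $\|v_i\|_\infty\le\Delta_i$; (b) if $K_i^2=K_i^1X_i-U_i$ for all $i$, $\|v_i\|_\infty\le\Delta_i$, and $\|B_iU_i(x_0(t)-x_0(t-\tau_{u_i}(t)))\|\le\beta$ for all large $t$, then $\limsup_{t\to\infty}\|\tilde x_i(t)\|^2\le\frac{\gamma\|C_i\|^2}{2\delta\lambda_{\min}(P_i)}(\Delta_i+\beta)^2$. -/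

import Mathlib

open MeasureTheory Filter Topology

noncomputable section

namespace DelayMAS

/-- `ℝⁿ` with the Euclidean norm. -/
abbrev E (n : ℕ) : Type := EuclideanSpace ℝ (Fin n)

/-! ### Solutions and disturbances -/

/-- Carathéodory solution of `ẋ(t) = f(t)` on `[0, ∞)`: `f` is locally integrable and `x` is its
primitive, i.e. `x` is locally absolutely continuous and `ẋ = f` almost everywhere. -/
def IsSolution {n : ℕ} (x f : ℝ → E n) : Prop :=
  ∀ t : ℝ, 0 ≤ t → IntervalIntegrable f volume 0 t ∧ x t = x 0 + ∫ s in (0 : ℝ)..t, f s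

/-- `v ∈ L_∞[0, ∞)` with `‖v‖_∞ ≤ Δ`. -/
def EssBoundedBy {n : ℕ} (v : ℝ → E n) (Δ : ℝ) : Prop :=
  AEStronglyMeasurable v (volume.restrict (Set.Ici 0)) ∧
    ∀ᵐ t ∂(volume.restrict (Set.Ici (0 : ℝ))), ‖v t‖ ≤ Δ

/-! ### Communication graph

The agents are the vertices of a digraph on `Fin (N + 1)`: the vertex `0` is the leader and
`i.succ` is the follower `i : Fin N`. `G.Adj j i` is an edge from `j` to `i` along which
information flows, that is, agent `i` receives information from agent `j`. -/

/-- The weight `a_{ij}`: it is `1` if agent `i` receives information from agent `j`, else `0`. -/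
def weight {N : ℕ} (G : Digraph (Fin (N + 1))) (i j : Fin (N + 1)) : ℝ :=
  open Classical in if G.Adj j i then 1 else 0

/-- `G` contains a directed spanning tree whose root is the leader. -/
def LeaderRooted {N : ℕ} (G : Digraph (Fin (N + 1))) : Prop :=
  ∀ i : Fin (N + 1), Relation.ReflTransGen G.Adj 0 i

/-! ### Delays -/

/-- Input delays: differentiable, `0 ≤ τ_{u_i} ≤ τbar` and `τ̇_{u_i} ≤ τhat` on `[0, ∞)`. -/
structure InputDelays {N : ℕ} (τbar τhat : ℝ) (τu : Fin N → ℝ → ℝ) : Prop where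
  nonneg : ∀ i t, 0 ≤ t → 0 ≤ τu i t
  le_bar : ∀ i t, 0 ≤ t → τu i t ≤ τbar
  differentiable : ∀ i, DifferentiableOn ℝ (τu i) (Set.Ici 0)
  deriv_le : ∀ i t, 0 ≤ t → derivWithin (τu i) (Set.Ici 0) t ≤ τhat

/-- Communication delays: `τc i j` is the delay from agent `j` to follower `i`. Along the edges
of the graph the delays are measurable and take values in `[0, τcbar]`. -/
structure CommDelays {N : ℕ} (G : Digraph (Fin (N + 1))) (τcbar : ℝ)
    (τc : Fin N → Fin (N + 1) → ℝ → ℝ) : Prop where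
  measurable : ∀ i j, G.Adj j i.succ → Measurable (τc i j)
  nonneg : ∀ i j t, G.Adj j i.succ → 0 ≤ t → 0 ≤ τc i j t
  le_bar : ∀ i j t, G.Adj j i.succ → 0 ≤ t → τc i j t ≤ τcbar

/-! ### Spectral notions -/

/-- No eigenvalue of `A` has positive real part. -/
def NoUnstableEigenvalue {n : ℕ} (A : Matrix (Fin n) (Fin n) ℝ) : Prop :=
  ∀ μ ∈ spectrum ℂ (A.map (algebraMap ℝ ℂ)), μ.re ≤ 0

/-- Every eigenvalue of `A` has negative real part, or has zero real part and is simple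
(algebraic multiplicity one). -/
def MarginallyStable {n : ℕ} (A : Matrix (Fin n) (Fin n) ℝ) : Prop :=
  ∀ μ ∈ spectrum ℂ (A.map (algebraMap ℝ ℂ)),
    μ.re < 0 ∨ (μ.re = 0 ∧ (A.map (algebraMap ℝ ℂ)).charpoly.rootMultiplicity μ = 1)

/-- The smallest eigenvalue of a symmetric matrix. -/
def lambdaMin {n : ℕ} (P : Matrix (Fin n) (Fin n) ℝ) : ℝ := sInf (spectrum ℝ P)

/-- The norm of a matrix induced by the Euclidean norms. -/
def opNorm {m n : ℕ} (C : Matrix (Fin m) (Fin n) ℝ) : ℝ :=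
  ‖LinearMap.toContinuousLinearMap C.toEuclideanLin‖

/-! ### Observer and closed-loop systems -/

/-- Right-hand side of the observer of follower `i`, for the leader matrix `A₀`:
`A₀ ξ_i(t) + ϵ ∑_{j ≠ i} a_{ij} [e^{A₀ τ_{ij}(t)} ξ_j(t - τ_{ij}(t)) - ξ_i(t)]`
`  + ϵ a_{i0} [e^{A₀ τ_{i0}(t)} x₀(t - τ_{i0}(t)) - ξ_i(t)]`, the sum being over followers `j`. -/
def observerRHS {N n : ℕ} (G : Digraph (Fin (N + 1))) (ϵ : ℝ)
    (τc : Fin N → Fin (N + 1) → ℝ → ℝ) (A₀ : Matrix (Fin n) (Fin n) ℝ)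
    (x₀ : ℝ → E n) (ξ : Fin N → ℝ → E n) (i : Fin N) (t : ℝ) : E n :=
  A₀.toEuclideanLin (ξ i t)
    + ϵ • ∑ j ∈ Finset.univ.erase i, weight G i.succ j.succ •
        ((NormedSpace.exp (τc i j.succ t • A₀)).toEuclideanLin (ξ j (t - τc i j.succ t)) - ξ i t)
    + (ϵ * weight G i.succ 0) •
        ((NormedSpace.exp (τc i 0 t • A₀)).toEuclideanLin (x₀ (t - τc i 0 t)) - ξ i t)

/-- Trajectory of the homogeneous multi-agent system with the observer and the input
`u_i = K (x_i - ξ_i)`. The values of `u_i` and `x₀` at negative times are initial data. -/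
structure HomClosedLoop {N n p : ℕ} (G : Digraph (Fin (N + 1))) (ϵ : ℝ)
    (τu : Fin N → ℝ → ℝ) (τc : Fin N → Fin (N + 1) → ℝ → ℝ)
    (A : Matrix (Fin n) (Fin n) ℝ) (B : Matrix (Fin n) (Fin p) ℝ) (K : Matrix (Fin p) (Fin n) ℝ)
    (v : Fin N → ℝ → E n) (x₀ : ℝ → E n) (x ξ : Fin N → ℝ → E n) (u : Fin N → ℝ → E p) :
    Prop where
  leader : IsSolution x₀ fun t => A.toEuclideanLin (x₀ t)
  follower : ∀ i, IsSolution (x i) fun t =>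
    A.toEuclideanLin (x i t) + B.toEuclideanLin (u i (t - τu i t)) + v i t
  observer_init : ∀ i t, t ≤ 0 → ξ i t = 0
  observer : ∀ i, IsSolution (ξ i) (observerRHS G ϵ τc A x₀ ξ i)
  input : ∀ i t, 0 ≤ t → u i t = K.toEuclideanLin (x i t - ξ i t)

/-- Trajectory of the heterogeneous multi-agent system with the observer and the input
`u_i = K¹_i x_i - K²_i ξ_i`. The values of `u_i` and `x₀` at negative times are initial data. -/
structure HetClosedLoop {N n : ℕ} {nn pp : Fin N → ℕ} (G : Digraph (Fin (N + 1))) (ϵ : ℝ)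
    (τu : Fin N → ℝ → ℝ) (τc : Fin N → Fin (N + 1) → ℝ → ℝ)
    (A₀ : Matrix (Fin n) (Fin n) ℝ)
    (A : ∀ i, Matrix (Fin (nn i)) (Fin (nn i)) ℝ) (B : ∀ i, Matrix (Fin (nn i)) (Fin (pp i)) ℝ)
    (K₁ : ∀ i, Matrix (Fin (pp i)) (Fin (nn i)) ℝ) (K₂ : ∀ i, Matrix (Fin (pp i)) (Fin n) ℝ)
    (v : ∀ i, ℝ → E (nn i)) (x₀ : ℝ → E n) (x : ∀ i, ℝ → E (nn i)) (ξ : Fin N → ℝ → E n)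
    (u : ∀ i, ℝ → E (pp i)) : Prop where
  leader : IsSolution x₀ fun t => A₀.toEuclideanLin (x₀ t)
  follower : ∀ i, IsSolution (x i) fun t =>
    (A i).toEuclideanLin (x i t) + (B i).toEuclideanLin (u i (t - τu i t)) + v i t
  observer_init : ∀ i t, t ≤ 0 → ξ i t = 0
  observer : ∀ i, IsSolution (ξ i) (observerRHS G ϵ τc A₀ x₀ ξ i)
  input : ∀ i t, 0 ≤ t →
    u i t = (K₁ i).toEuclideanLin (x i t) - (K₂ i).toEuclideanLin (ξ i t)

/-- All initial data have size at most `D`: the initial states of the followers, the inputs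
applied before time `0`, and the leader state up to time `0` (as far as the delays reach back). -/
structure InitialDataBound {N n : ℕ} {nn pp : Fin N → ℕ} (τbar τcbar : ℝ) (x₀ : ℝ → E n)
    (x : ∀ i, ℝ → E (nn i)) (u : ∀ i, ℝ → E (pp i)) (D : ℝ) : Prop where
  state : ∀ i, ‖x i 0‖ ≤ D
  input : ∀ i, ∀ s ∈ Set.Ico (-τbar) 0, ‖u i s‖ ≤ D
  leader : ∀ s ∈ Set.Icc (-τcbar) 0, ‖x₀ s‖ ≤ D

/-! ### The linear matrix inequalities -/

section LMI

variable {n p : ℕ}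

/-- The symmetric `5 × 5` block matrix `Φ₂`. -/
def Phi2 (A : Matrix (Fin n) (Fin n) ℝ) (B : Matrix (Fin n) (Fin p) ℝ) (τbar τhat δ γ ε : ℝ)
    (P Q R S S₁₂ M : Matrix (Fin n) (Fin n) ℝ) (Y : Matrix (Fin p) (Fin n) ℝ) :
    Matrix (Fin 5 × Fin n) (Fin 5 × Fin n) ℝ :=
  let e : ℝ := Real.exp (-2 * δ * τbar)
  let Φ11 := (2 * δ) • P + S + Q - e • R + A * M + M.transpose * A.transpose
  let Φ12 := P - M + ε • (M.transpose * A.transpose)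
  let Φ13 := e • S₁₂
  let Φ14 := B * Y + e • (R - S₁₂)
  let Φ22 := τbar ^ 2 • R - ε • M.transpose - ε • M
  let Φ24 := ε • (B * Y)
  let Φ33 := -(e • (S + R))
  let Φ34 := e • (R - S₁₂.transpose)
  let Φ44 := -(((1 - τhat) * e) • Q) + e • (-((2 : ℝ) • R) + S₁₂ + S₁₂.transpose)
  let I : Matrix (Fin n) (Fin n) ℝ := 1
  Matrix.comp (Fin 5) (Fin 5) (Fin n) (Fin n) ℝ
    !![Φ11,           Φ12,           Φ13,           Φ14,   I;
       Φ12.transpose, Φ22,           0,             Φ24,   ε • I;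
       Φ13.transpose, 0,             Φ33,           Φ34,   0;
       Φ14.transpose, Φ24.transpose, Φ34.transpose, Φ44,   0;
       I,             ε • I,         0,             0,     -(γ • I)]

/-- The block matrix `Φ₂' = [R, S₁₂; S₁₂ᵀ, R]`. -/
def Phi2' (R S₁₂ : Matrix (Fin n) (Fin n) ℝ) : Matrix (Fin n ⊕ Fin n) (Fin n ⊕ Fin n) ℝ :=
  Matrix.fromBlocks R S₁₂ S₁₂.transpose R

/-- `(P, Q, R, S, S₁₂, M, Y)` is a solution of the linear matrix inequalities `Φ₂ ≺ 0` and
`Φ₂' ⪰ 0` with `P, R, S ≻ 0`, and `Q ≻ 0` if `τhat < 1`, `Q = 0` if `τhat ≥ 1`. -/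
structure LMISolution (A : Matrix (Fin n) (Fin n) ℝ) (B : Matrix (Fin n) (Fin p) ℝ)
    (τbar τhat δ γ ε : ℝ) (P Q R S S₁₂ M : Matrix (Fin n) (Fin n) ℝ)
    (Y : Matrix (Fin p) (Fin n) ℝ) : Prop where
  posDef_P : P.PosDef
  posDef_R : R.PosDef
  posDef_S : S.PosDef
  posDef_Q : τhat < 1 → Q.PosDef
  zero_Q : 1 ≤ τhat → Q = 0
  phi2_neg : (-(Phi2 A B τbar τhat δ γ ε P Q R S S₁₂ M Y)).PosDef
  phi2'_nonneg : (Phi2' R S₁₂).PosSemidef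

end LMI

/-- The matrix `M⁻ᵀ P M⁻¹`. -/
def unbar {n : ℕ} (P M : Matrix (Fin n) (Fin n) ℝ) : Matrix (Fin n) (Fin n) ℝ :=
  M⁻¹.transpose * P * M⁻¹

end DelayMAS

end

/-!
In the frame moving with the leader flow `e^{A₀t}` the leader state is constant and the observers
perform a delayed consensus iteration. An agent at distance `k` from the leader is pulled towards an
agent at distance `k - 1`, and this yields exponentially decaying supersolutions; since `A₀` has no
unstable eigenvalue, returning to the original frame costs only a polynomial factor. The observer
errors therefore decay exponentially.

The regulation error `z_i = x_i - X_i x₀` then satisfies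
`ż_i = A_i z_i + B_i K¹_i z_i(t - τ) + w_i`, where `w_i` consists of `v_i`, a term driven by the
leader state alone and an exponentially decaying term. Homogeneous agents are the case `X = 1`,
`U = 0`, in which the leader term vanishes. The matrix inequalities say that the Lyapunov–Krasovskii
functional satisfies `V̇ ≤ -2δV + γ‖w‖²`, and comparison with this scalar inequality gives all the
bounds.
-/

noncomputable section

namespace DelayMAS

/-- The notion `IsSolution` in an arbitrary normed space: `x` is a primitive of the locally
integrable function `f` on `[0, ∞)`. -/
def IsPrimitive {F : Type*} [NormedAddCommGroup F] [NormedSpace ℝ F] (x f : ℝ → F) : Prop :=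
  ∀ t : ℝ, 0 ≤ t → IntervalIntegrable f volume 0 t ∧ x t = x 0 + ∫ s in (0 : ℝ)..t, f s

theorem IsSolution.isPrimitive {n : ℕ} {x f : ℝ → E n} (h : IsSolution x f) : IsPrimitive x f := h

namespace IsPrimitive

variable {F G H : Type*} [NormedAddCommGroup F] [NormedSpace ℝ F]
  [NormedAddCommGroup G] [NormedSpace ℝ G] [NormedAddCommGroup H] [NormedSpace ℝ H]
  {x y f g : ℝ → F}

theorem intervalIntegrable (h : IsPrimitive x f) {s t : ℝ} (hs : 0 ≤ s) (ht : 0 ≤ t) :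
    IntervalIntegrable f volume s t :=
  (h s hs).1.symm.trans (h t ht).1

theorem sub_eq_integral (h : IsPrimitive x f) {s t : ℝ} (hs : 0 ≤ s) (ht : 0 ≤ t) :
    x t - x s = ∫ r in s..t, f r := by
  rw [(h s hs).2, (h t ht).2, add_sub_add_left_eq_sub,
    intervalIntegral.integral_interval_sub_left (h t ht).1 (h s hs).1]

theorem congr (h : IsPrimitive x f) (hx : Set.EqOn x y (Set.Ici 0))
    (hf : f =ᵐ[volume.restrict (Set.Ici 0)] g) : IsPrimitive y g := by
  intro t ht
  have hsub : Set.uIoc 0 t ⊆ Set.Ici 0 := by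
    rw [Set.uIoc_of_le ht]
    exact fun s hs => hs.1.le
  have hae : f =ᵐ[volume.restrict (Set.uIoc 0 t)] g := ae_restrict_of_ae_restrict_of_subset hsub hf
  refine ⟨(h t ht).1.congr_ae hae, ?_⟩
  rw [← hx ht, ← hx Set.self_mem_Ici, (h t ht).2,
    intervalIntegral.integral_congr_ae_restrict hae]

theorem congr_right (h : IsPrimitive x f) (hf : Set.EqOn f g (Set.Ici 0)) : IsPrimitive x g :=
  h.congr (fun _ _ => rfl) ((ae_restrict_mem measurableSet_Ici).mono fun _ ht => hf ht)

theorem continuousOn (h : IsPrimitive x f) : ContinuousOn x (Set.Ici 0) := by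
  intro t (ht : 0 ≤ t)
  have hprim : ContinuousOn (fun t => x 0 + ∫ s in (0 : ℝ)..t, f s) (Set.uIcc 0 (t + 1)) :=
    continuousOn_const.add (intervalIntegral.continuousOn_primitive_interval'
      (h (t + 1) (by linarith)).1 Set.left_mem_uIcc)
  rw [Set.uIcc_of_le (by linarith)] at hprim
  have hx : ContinuousOn x (Set.Icc 0 (t + 1)) := hprim.congr fun s hs => (h s hs.1).2
  refine (hx t ⟨ht, by linarith⟩).mono_of_mem_nhdsWithin ?_
  exact mem_nhdsWithin.2
    ⟨Set.Iio (t + 1), isOpen_Iio, by simp, fun s hs => ⟨hs.2, le_of_lt hs.1⟩⟩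

theorem const (c : F) : IsPrimitive (fun _ => c) (fun _ => 0) := fun _ _ => by simp

theorem add (hx : IsPrimitive x f) (hy : IsPrimitive y g) :
    IsPrimitive (fun t => x t + y t) (fun t => f t + g t) := by
  refine fun t ht => ⟨(hx t ht).1.add (hy t ht).1, ?_⟩
  change x t + y t = x 0 + y 0 + _
  rw [intervalIntegral.integral_add (hx t ht).1 (hy t ht).1, (hx t ht).2, (hy t ht).2]
  abel

theorem sub (hx : IsPrimitive x f) (hy : IsPrimitive y g) :
    IsPrimitive (fun t => x t - y t) (fun t => f t - g t) := by
  refine fun t ht => ⟨(hx t ht).1.sub (hy t ht).1, ?_⟩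
  change x t - y t = x 0 - y 0 + _
  rw [intervalIntegral.integral_sub (hx t ht).1 (hy t ht).1, (hx t ht).2, (hy t ht).2]
  abel

theorem sum {ι : Type*} (s : Finset ι) {X Y : ι → ℝ → F} (h : ∀ i ∈ s, IsPrimitive (X i) (Y i)) :
    IsPrimitive (fun t => ∑ i ∈ s, X i t) (fun t => ∑ i ∈ s, Y i t) := by
  classical
  induction s using Finset.induction_on with
  | empty => simpa using const (0 : F)
  | insert a s ha ih =>
    simp only [Finset.sum_insert ha]
    exact (h a (by simp)).add (ih fun i hi => h i (by simp [hi]))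

theorem map [CompleteSpace F] [CompleteSpace G] (L : F →L[ℝ] G) (hx : IsPrimitive x f) :
    IsPrimitive (fun t => L (x t)) (fun t => L (f t)) := by
  refine fun t ht => ⟨⟨L.integrable_comp (hx t ht).1.1, L.integrable_comp (hx t ht).1.2⟩, ?_⟩
  rw [L.intervalIntegral_comp_comm (hx t ht).1, ← map_add, ← (hx t ht).2]

theorem const_mul {x f : ℝ → ℝ} (c : ℝ) (h : IsPrimitive x f) :
    IsPrimitive (fun t => c * x t) (fun t => c * f t) :=
  h.map (ContinuousLinearMap.mul ℝ ℝ c)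

theorem of_hasDerivAt [CompleteSpace F] (h : ∀ t, HasDerivAt x (f t) t) (hf : Continuous f) :
    IsPrimitive x f := by
  refine fun t _ => ⟨hf.intervalIntegrable _ _, ?_⟩
  rw [intervalIntegral.integral_eq_sub_of_hasDerivAt (fun s _ => h s) (hf.intervalIntegrable _ _)]
  abel

theorem exists_absolutelyContinuousOnInterval {x f : ℝ → ℝ} (h : IsPrimitive x f) {t : ℝ}
    (ht : 0 ≤ t) :
    ∃ z : ℝ → ℝ, AbsolutelyContinuousOnInterval z 0 t ∧ Set.EqOn z x (Set.Icc 0 t) ∧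
      ∀ᵐ s, s ∈ Set.uIoc 0 t → deriv z s = f s := by
  refine ⟨fun s => (∫ r in (0 : ℝ)..s, f r) + x 0, ?_, fun s hs => ?_, ?_⟩
  · exact ((h t ht).1.absolutelyContinuousOnInterval_intervalIntegral Set.left_mem_uIcc).add
      (LipschitzWith.const (x 0)).lipschitzOnWith.absolutelyContinuousOnInterval
  · simp only [(h s hs.1).2, add_comm]
  · filter_upwards [(h t ht).1.ae_hasDerivAt_integral] with s hs hst
    exact ((hs (Set.uIoc_subset_uIcc hst) 0 Set.left_mem_uIcc).add_const _).deriv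

theorem mul {x f y g : ℝ → ℝ} (hx : IsPrimitive x f) (hy : IsPrimitive y g) :
    IsPrimitive (fun t => x t * y t) (fun t => f t * y t + x t * g t) := by
  intro t ht
  have hsub : Set.uIcc 0 t ⊆ Set.Ici 0 := by
    rw [Set.uIcc_of_le ht]
    exact fun s hs => hs.1
  refine ⟨((hx t ht).1.mul_continuousOn (hy.continuousOn.mono hsub)).add
    ((hy t ht).1.continuousOn_mul (hx.continuousOn.mono hsub)), ?_⟩
  obtain ⟨x', hx', hxeq, hxderiv⟩ := hx.exists_absolutelyContinuousOnInterval ht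
  obtain ⟨y', hy', hyeq, hyderiv⟩ := hy.exists_absolutelyContinuousOnInterval ht
  have hparts := hx'.integral_deriv_mul_eq_sub hy'
  rw [hxeq ⟨ht, le_rfl⟩, hxeq ⟨le_rfl, ht⟩, hyeq ⟨ht, le_rfl⟩, hyeq ⟨le_rfl, ht⟩] at hparts
  have hint : ∫ s in (0 : ℝ)..t, (f s * y s + x s * g s)
      = ∫ s in (0 : ℝ)..t, (deriv x' s * y' s + x' s * deriv y' s) := by
    apply intervalIntegral.integral_congr_ae
    filter_upwards [hxderiv, hyderiv] with s hxs hys hs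
    have hs' : s ∈ Set.Icc 0 t := by
      rw [Set.uIoc_of_le ht] at hs
      exact ⟨hs.1.le, hs.2⟩
    rw [hxs hs, hys hs, hxeq hs', hyeq hs']
  rw [hint, hparts]
  ring

theorem bilin [FiniteDimensional ℝ F] [FiniteDimensional ℝ G] [CompleteSpace H]
    (B : F →L[ℝ] G →L[ℝ] H) {y g : ℝ → G} (hx : IsPrimitive x f) (hy : IsPrimitive y g) :
    IsPrimitive (fun t => B (x t) (y t)) (fun t => B (f t) (y t) + B (x t) (g t)) := by
  have : CompleteSpace F := FiniteDimensional.complete ℝ F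
  have : CompleteSpace G := FiniteDimensional.complete ℝ G
  let b := Module.finBasis ℝ F
  let b' := Module.finBasis ℝ G
  have expand (u : F) (w : G) :
      B u w = ∑ i, ∑ j, (b.repr u i * b'.repr w j) • B (b i) (b' j) := by
    conv_lhs => rw [← b.sum_repr u, ← b'.sum_repr w]
    simp only [map_sum, map_smul, sum_apply, smul_apply, smul_smul, Finset.smul_sum]
    refine Finset.sum_comm.trans <|
      Finset.sum_congr rfl fun i _ => Finset.sum_congr rfl fun j _ => ?_
    rw [mul_comm]
  have hxi (i) : IsPrimitive (fun t => b.repr (x t) i) (fun t => b.repr (f t) i) :=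
    hx.map (LinearMap.toContinuousLinearMap (b.coord i))
  have hyj (j) : IsPrimitive (fun t => b'.repr (y t) j) (fun t => b'.repr (g t) j) :=
    hy.map (LinearMap.toContinuousLinearMap (b'.coord j))
  have hsum := IsPrimitive.sum Finset.univ fun i _ => IsPrimitive.sum Finset.univ fun j _ =>
    ((hxi i).mul (hyj j)).map (ContinuousLinearMap.toSpanSingleton ℝ (B (b i) (b' j)))
  refine hsum.congr (fun t _ => ?_) (Eventually.of_forall fun t => ?_)
  · simp [expand (x t) (y t)]
  · simp only [ContinuousLinearMap.toSpanSingleton_apply, expand (x t) (g t), expand (f t) (y t),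
      add_smul, Finset.sum_add_distrib]

end IsPrimitive

section ExponentialGrowth

theorem norm_le_mul_exp_of_norm_deriv_le_mul_exp {F : Type*} [NormedAddCommGroup F]
    [NormedSpace ℝ F] {w w' : ℝ → F} (hw : ∀ t, HasDerivAt w (w' t) t) {a c : ℝ} (ha : 0 < a)
    (hc : 0 ≤ c) (hle : ∀ t, 0 ≤ t → ‖w' t‖ ≤ c * Real.exp (a * t)) {t : ℝ} (ht : 0 ≤ t) :
    ‖w t‖ ≤ (‖w 0‖ + c / a) * Real.exp (a * t) := by
  have hB (s : ℝ) : HasDerivAt (fun s : ℝ => ‖w 0‖ + c / a * Real.exp (a * s))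
      (c * Real.exp (a * s)) s := by
    have := (((hasDerivAt_id s).const_mul a).exp.const_mul (c / a)).const_add ‖w 0‖
    convert! this using 1
    field_simp
    simp
  have hboundary := image_norm_le_of_norm_deriv_right_le_deriv_boundary (a := 0) (b := t)
    (fun s _ => (hw s).continuousAt.continuousWithinAt) (fun s _ => (hw s).hasDerivWithinAt)
    (by simpa using div_nonneg hc ha.le) hB (fun s hs => hle s hs.1) ⟨ht, le_rfl⟩
  have hone : (1 : ℝ) ≤ Real.exp (a * t) := Real.one_le_exp (by positivity)
  refine hboundary.trans ?_
  rw [add_mul]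
  gcongr
  exact le_mul_of_one_le_right (norm_nonneg _) hone

variable {F : Type*} [NormedAddCommGroup F] [NormedSpace ℂ F]

theorem hasDerivAt_cexp_smul_exp_smul_apply [CompleteSpace F] (T : F →L[ℂ] F) (μ : ℂ) (v : F)
    (t : ℝ) :
    HasDerivAt (fun s : ℝ => Complex.exp (-(s : ℂ) * μ) • NormedSpace.exp (s • T) v)
      (Complex.exp (-(t : ℂ) * μ) • NormedSpace.exp (t • T) ((T - μ • 1) v)) t := by
  have hexp : HasDerivAt (fun s : ℝ => NormedSpace.exp (s • T) v)
      (NormedSpace.exp (t • T) (T v)) t :=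
    ((ContinuousLinearMap.apply ℂ F v).restrictScalars ℝ).hasFDerivAt.comp_hasDerivAt t
      (hasDerivAt_exp_smul_const T t)
  have hcexp : HasDerivAt (fun s : ℝ => Complex.exp (-(s : ℂ) * μ))
      (Complex.exp (-(t : ℂ) * μ) * (-1 * μ)) t :=
    ((Complex.ofRealCLM.hasDerivAt (x := t)).neg.mul_const μ).cexp
  convert! hcexp.smul hexp using 1
  simp only [sub_apply, smul_apply, one_apply_eq_self, map_sub, map_smul, smul_sub, smul_smul]
  rw [sub_eq_add_neg, ← neg_smul]
  congr 2
  ring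

theorem norm_cexp_neg_ofReal_mul (t : ℝ) (μ : ℂ) :
    ‖Complex.exp (-(t : ℂ) * μ)‖ = Real.exp (-(μ.re * t)) := by
  rw [Complex.norm_exp]
  simp [mul_comm]

theorem isBigO_exp_smul_apply_of_pow_apply_eq_zero [CompleteSpace F] (T : F →L[ℂ] F) {μ : ℂ}
    {κ : ℝ} (hκ : μ.re < κ) (k : ℕ) {v : F} (hv : ((T - μ • 1) ^ k) v = 0) :
    (fun t : ℝ => NormedSpace.exp (t • T) v) =O[𝓟 (Set.Ici 0)] fun t => Real.exp (κ * t) := by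
  induction k generalizing v with
  | zero =>
    have hv0 : v = 0 := by simpa using hv
    simpa [hv0] using Asymptotics.isBigO_zero _ _
  | succ k ih =>
    obtain ⟨c, hc, hbound⟩ := (ih (v := (T - μ • 1) v) (by simpa [pow_succ] using hv)).exists_nonneg
    rw [Asymptotics.isBigOWith_principal] at hbound
    refine Asymptotics.isBigO_principal.2 ⟨‖v‖ + c / (κ - μ.re), fun t ht => ?_⟩
    have hsplit (s : ℝ) : (κ - μ.re) * s = -(μ.re * s) + κ * s := by ring
    have hderiv (s : ℝ) (hs : 0 ≤ s) :
        ‖Complex.exp (-(s : ℂ) * μ) • NormedSpace.exp (s • T) ((T - μ • 1) v)‖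
          ≤ c * Real.exp ((κ - μ.re) * s) := by
      rw [norm_smul, norm_cexp_neg_ofReal_mul, hsplit, Real.exp_add, mul_left_comm]
      gcongr
      simpa using hbound s hs
    have hle := norm_le_mul_exp_of_norm_deriv_le_mul_exp
      (hasDerivAt_cexp_smul_exp_smul_apply T μ v) (sub_pos.2 hκ) hc hderiv ht
    rw [norm_smul, norm_cexp_neg_ofReal_mul, hsplit t, Real.exp_add, mul_left_comm,
      mul_le_mul_iff_right₀ (Real.exp_pos _)] at hle
    simpa using hle

theorem norm_exp_smul_apply_of_apply_eq_smul [CompleteSpace F] (T : F →L[ℂ] F) {μ : ℂ} {v : F}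
    (hv : T v = μ • v) (t : ℝ) :
    ‖NormedSpace.exp (t • T) v‖ = Real.exp (μ.re * t) * ‖v‖ := by
  have hderiv (s : ℝ) : HasDerivAt
      (fun s : ℝ => Complex.exp (-(s : ℂ) * μ) • NormedSpace.exp (s • T) v) 0 s := by
    simpa [hv] using hasDerivAt_cexp_smul_exp_smul_apply T μ v s
  have hconst := congrArg norm (is_const_of_deriv_eq_zero
    (fun s => (hderiv s).differentiableAt) (fun s => (hderiv s).deriv) t 0)
  rw [norm_smul, norm_smul, norm_cexp_neg_ofReal_mul, norm_cexp_neg_ofReal_mul, Real.exp_neg,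
    inv_mul_eq_iff_eq_mul₀ (Real.exp_pos _).ne'] at hconst
  simpa using hconst

theorem apply_eq_smul_of_rootMultiplicity_eq_one {K V : Type*} [Field K] [AddCommGroup V]
    [Module K V] [FiniteDimensional K V] {f : Module.End K V} {μ : K} (hμ : f.HasEigenvalue μ)
    (hs : f.charpoly.rootMultiplicity μ = 1) {v : V} (hv : v ∈ f.maxGenEigenspace μ) :
    f v = μ • v := by
  have heig : 1 ≤ Module.finrank K (f.eigenspace μ) := Submodule.one_le_finrank_iff.2 hμ
  have heq : f.eigenspace μ = f.maxGenEigenspace μ :=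
    Submodule.eq_of_le_of_finrank_le Module.End.eigenspace_le_maxGenEigenspace
      ((LinearMap.finrank_maxGenEigenspace_eq f μ).trans_le (hs.trans_le heig))
  exact Module.End.mem_eigenspace_iff.1 (heq ▸ hv)

theorem hasEigenvalue_of_mem_maxGenEigenspace {K V : Type*} [Field K] [AddCommGroup V]
    [Module K V] {f : Module.End K V} {μ : K} {v : V} (hv : v ∈ f.maxGenEigenspace μ)
    (hv0 : v ≠ 0) : f.HasEigenvalue μ := by
  have hgen : f.HasUnifEigenvalue μ ⊤ := fun h => hv0 <| by
    rwa [Module.End.maxGenEigenspace, h, Submodule.mem_bot] at hv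
  exact hgen.lt zero_lt_one

theorem isBigO_of_forall_isBigO_apply {ι 𝕜 V W : Type*} [NontriviallyNormedField 𝕜]
    [CompleteSpace 𝕜] [NormedAddCommGroup V] [NormedSpace 𝕜 V] [FiniteDimensional 𝕜 V]
    [NormedAddCommGroup W] [NormedSpace 𝕜 W] {l : Filter ι} {Φ : ι → V →L[𝕜] W} {g : ι → ℝ}
    (h : ∀ v, (fun i => Φ i v) =O[l] g) : Φ =O[l] g := by
  let b := Module.finBasis 𝕜 V
  obtain ⟨C, _, hC⟩ := b.exists_opNorm_le (F := W)
  have hsum : (fun i => ∑ k, ‖Φ i (b k)‖) =O[l] g :=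
    Asymptotics.IsBigO.fun_sum fun k _ => (h (b k)).norm_left
  refine (Asymptotics.isBigO_of_le' l (c := C) fun i => ?_).trans hsum
  rw [Real.norm_of_nonneg (by positivity)]
  exact hC (by positivity) fun k =>
    Finset.single_le_sum (f := fun k => ‖Φ i (b k)‖) (fun _ _ => norm_nonneg _) (Finset.mem_univ k)

theorem isBigO_exp_smul [FiniteDimensional ℂ F] (T : F →L[ℂ] F) {κ : ℝ}
    (hT : ∀ μ, Module.End.HasEigenvalue (T : Module.End ℂ F) μ →
      μ.re < κ ∨ μ.re = κ ∧ (LinearMap.charpoly (T : Module.End ℂ F)).rootMultiplicity μ = 1) :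
    (fun t : ℝ => NormedSpace.exp (t • T)) =O[𝓟 (Set.Ici 0)] fun t => Real.exp (κ * t) := by
  have : CompleteSpace F := FiniteDimensional.complete ℂ F
  refine isBigO_of_forall_isBigO_apply fun v => ?_
  have hv : v ∈ ⨆ μ, Module.End.maxGenEigenspace (T : Module.End ℂ F) μ := by
    rw [Module.End.iSup_maxGenEigenspace_eq_top]
    trivial
  induction hv using Submodule.iSup_induction' with
  | zero => simpa using Asymptotics.isBigO_zero _ _
  | add v w _ _ hv hw => simpa only [map_add] using hv.add hw
  | mem μ v hv =>
    rcases eq_or_ne v 0 with rfl | hv0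
    · simpa using Asymptotics.isBigO_zero _ _
    have hμ := hasEigenvalue_of_mem_maxGenEigenspace hv hv0
    rcases hT μ hμ with hre | ⟨rfl, hsimple⟩
    · obtain ⟨k, hk⟩ := (Module.End.mem_maxGenEigenspace _ _ _).1 hv
      refine isBigO_exp_smul_apply_of_pow_apply_eq_zero T hre k ?_
      rw [← hk, ← ContinuousLinearMap.coe_coe, ContinuousLinearMap.toLinearMap_pow]
      rfl
    · refine Asymptotics.isBigO_of_le' _ (c := ‖v‖) fun t => ?_
      rw [norm_exp_smul_apply_of_apply_eq_smul T
        (apply_eq_smul_of_rootMultiplicity_eq_one hμ hsimple hv),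
        Real.norm_of_nonneg (Real.exp_pos _).le, mul_comm]

end ExponentialGrowth

section MatrixExponential

variable {n m : ℕ}

/-- The continuous linear map of a real matrix between Euclidean spaces. -/
abbrev clm (A : Matrix (Fin m) (Fin n) ℝ) : E n →L[ℝ] E m :=
  LinearMap.toContinuousLinearMap A.toEuclideanLin

theorem clm_apply (A : Matrix (Fin m) (Fin n) ℝ) (v : E n) : clm A v = A.toEuclideanLin v := rfl

theorem clm_mul_apply {l : ℕ} (A : Matrix (Fin m) (Fin n) ℝ) (B : Matrix (Fin n) (Fin l) ℝ)
    (v : E l) : clm (A * B) v = clm A (clm B v) := by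
  ext i
  simp [clm_apply, Matrix.toLpLin_apply, Matrix.mulVec_mulVec]

theorem clm_one_apply (v : E n) : clm (1 : Matrix (Fin n) (Fin n) ℝ) v = v := by
  ext i
  simp [clm_apply]

theorem toEuclideanLin_exp (A : Matrix (Fin n) (Fin n) ℝ) (v : E n) :
    (NormedSpace.exp A).toEuclideanLin v = NormedSpace.exp (clm A) v := by
  let e := (Matrix.toEuclideanCLM (n := Fin n) (𝕜 := ℝ)).toAlgEquiv
  have h : e (NormedSpace.exp A) = NormedSpace.exp (e A) := by
    rw [NormedSpace.exp_eq_tsum ℝ, NormedSpace.exp_eq_tsum ℝ]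
    refine (e.toLinearEquiv.toContinuousLinearEquiv.map_tsum).trans (tsum_congr fun k => ?_)
    change e _ = _
    rw [map_smul, map_pow]
  exact congrArg (fun T : E n →L[ℝ] E n => T v) h

/-- The inclusion of `ℝⁿ` into `ℂⁿ` as a real linear map. It transfers the growth of the
exponential of a complex matrix, read off from its generalized eigenspaces, to real matrices. -/
def complexify (n : ℕ) : E n →L[ℝ] EuclideanSpace ℂ (Fin n) :=
  LinearMap.toContinuousLinearMap
    { toFun := fun v => WithLp.toLp 2 fun i => (v i : ℂ)
      map_add' := fun v w => by ext i; simp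
      map_smul' := fun c v => by ext i; simp }

theorem complexify_apply (v : E n) (i : Fin n) : complexify n v i = (v i : ℂ) := rfl

theorem norm_complexify (v : E n) : ‖complexify n v‖ = ‖v‖ := by
  simp [EuclideanSpace.norm_eq, complexify_apply]

theorem exp_apply_of_intertwines {V W : Type*} [NormedAddCommGroup V] [NormedSpace ℝ V]
    [CompleteSpace V] [NormedAddCommGroup W] [NormedSpace ℂ W] [CompleteSpace W]
    (J : V →L[ℝ] W) {T : V →L[ℝ] V} {T' : W →L[ℂ] W} (h : ∀ v, J (T v) = T' (J v)) (v : V) :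
    J (NormedSpace.exp T v) = NormedSpace.exp T' (J v) := by
  have hpow (k : ℕ) : J ((T ^ k) v) = (T' ^ k) (J v) := by
    induction k with
    | zero => simp
    | succ k ih => rw [pow_succ', pow_succ', mul_apply_eq_comp, mul_apply_eq_comp, h, ih]
  have hreal := ((ContinuousLinearMap.apply ℝ _ v).hasSum
    (NormedSpace.exp_series_hasSum_exp' (𝕂 := ℝ) T)).mapL J
  have hcomplex := (ContinuousLinearMap.apply ℂ _ (J v)).hasSum
    (NormedSpace.exp_series_hasSum_exp' (𝕂 := ℂ) T')
  refine hreal.unique (hcomplex.congr_fun fun k => ?_)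
  simp only [ContinuousLinearMap.apply_apply, map_smul, hpow]
  rw [← Complex.coe_smul]
  simp

theorem norm_exp_smul_clm_le (A : Matrix (Fin n) (Fin n) ℝ) (t : ℝ) :
    ‖NormedSpace.exp (t • clm A)‖ ≤
      ‖NormedSpace.exp (t • Matrix.toEuclideanCLM (n := Fin n) (𝕜 := ℂ)
        (A.map (algebraMap ℝ ℂ)))‖ := by
  refine ContinuousLinearMap.opNorm_le_bound _ (norm_nonneg _) fun v => ?_
  rw [← norm_complexify, ← norm_complexify v, exp_apply_of_intertwines (complexify n)
    (T' := t • Matrix.toEuclideanCLM (n := Fin n) (𝕜 := ℂ) (A.map (algebraMap ℝ ℂ)))]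
  · exact ContinuousLinearMap.le_opNorm _ _
  · intro w
    ext i
    simp [complexify_apply, Matrix.toLpLin_apply, Matrix.mulVec, dotProduct]

theorem mem_spectrum_of_hasEigenvalue_toEuclideanLin {A : Matrix (Fin n) (Fin n) ℂ} {μ : ℂ}
    (h : Module.End.HasEigenvalue
      (A.toEuclideanLin : Module.End ℂ (EuclideanSpace ℂ (Fin n))) μ) : μ ∈ spectrum ℂ A :=
  AlgEquiv.spectrum_eq (Matrix.toLpLinAlgEquiv 2) A ▸ h.mem_spectrum

theorem charpoly_toEuclideanLin (A : Matrix (Fin n) (Fin n) ℂ) :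
    LinearMap.charpoly (A.toEuclideanLin : Module.End ℂ (EuclideanSpace ℂ (Fin n)))
      = A.charpoly := by
  rw [Matrix.toEuclideanLin_eq_toLin_orthonormal, Matrix.charpoly_toLin]

theorem exists_norm_exp_smul_clm_le (A : Matrix (Fin n) (Fin n) ℝ) {κ : ℝ}
    (hA : ∀ μ ∈ spectrum ℂ (A.map (algebraMap ℝ ℂ)),
      μ.re < κ ∨ μ.re = κ ∧ (A.map (algebraMap ℝ ℂ)).charpoly.rootMultiplicity μ = 1) :
    ∃ c : ℝ, 0 ≤ c ∧ ∀ t : ℝ, 0 ≤ t → ‖NormedSpace.exp (t • clm A)‖ ≤ c * Real.exp (κ * t) := by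
  obtain ⟨c, hc, hbound⟩ := (isBigO_exp_smul (Matrix.toEuclideanCLM (n := Fin n) (𝕜 := ℂ)
    (A.map (algebraMap ℝ ℂ))) (κ := κ) fun μ hμ =>
      charpoly_toEuclideanLin (A.map (algebraMap ℝ ℂ)) ▸
        hA μ (mem_spectrum_of_hasEigenvalue_toEuclideanLin hμ)).exists_nonneg
  rw [Asymptotics.isBigOWith_principal] at hbound
  refine ⟨c, hc, fun t ht => (norm_exp_smul_clm_le A t).trans ?_⟩
  simpa using hbound t ht

theorem NoUnstableEigenvalue.exists_norm_exp_le {A : Matrix (Fin n) (Fin n) ℝ}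
    (hA : NoUnstableEigenvalue A) {κ : ℝ} (hκ : 0 < κ) :
    ∃ c : ℝ, 0 ≤ c ∧ ∀ t : ℝ, 0 ≤ t → ‖NormedSpace.exp (t • clm A)‖ ≤ c * Real.exp (κ * t) :=
  exists_norm_exp_smul_clm_le A fun μ hμ => .inl ((hA μ hμ).trans_lt hκ)

theorem MarginallyStable.noUnstableEigenvalue {A : Matrix (Fin n) (Fin n) ℝ}
    (hA : MarginallyStable A) : NoUnstableEigenvalue A := fun μ hμ =>
  (hA μ hμ).elim le_of_lt fun h => h.1.le

theorem MarginallyStable.exists_norm_exp_le {A : Matrix (Fin n) (Fin n) ℝ}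
    (hA : MarginallyStable A) :
    ∃ c : ℝ, 0 ≤ c ∧ ∀ t : ℝ, 0 ≤ t → ‖NormedSpace.exp (t • clm A)‖ ≤ c := by
  simpa using exists_norm_exp_smul_clm_le A hA

end MatrixExponential

section LinearFlow

variable {F : Type*} [NormedAddCommGroup F] [NormedSpace ℝ F]

theorem exp_zero_smul_apply (T : F →L[ℝ] F) (v : F) :
    NormedSpace.exp ((0 : ℝ) • T) v = v := by
  simp

theorem hasDerivAt_exp_neg_smul [CompleteSpace F] (T : F →L[ℝ] F) (t : ℝ) :
    HasDerivAt (fun t : ℝ => NormedSpace.exp ((-t) • T)) (-(NormedSpace.exp ((-t) • T) * T)) t := by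
  have h := (hasDerivAt_exp_smul_const T (-t)).scomp t (hasDerivAt_neg t)
  rwa [neg_one_smul] at h

theorem continuous_exp_neg_smul [CompleteSpace F] (T : F →L[ℝ] F) :
    Continuous (fun t : ℝ => NormedSpace.exp ((-t) • T)) :=
  continuous_iff_continuousAt.2 fun t => (hasDerivAt_exp_neg_smul T t).continuousAt

theorem exp_smul_exp_smul_apply [CompleteSpace F] (T : F →L[ℝ] F) (s t : ℝ) (v : F) :
    NormedSpace.exp (s • T) (NormedSpace.exp (t • T) v) = NormedSpace.exp ((s + t) • T) v := by
  let _ : NormedAlgebra ℚ (F →L[ℝ] F) := NormedAlgebra.restrictScalars ℚ ℝ _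
  have hcomm : Commute (s • T) (t • T) := ((Commute.refl T).smul_left s).smul_right t
  rw [add_smul, NormedSpace.exp_add_of_commute hcomm, mul_apply_eq_comp]

variable [FiniteDimensional ℝ F]

theorem IsPrimitive.exp_neg_smul (T : F →L[ℝ] F) {x f : ℝ → F} (h : IsPrimitive x f) :
    IsPrimitive (fun t => NormedSpace.exp ((-t) • T) (x t))
      (fun t => NormedSpace.exp ((-t) • T) (f t - T (x t))) := by
  have : CompleteSpace F := FiniteDimensional.complete ℝ F
  have hexp : IsPrimitive (fun t : ℝ => NormedSpace.exp ((-t) • T))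
      (fun t => -(NormedSpace.exp ((-t) • T) * T)) :=
    IsPrimitive.of_hasDerivAt (hasDerivAt_exp_neg_smul T)
      ((continuous_exp_neg_smul T).mul continuous_const).neg
  refine (hexp.bilin (ContinuousLinearMap.id ℝ (F →L[ℝ] F)) h).congr_right fun t _ => ?_
  simp only [ContinuousLinearMap.id_apply, map_sub]
  rw [sub_eq_add_neg, add_comm]
  rfl

theorem IsPrimitive.eq_exp_smul (T : F →L[ℝ] F) {x : ℝ → F}
    (h : IsPrimitive x fun t => T (x t)) {t : ℝ} (ht : 0 ≤ t) :
    x t = NormedSpace.exp (t • T) (x 0) := by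
  have : CompleteSpace F := FiniteDimensional.complete ℝ F
  have hconst := ((h.exp_neg_smul T) t ht).2
  simp only [sub_self, map_zero, intervalIntegral.integral_zero, add_zero, neg_zero,
    exp_zero_smul_apply] at hconst
  rw [← hconst, exp_smul_exp_smul_apply, add_neg_cancel, exp_zero_smul_apply]

end LinearFlow

section Consensus

variable {F : Type*} [NormedAddCommGroup F] [NormedSpace ℝ F]

theorem norm_sum_smul_delay_le {ι : Type*} [Fintype ι] {a m θ : ι → ℝ} (ha : ∀ j, 0 ≤ a j)
    (hm : ∀ j, 0 ≤ m j) {κ θbar K T s : ℝ} (hκ : 0 ≤ κ) (hK : 0 ≤ K) (hs : 0 ≤ s) (hsT : s ≤ T)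
    (hθ : ∀ j, a j ≠ 0 → 0 ≤ θ j ∧ θ j ≤ θbar) {d : ι → ℝ → F}
    (hd : ∀ j t, -θbar ≤ t → t ≤ T → ‖d j t‖ ≤ K * m j * Real.exp (-κ * t)) :
    ‖∑ j, a j • d j (s - θ j)‖
      ≤ K * Real.exp (-κ * s) * ∑ j, a j * (m j * Real.exp (κ * θbar)) := by
  refine (norm_sum_le _ _).trans ?_
  rw [Finset.mul_sum]
  refine Finset.sum_le_sum fun j _ => ?_
  rw [norm_smul, Real.norm_of_nonneg (ha j)]
  by_cases hj : a j = 0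
  · simp [hj]
  obtain ⟨hθ0, hθbar⟩ := hθ j hj
  have hexp : Real.exp (-κ * (s - θ j)) ≤ Real.exp (-κ * s) * Real.exp (κ * θbar) := by
    rw [← Real.exp_add, Real.exp_le_exp]
    nlinarith
  calc a j * ‖d j (s - θ j)‖
      ≤ a j * (K * m j * Real.exp (-κ * (s - θ j))) :=
        mul_le_mul_of_nonneg_left (hd j _ (by linarith) (by linarith)) (ha j)
    _ ≤ a j * (K * m j * (Real.exp (-κ * s) * Real.exp (κ * θbar))) :=
        mul_le_mul_of_nonneg_left
          (mul_le_mul_of_nonneg_left hexp (mul_nonneg hK (hm j))) (ha j)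
    _ = _ := by ring

theorem exists_forall_le_of_continuousOn {ι X : Type*} [Finite ι] [Nonempty ι] [TopologicalSpace X]
    {s : Set X} (hs : IsCompact s) (hne : s.Nonempty) {φ : ι → X → ℝ}
    (hφ : ∀ i, ContinuousOn (φ i) s) : ∃ k, ∃ y ∈ s, ∀ i, ∀ x ∈ s, φ i x ≤ φ k y := by
  choose σ hσ hmax using fun i => hs.exists_isMaxOn hne (hφ i)
  obtain ⟨k, hk⟩ := Finite.exists_max fun i => φ i (σ i)
  exact ⟨k, σ k, hσ k, fun i x hx => (hmax i hx).trans (hk i)⟩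

variable [FiniteDimensional ℝ F]

theorem IsPrimitive.exp_mul_smul {x f : ℝ → F} (h : IsPrimitive x f) (l : ℝ) :
    IsPrimitive (fun t => Real.exp (l * t) • x t)
      (fun t => Real.exp (l * t) • (f t + l • x t)) := by
  have : CompleteSpace F := FiniteDimensional.complete ℝ F
  have hexp : IsPrimitive (fun t : ℝ => Real.exp (l * t)) (fun t => Real.exp (l * t) * l) := by
    refine IsPrimitive.of_hasDerivAt (fun t => ?_) (by fun_prop)
    simpa using ((hasDerivAt_id t).const_mul l).exp
  refine (hexp.bilin (ContinuousLinearMap.lsmul ℝ ℝ) h).congr_right fun t _ => ?_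
  simp only [ContinuousLinearMap.lsmul_apply, smul_add, smul_smul]
  exact add_comm _ _

theorem exp_mul_norm_le_of_supersolution {ι : Type*} [Fintype ι] {a m : ι → ℝ}
    (ha : ∀ j, 0 ≤ a j) (hm : ∀ j, 0 ≤ m j) {μ ϵ κ θbar C K T : ℝ} (hϵ : 0 ≤ ϵ) (hκ : 0 ≤ κ)
    (hK : 0 ≤ K) (hT : 0 ≤ T) {θ : ι → ℝ → ℝ}
    (hθ : ∀ j t, a j ≠ 0 → 0 ≤ t → 0 ≤ θ j t ∧ θ j t ≤ θbar)
    (hsuper : ϵ * ∑ j, a j * (m j * Real.exp (κ * θbar)) ≤ (ϵ * ∑ j, a j - κ) * μ)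
    {d : ι → ℝ → F} {y : ℝ → F}
    (hy : IsPrimitive y fun t => ϵ • ∑ j, a j • (d j (t - θ j t) - y t)) (hy0 : ‖y 0‖ ≤ C * μ)
    (hd : ∀ j t, -θbar ≤ t → t ≤ T → ‖d j t‖ ≤ K * m j * Real.exp (-κ * t)) :
    Real.exp ((ϵ * ∑ j, a j) * T) * ‖y T‖
      ≤ C * μ + K * μ * (Real.exp ((ϵ * ∑ j, a j - κ) * T) - 1) := by
  set l := ϵ * ∑ j, a j with hl
  have hprim : IsPrimitive (fun t => Real.exp (l * t) • y t)
      (fun t => (Real.exp (l * t) * ϵ) • ∑ j, a j • d j (t - θ j t)) := by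
    refine (hy.exp_mul_smul l).congr_right fun t _ => ?_
    have hl' : l • y t = ϵ • (∑ j, a j) • y t := by rw [hl, mul_smul]
    simp only [smul_sub, Finset.sum_sub_distrib, ← Finset.sum_smul, hl', sub_add_cancel,
      smul_smul]
  have hrate (s : ℝ) (hs : s ∈ Set.Ioc 0 T) :
      ‖(Real.exp (l * s) * ϵ) • ∑ j, a j • d j (s - θ j s)‖
        ≤ K * μ * ((l - κ) * Real.exp ((l - κ) * s)) := by
    rw [norm_smul, Real.norm_of_nonneg (by positivity)]
    calc Real.exp (l * s) * ϵ * ‖∑ j, a j • d j (s - θ j s)‖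
        ≤ Real.exp (l * s) * ϵ *
          (K * Real.exp (-κ * s) * ∑ j, a j * (m j * Real.exp (κ * θbar))) := by
          gcongr
          exact norm_sum_smul_delay_le ha hm hκ hK hs.1.le hs.2 (fun j hj => hθ j s hj hs.1.le) hd
      _ = K * (Real.exp (l * s) * Real.exp (-κ * s)) *
          (ϵ * ∑ j, a j * (m j * Real.exp (κ * θbar))) := by ring
      _ ≤ K * (Real.exp (l * s) * Real.exp (-κ * s)) * ((l - κ) * μ) :=
          mul_le_mul_of_nonneg_left hsuper (by positivity)
      _ = _ := by rw [← Real.exp_add]; ring_nf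
  have hint : ‖∫ s in (0 : ℝ)..T, (Real.exp (l * s) * ϵ) • ∑ j, a j • d j (s - θ j s)‖
      ≤ K * μ * (Real.exp ((l - κ) * T) - 1) := by
    refine (intervalIntegral.norm_integral_le_of_norm_le hT (Eventually.of_forall hrate)
      (Continuous.intervalIntegrable (by fun_prop) _ _)).trans_eq ?_
    simp
  have hyT := (hprim T hT).2
  simp only [mul_zero, Real.exp_zero, one_smul] at hyT
  rw [← Real.norm_of_nonneg (Real.exp_pos (l * T)).le, ← norm_smul, hyT]
  exact (norm_add_le _ _).trans (add_le_add hy0 hint)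

variable {N : ℕ}

/-- The functions `m_j e^{-κ t}` form a supersolution of the delayed consensus dynamics
`ḋ_i(t) = ϵ ∑_j a_{ij} (d_j(t - τ_{ij}(t)) - d_i(t))` of the followers, for all delays up to
`τcbar`. It is the barrier in the comparison argument for the observer errors. -/
def IsSupersolution (a : Fin N → Fin (N + 1) → ℝ) (ϵ κ τcbar : ℝ) (m : Fin (N + 1) → ℝ) : Prop :=
  ∀ i, ϵ * ∑ j, a i j * (m j * Real.exp (κ * τcbar)) ≤ (ϵ * ∑ j, a i j - κ) * m i.succ

theorem le_of_isMaxOn_of_isSupersolution {a : Fin N → Fin (N + 1) → ℝ} (ha : ∀ i j, 0 ≤ a i j)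
    {ϵ κ τcbar C K T : ℝ} (hϵ : 0 ≤ ϵ) (hκ : 0 ≤ κ) (hC : 0 ≤ C) (hCK : C ≤ K) (hT : 0 ≤ T)
    (hτ0 : 0 ≤ τcbar) {τ : Fin N → Fin (N + 1) → ℝ → ℝ}
    (hτ : ∀ i j t, a i j ≠ 0 → 0 ≤ t → 0 ≤ τ i j t ∧ τ i j t ≤ τcbar)
    {m : Fin (N + 1) → ℝ} (hm : ∀ j, 0 < m j) (hsuper : IsSupersolution a ϵ κ τcbar m)
    {d : Fin (N + 1) → ℝ → F}
    (hd : ∀ i : Fin N, IsPrimitive (d i.succ)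
      fun t => ϵ • ∑ j, a i j • (d j (t - τ i j t) - d i.succ t))
    (hinit : ∀ j t, -τcbar ≤ t → t ≤ 0 → ‖d j t‖ ≤ C * m j * Real.exp (-κ * t))
    (hlead : ∀ t, 0 ≤ t → d 0 t = 0)
    (hK : ∀ (i : Fin N) (t : ℝ), 0 ≤ t → t ≤ T → ‖d i.succ t‖ ≤ K * m i.succ * Real.exp (-κ * t))
    {k : Fin N} (hmax : ‖d k.succ T‖ = K * m k.succ * Real.exp (-κ * T)) : K ≤ C := by
  have hall (j : Fin (N + 1)) (t : ℝ) (hτt : -τcbar ≤ t) (htT : t ≤ T) :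
      ‖d j t‖ ≤ K * m j * Real.exp (-κ * t) := by
    have hmj := (hm j).le
    rcases le_total t 0 with ht | ht
    · refine (hinit j t hτt ht).trans ?_
      gcongr
    · cases j using Fin.cases with
      | zero =>
        rw [hlead t ht, norm_zero]
        have := hC.trans hCK
        positivity
      | succ j => exact hK j t ht htT
  have hk0 : ‖d k.succ 0‖ ≤ C * m k.succ := by
    simpa using hinit k.succ 0 (by linarith) le_rfl
  have hstep := exp_mul_norm_le_of_supersolution (ha k) (fun j => (hm j).le) hϵ hκ
    (hC.trans hCK) hT (hτ k) (hsuper k) (hd k) hk0 hall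
  rw [hmax, mul_left_comm, ← Real.exp_add, ← add_mul, ← sub_eq_add_neg] at hstep
  have := hm k.succ
  nlinarith

theorem norm_le_of_isSupersolution {a : Fin N → Fin (N + 1) → ℝ} (ha : ∀ i j, 0 ≤ a i j)
    {ϵ κ τcbar C : ℝ} (hϵ : 0 ≤ ϵ) (hκ : 0 ≤ κ) (hτ0 : 0 ≤ τcbar) (hC : 0 ≤ C)
    {τ : Fin N → Fin (N + 1) → ℝ → ℝ}
    (hτ : ∀ i j t, a i j ≠ 0 → 0 ≤ t → 0 ≤ τ i j t ∧ τ i j t ≤ τcbar)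
    {m : Fin (N + 1) → ℝ} (hm : ∀ j, 0 < m j) (hsuper : IsSupersolution a ϵ κ τcbar m)
    {d : Fin (N + 1) → ℝ → F}
    (hd : ∀ i : Fin N, IsPrimitive (d i.succ)
      fun t => ϵ • ∑ j, a i j • (d j (t - τ i j t) - d i.succ t))
    (hinit : ∀ j t, -τcbar ≤ t → t ≤ 0 → ‖d j t‖ ≤ C * m j * Real.exp (-κ * t))
    (hlead : ∀ t, 0 ≤ t → d 0 t = 0) (i : Fin N) {t : ℝ} (ht : 0 ≤ t) :
    ‖d i.succ t‖ ≤ C * m i.succ * Real.exp (-κ * t) := by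
  let φ : Fin N → ℝ → ℝ := fun i s => ‖d i.succ s‖ * Real.exp (κ * s) / m i.succ
  have hφ (i : Fin N) : ContinuousOn (φ i) (Set.Icc 0 t) := by
    have := (hd i).continuousOn.mono (Set.Icc_subset_Ici_self : Set.Icc 0 t ⊆ _)
    fun_prop
  have hnorm (i : Fin N) (s : ℝ) : ‖d i.succ s‖ = φ i s * m i.succ * Real.exp (-κ * s) := by
    rw [div_mul_cancel₀ _ (hm i.succ).ne', mul_assoc, ← Real.exp_add]
    simp
  have : Nonempty (Fin N) := ⟨i⟩
  obtain ⟨k, T, hT, hmax⟩ := exists_forall_le_of_continuousOn isCompact_Icc ⟨0, le_rfl, ht⟩ hφ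
  have hbound (i : Fin N) (s : ℝ) (hs : 0 ≤ s) (hst : s ≤ t) :
      ‖d i.succ s‖ ≤ φ k T * m i.succ * Real.exp (-κ * s) := by
    rw [hnorm]
    have := (hm i.succ).le
    gcongr
    exact hmax i s ⟨hs, hst⟩
  have hle : φ k T ≤ C := by
    by_contra! hlt
    exact hlt.not_ge <| le_of_isMaxOn_of_isSupersolution ha hϵ hκ hC hlt.le hT.1 hτ0 hτ hm hsuper
      hd hinit hlead (fun i s hs hsT => hbound i s hs (hsT.trans hT.2)) (hnorm k T)
  refine (hbound i t ht le_rfl).trans ?_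
  have := (hm i.succ).le
  gcongr

end Consensus

section Weights

variable {N : ℕ}

/-- The weights `a_{ij}` of the neighbours of follower `i` with self-loops removed, so that the
observer is a sum over all agents. -/
def coupling (G : Digraph (Fin (N + 1))) (i : Fin N) (j : Fin (N + 1)) : ℝ :=
  if j = i.succ then 0 else weight G i.succ j

theorem weight_nonneg (G : Digraph (Fin (N + 1))) (i j : Fin (N + 1)) : 0 ≤ weight G i j := by
  unfold weight
  split_ifs <;> norm_num

theorem weight_le_one (G : Digraph (Fin (N + 1))) (i j : Fin (N + 1)) : weight G i j ≤ 1 := by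
  unfold weight
  split_ifs <;> norm_num

theorem coupling_nonneg (G : Digraph (Fin (N + 1))) (i : Fin N) (j : Fin (N + 1)) :
    0 ≤ coupling G i j := by
  unfold coupling
  split_ifs
  · exact le_rfl
  · exact weight_nonneg _ _ _

theorem coupling_le_one (G : Digraph (Fin (N + 1))) (i : Fin N) (j : Fin (N + 1)) :
    coupling G i j ≤ 1 := by
  unfold coupling
  split_ifs
  · exact zero_le_one
  · exact weight_le_one _ _ _

theorem adj_of_coupling_ne_zero {G : Digraph (Fin (N + 1))} {i : Fin N} {j : Fin (N + 1)}
    (h : coupling G i j ≠ 0) : G.Adj j i.succ := by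
  by_contra hn
  exact h (by simp [coupling, weight, hn])

/-- The vertex `i` is reached from the leader by a walk of length `k`. The least such `k` ranks
the vertices. -/
def ReachableIn (G : Digraph (Fin (N + 1))) : ℕ → Fin (N + 1) → Prop
  | 0, i => i = 0
  | k + 1, i => ∃ j, ReachableIn G k j ∧ G.Adj j i

theorem LeaderRooted.exists_reachableIn {G : Digraph (Fin (N + 1))} (hG : LeaderRooted G)
    (i : Fin (N + 1)) : ∃ k, ReachableIn G k i := by
  induction hG i with
  | refl => exact ⟨0, rfl⟩
  | tail _ hadj ih =>
    obtain ⟨k, hk⟩ := ih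
    exact ⟨k + 1, _, hk, hadj⟩

theorem LeaderRooted.exists_rank {G : Digraph (Fin (N + 1))} (hG : LeaderRooted G) :
    ∃ r : Fin (N + 1) → ℕ, ∀ i : Fin N, ∃ j, G.Adj j i.succ ∧ r j < r i.succ := by
  classical
  let r : Fin (N + 1) → ℕ := fun i => Nat.find (hG.exists_reachableIn i)
  refine ⟨r, fun i => ?_⟩
  have hspec : ReachableIn G (r i.succ) i.succ := Nat.find_spec (hG.exists_reachableIn i.succ)
  rcases hk : r i.succ with _ | k
  · rw [hk] at hspec
    exact absurd hspec (Fin.succ_ne_zero i)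
  · rw [hk] at hspec
    obtain ⟨j, hj, hadj⟩ := hspec
    exact ⟨j, hadj, Nat.lt_succ_of_le (Nat.find_min' (hG.exists_reachableIn j) hj)⟩

theorem sum_mul_one_sub_pow_lt {ι : Type*} [Fintype ι] {a : ι → ℝ} (h0 : ∀ j, 0 ≤ a j)
    (h1 : ∀ j, a j ≤ 1) {r : ι → ℕ} {s : ℕ} {ρ : ℝ} (hρ0 : 0 < ρ) (hρ1 : ρ ≤ 1)
    (hρ : Fintype.card ι * ρ < 1) {k : ι} (hk : a k = 1) (hks : r k < s) :
    ∑ j, a j * (1 - ρ ^ (r j + 1)) < (∑ j, a j) * (1 - ρ ^ (s + 1)) := by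
  have hlower : ρ ^ s ≤ ∑ j, a j * ρ ^ (r j + 1) :=
    calc ρ ^ s ≤ a k * ρ ^ (r k + 1) := by
          rw [hk, one_mul]
          exact pow_le_pow_of_le_one hρ0.le hρ1 hks
      _ ≤ _ := Finset.single_le_sum (f := fun j => a j * ρ ^ (r j + 1))
          (fun j _ => mul_nonneg (h0 j) (by positivity)) (Finset.mem_univ k)
  have hupper : (∑ j, a j) * ρ ^ (s + 1) < ρ ^ s :=
    calc (∑ j, a j) * ρ ^ (s + 1) ≤ Fintype.card ι * ρ ^ (s + 1) := by
          gcongr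
          simpa using Finset.sum_le_sum fun j (_ : j ∈ Finset.univ) => h1 j
      _ = ρ ^ s * (Fintype.card ι * ρ) := by ring
      _ < ρ ^ s := mul_lt_of_lt_one_right (by positivity) hρ
  simp only [mul_sub, mul_one, Finset.sum_sub_distrib]
  linarith

theorem LeaderRooted.exists_potential {G : Digraph (Fin (N + 1))} (hG : LeaderRooted G) :
    ∃ m : Fin (N + 1) → ℝ, (∀ j, 1 / 2 ≤ m j) ∧ (∀ j, m j ≤ 1) ∧
      ∀ i : Fin N, ∑ j, coupling G i j * m j < (∑ j, coupling G i j) * m i.succ := by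
  obtain ⟨r, hr⟩ := hG.exists_rank
  set ρ : ℝ := 1 / (N + 2) with hρ
  have hρ0 : 0 < ρ := by positivity
  have hρ1 : ρ ≤ 1 / 2 :=
    one_div_le_one_div_of_le (by norm_num) (by linarith [(Nat.cast_nonneg N : (0 : ℝ) ≤ N)])
  refine ⟨fun j => 1 - ρ ^ (r j + 1), fun j => ?_, fun j => ?_, fun i => ?_⟩
  · have : ρ ^ (r j + 1) ≤ ρ := pow_le_of_le_one hρ0.le (by linarith) (Nat.succ_ne_zero _)
    linarith
  · exact sub_le_self 1 (by positivity)
  · obtain ⟨k, hadj, hlt⟩ := hr i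
    have hne : k ≠ i.succ := fun h => by simp [h] at hlt
    refine sum_mul_one_sub_pow_lt (coupling_nonneg G i) (coupling_le_one G i) hρ0 (by linarith) ?_
      (by simp [coupling, hne, weight, hadj]) hlt
    rw [hρ, Fintype.card_fin, mul_one_div, div_lt_one (by positivity)]
    push_cast
    linarith

theorem LeaderRooted.exists_isSupersolution {G : Digraph (Fin (N + 1))} (hG : LeaderRooted G)
    {ϵ : ℝ} (hϵ : 0 < ϵ) (τcbar : ℝ) :
    ∃ (m : Fin (N + 1) → ℝ) (κ : ℝ), 0 < κ ∧ (∀ j, 1 / 2 ≤ m j) ∧ (∀ j, m j ≤ 1) ∧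
      IsSupersolution (coupling G) ϵ κ τcbar m := by
  obtain ⟨m, hm_ge, hm_le, hm⟩ := hG.exists_potential
  have hev : ∀ᶠ κ in 𝓝[>] (0 : ℝ), IsSupersolution (coupling G) ϵ κ τcbar m := by
    refine eventually_all.2 fun i => ?_
    have hleft : Continuous fun κ : ℝ =>
      ϵ * ∑ j, coupling G i j * (m j * Real.exp (κ * τcbar)) := by fun_prop
    have hright : Continuous fun κ : ℝ => (ϵ * ∑ j, coupling G i j - κ) * m i.succ := by fun_prop
    have hlt : ∀ᶠ κ in 𝓝 (0 : ℝ), ϵ * ∑ j, coupling G i j * (m j * Real.exp (κ * τcbar))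
        < (ϵ * ∑ j, coupling G i j - κ) * m i.succ := by
      refine (hleft.tendsto 0).eventually_lt (hright.tendsto 0) ?_
      simp only [zero_mul, Real.exp_zero, mul_one, sub_zero, mul_assoc]
      exact mul_lt_mul_of_pos_left (hm i) hϵ
    exact (hlt.filter_mono nhdsWithin_le_nhds).mono fun κ h => h.le
  obtain ⟨κ, hκ, hκ0⟩ := (hev.and self_mem_nhdsWithin).exists
  exact ⟨m, κ, hκ0, hm_ge, hm_le, hκ⟩

end Weights

section Observer

variable {N n : ℕ}

theorem observerRHS_eq (G : Digraph (Fin (N + 1))) (ϵ : ℝ)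
    (τc : Fin N → Fin (N + 1) → ℝ → ℝ) (A : Matrix (Fin n) (Fin n) ℝ)
    (x₀ : ℝ → E n) (ξ : Fin N → ℝ → E n) (i : Fin N) (t : ℝ) :
    observerRHS G ϵ τc A x₀ ξ i t = clm A (ξ i t) + ϵ • ∑ j, coupling G i j •
      (NormedSpace.exp (τc i j t • clm A) ((Fin.cons x₀ ξ : Fin (N + 1) → ℝ → E n) j
        (t - τc i j t)) - ξ i t) := by
  have hclm (s : ℝ) (v : E n) : (NormedSpace.exp (s • A)).toEuclideanLin v
      = NormedSpace.exp (s • clm A) v := by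
    rw [toEuclideanLin_exp]
    simp [clm]
  have hleader : coupling G i 0 = weight G i.succ 0 := by
    simp [coupling, (Fin.succ_ne_zero i).symm]
  have hself : coupling G i i.succ = 0 := by simp [coupling]
  have hother : ∀ j ∈ Finset.univ.erase i, weight G i.succ j.succ = coupling G i j.succ := by
    intro j hj
    simp [coupling, Finset.ne_of_mem_erase hj]
  rw [observerRHS, Fin.sum_univ_succ, ← Finset.add_sum_erase _ _ (Finset.mem_univ i), hself,
    zero_smul, zero_add, hleader, smul_add, smul_smul,
    Finset.sum_congr rfl fun j hj => by rw [hother j hj]]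
  simp only [Fin.cons_zero, Fin.cons_succ, hclm, clm_apply]
  abel

theorem CommDelays.bar_nonneg {G : Digraph (Fin (N + 1))} {τcbar : ℝ}
    {τc : Fin N → Fin (N + 1) → ℝ → ℝ} (hτc : CommDelays G τcbar τc) (hG : LeaderRooted G)
    (i : Fin N) : 0 ≤ τcbar := by
  obtain ⟨r, hr⟩ := hG.exists_rank
  obtain ⟨j, hadj, _⟩ := hr i
  exact (hτc.nonneg i j 0 hadj le_rfl).trans (hτc.le_bar i j 0 hadj le_rfl)

/-- The estimates of the leader state in the frame moving with the leader flow,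
`e^{-tT} X_j(t) - x₀(0)` with `X_0 = x₀` and `X_j = ξ_j`. In this frame the observers follow the
delayed consensus dynamics with the leader at rest at `0`. -/
def frameError {F : Type*} [NormedAddCommGroup F] [NormedSpace ℝ F] (T : F →L[ℝ] F) (x₀ : ℝ → F)
    (ξ : Fin N → ℝ → F) (j : Fin (N + 1)) (t : ℝ) : F :=
  NormedSpace.exp ((-t) • T) ((Fin.cons x₀ ξ : Fin (N + 1) → ℝ → F) j t) - x₀ 0

section FrameError

variable {F : Type*} [NormedAddCommGroup F] [NormedSpace ℝ F] [FiniteDimensional ℝ F]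
  {T : F →L[ℝ] F} {x₀ : ℝ → F}

theorem frameError_zero (hx₀ : IsPrimitive x₀ fun t => T (x₀ t)) (ξ : Fin N → ℝ → F) {t : ℝ}
    (ht : 0 ≤ t) : frameError T x₀ ξ 0 t = 0 := by
  have : CompleteSpace F := FiniteDimensional.complete ℝ F
  rw [frameError, Fin.cons_zero, hx₀.eq_exp_smul T ht, exp_smul_exp_smul_apply, neg_add_cancel,
    exp_zero_smul_apply, sub_self]

theorem sub_eq_exp_smul_frameError (hx₀ : IsPrimitive x₀ fun t => T (x₀ t)) (ξ : Fin N → ℝ → F)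
    (i : Fin N) {t : ℝ} (ht : 0 ≤ t) :
    ξ i t - x₀ t = NormedSpace.exp (t • T) (frameError T x₀ ξ i.succ t) := by
  have : CompleteSpace F := FiniteDimensional.complete ℝ F
  rw [frameError, Fin.cons_succ, map_sub, exp_smul_exp_smul_apply, add_neg_cancel,
    exp_zero_smul_apply, ← hx₀.eq_exp_smul T ht]

theorem exists_norm_frameError_le (N : ℕ) (T : F →L[ℝ] F) (θ : ℝ) :
    ∃ K : ℝ, 0 ≤ K ∧ ∀ (x₀ : ℝ → F) (ξ : Fin N → ℝ → F) (D : ℝ),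
      (∀ s ∈ Set.Icc (-θ) 0, ‖x₀ s‖ ≤ D) → (∀ i t, t ≤ 0 → ξ i t = 0) →
      ∀ j, ∀ t ∈ Set.Icc (-θ) 0, ‖frameError T x₀ ξ j t‖ ≤ K * D := by
  have : CompleteSpace F := FiniteDimensional.complete ℝ F
  obtain ⟨K, hK⟩ := (isCompact_Icc (a := -θ) (b := 0)).exists_bound_of_continuousOn
    (continuous_exp_neg_smul T).continuousOn
  refine ⟨max K 0 + 1, by positivity, fun x₀ ξ D hD hξ j t ht => ?_⟩
  have hD0 : 0 ≤ D := (norm_nonneg _).trans (hD t ht)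
  have hX : ‖(Fin.cons x₀ ξ : Fin (N + 1) → ℝ → F) j t‖ ≤ D := by
    cases j using Fin.cases with
    | zero => exact hD t ht
    | succ j => simpa [hξ j t ht.2] using hD0
  have hexp : ‖NormedSpace.exp ((-t) • T)‖ ≤ max K 0 := (hK t ht).trans (le_max_left K 0)
  rw [frameError, add_mul, one_mul]
  refine (norm_sub_le _ _).trans (add_le_add ?_ (hD 0 ⟨ht.1.trans ht.2, le_rfl⟩))
  exact ContinuousLinearMap.le_of_opNorm_le_of_le _ hexp hX

end FrameError

theorem isPrimitive_frameError {G : Digraph (Fin (N + 1))} {ϵ : ℝ}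
    {τc : Fin N → Fin (N + 1) → ℝ → ℝ} {A : Matrix (Fin n) (Fin n) ℝ} {x₀ : ℝ → E n}
    {ξ : Fin N → ℝ → E n} {i : Fin N} (hξ : IsSolution (ξ i) (observerRHS G ϵ τc A x₀ ξ i)) :
    IsPrimitive (frameError (clm A) x₀ ξ i.succ) fun t => ϵ • ∑ j, coupling G i j •
      (frameError (clm A) x₀ ξ j (t - τc i j t) - frameError (clm A) x₀ ξ i.succ t) := by
  refine ((hξ.isPrimitive.exp_neg_smul (clm A)).sub (.const (x₀ 0))).congr_right fun t _ => ?_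
  simp only [observerRHS_eq, add_sub_cancel_left, map_smul, map_sum, map_sub, sub_zero,
    exp_smul_exp_smul_apply, frameError, sub_sub_sub_cancel_right, Fin.cons_succ, neg_sub,
    neg_add_eq_sub]

theorem exists_observer_error_bound {G : Digraph (Fin (N + 1))} (hG : LeaderRooted G)
    {ϵ : ℝ} (hϵ : 0 < ϵ) {τcbar : ℝ} {τc : Fin N → Fin (N + 1) → ℝ → ℝ}
    (hτc : CommDelays G τcbar τc) {A : Matrix (Fin n) (Fin n) ℝ} (hA : NoUnstableEigenvalue A) :
    ∃ c κ : ℝ, 0 ≤ c ∧ 0 < κ ∧ ∀ (x₀ : ℝ → E n) (ξ : Fin N → ℝ → E n) (D : ℝ),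
      IsSolution x₀ (fun t => A.toEuclideanLin (x₀ t)) → (∀ i t, t ≤ 0 → ξ i t = 0) →
      (∀ i, IsSolution (ξ i) (observerRHS G ϵ τc A x₀ ξ i)) →
      (∀ s ∈ Set.Icc (-τcbar) 0, ‖x₀ s‖ ≤ D) →
      ∀ i t, 0 ≤ t → ‖ξ i t - x₀ t‖ ≤ c * D * Real.exp (-κ * t) := by
  obtain ⟨m, κ, hκ, hm_ge, hm_le, hsuper⟩ := hG.exists_isSupersolution hϵ τcbar
  obtain ⟨c, hc, hgrow⟩ := hA.exists_norm_exp_le (half_pos hκ)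
  obtain ⟨K, hK, hframe⟩ := exists_norm_frameError_le N (clm A) τcbar
  refine ⟨c * (2 * K), κ / 2, by positivity, by positivity, ?_⟩
  intro x₀ ξ D hx₀ hξ0 hξ hD i t ht
  have hτ0 : 0 ≤ τcbar := hτc.bar_nonneg hG i
  have hD0 : 0 ≤ D := (norm_nonneg _).trans (hD 0 ⟨by linarith, le_rfl⟩)
  have hinit (j : Fin (N + 1)) (t : ℝ) (hτt : -τcbar ≤ t) (ht : t ≤ 0) :
      ‖frameError (clm A) x₀ ξ j t‖ ≤ 2 * K * D * m j * Real.exp (-κ * t) := by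
    have hexp : (1 : ℝ) ≤ Real.exp (-κ * t) := Real.one_le_exp (by nlinarith)
    have hone : (1 : ℝ) ≤ 2 * m j * Real.exp (-κ * t) := by nlinarith [hm_ge j]
    calc _ ≤ K * D := hframe x₀ ξ D hD hξ0 j t ⟨hτt, ht⟩
      _ ≤ K * D * (2 * m j * Real.exp (-κ * t)) := le_mul_of_one_le_right (by positivity) hone
      _ = _ := by ring
  have hdelay (i : Fin N) (j : Fin (N + 1)) (t : ℝ) (hij : coupling G i j ≠ 0) (ht : 0 ≤ t) :
      0 ≤ τc i j t ∧ τc i j t ≤ τcbar :=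
    ⟨hτc.nonneg i j t (adj_of_coupling_ne_zero hij) ht,
      hτc.le_bar i j t (adj_of_coupling_ne_zero hij) ht⟩
  have hdecay := norm_le_of_isSupersolution (coupling_nonneg G) hϵ.le hκ.le hτ0
    (by positivity) hdelay (fun j => one_half_pos.trans_le (hm_ge j)) hsuper
    (fun i => isPrimitive_frameError (hξ i)) hinit
    (fun t => frameError_zero (T := clm A) hx₀ ξ) i ht
  rw [sub_eq_exp_smul_frameError (T := clm A) hx₀ ξ i ht]
  calc _ ≤ (c * Real.exp (κ / 2 * t)) * (2 * K * D * 1 * Real.exp (-κ * t)) := by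
        refine ContinuousLinearMap.le_of_opNorm_le_of_le _ (hgrow t ht) (hdecay.trans ?_)
        gcongr
        exact hm_le _
    _ = c * (2 * K) * D * (Real.exp (κ / 2 * t) * Real.exp (-κ * t)) := by ring
    _ = _ := by rw [← Real.exp_add]; ring_nf

end Observer

section Form

variable {n m l : ℕ}

/-- The bilinear form `(a, b) ↦ aᵀ R b` of a matrix, as a bundled continuous bilinear map. Block
matrix inequalities are read as inequalities between such forms. -/
def form (R : Matrix (Fin m) (Fin n) ℝ) : E m →L[ℝ] E n →L[ℝ] ℝ :=
  (innerSL ℝ).bilinearComp (ContinuousLinearMap.id ℝ (E m)) (clm R)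

theorem form_apply (R : Matrix (Fin m) (Fin n) ℝ) (a : E m) (b : E n) :
    form R a b = inner ℝ a (clm R b) := rfl

theorem form_eq_dotProduct (R : Matrix (Fin m) (Fin n) ℝ) (a : E m) (b : E n) :
    form R a b = a.ofLp ⬝ᵥ R.mulVec b.ofLp := by
  rw [form_apply, EuclideanSpace.inner_eq_star_dotProduct, dotProduct_comm]
  rfl

theorem form_add (R S : Matrix (Fin m) (Fin n) ℝ) (a : E m) (b : E n) :
    form (R + S) a b = form R a b + form S a b := by
  simp [form_eq_dotProduct, Matrix.add_mulVec]

theorem form_sub (R S : Matrix (Fin m) (Fin n) ℝ) (a : E m) (b : E n) :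
    form (R - S) a b = form R a b - form S a b := by
  simp [form_eq_dotProduct, Matrix.sub_mulVec]

theorem form_neg (R : Matrix (Fin m) (Fin n) ℝ) (a : E m) (b : E n) :
    form (-R) a b = -form R a b := by
  simp [form_eq_dotProduct, Matrix.neg_mulVec]

theorem form_smul (c : ℝ) (R : Matrix (Fin m) (Fin n) ℝ) (a : E m) (b : E n) :
    form (c • R) a b = c * form R a b := by
  simp [form_eq_dotProduct, Matrix.smul_mulVec]

theorem form_zero (a : E m) (b : E n) : form (0 : Matrix (Fin m) (Fin n) ℝ) a b = 0 := by
  simp [form_eq_dotProduct]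

theorem form_one (a b : E n) : form (1 : Matrix (Fin n) (Fin n) ℝ) a b = inner ℝ a b := by
  rw [form_eq_dotProduct, EuclideanSpace.inner_eq_star_dotProduct, dotProduct_comm]
  simp

theorem form_transpose (R : Matrix (Fin m) (Fin n) ℝ) (a : E n) (b : E m) :
    form R.transpose a b = form R b a := by
  rw [form_eq_dotProduct, form_eq_dotProduct, Matrix.mulVec_transpose, dotProduct_comm,
    Matrix.dotProduct_mulVec]

theorem form_mul_right (R : Matrix (Fin m) (Fin n) ℝ) (T : Matrix (Fin n) (Fin l) ℝ) (a : E m)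
    (b : E l) : form (R * T) a b = form R a (clm T b) := by
  simp only [form_apply, clm_mul_apply]

theorem form_comm {R : Matrix (Fin n) (Fin n) ℝ} (hR : R.IsHermitian) (a b : E n) :
    form R a b = form R b a := by
  rw [← form_transpose, ← Matrix.conjTranspose_eq_transpose_of_trivial, hR.eq]

theorem form_self_nonneg {R : Matrix (Fin n) (Fin n) ℝ} (hR : R.PosSemidef) (a : E n) :
    0 ≤ form R a a := by
  rw [form_eq_dotProduct]
  simpa using hR.dotProduct_mulVec_nonneg a.ofLp

theorem form_unbar (P M : Matrix (Fin n) (Fin n) ℝ) (a : E n) :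
    form (unbar P M) a a = form P (clm M⁻¹ a) (clm M⁻¹ a) := by
  rw [unbar, form_mul_right, ← form_transpose, Matrix.transpose_mul, form_mul_right,
    Matrix.transpose_transpose, form_transpose]

theorem form_self_eq_sum_eigenvalues {P : Matrix (Fin n) (Fin n) ℝ} (hP : P.IsHermitian)
    (z : E n) :
    form P z z = ∑ i, hP.eigenvalues i * inner ℝ (hP.eigenvectorBasis i) z ^ 2 := by
  rw [form_apply, ← hP.eigenvectorBasis.sum_inner_mul_inner]
  refine Finset.sum_congr rfl fun i _ => ?_
  have heigen : clm P (hP.eigenvectorBasis i) = hP.eigenvalues i • hP.eigenvectorBasis i := by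
    ext j
    simpa [clm_apply, Matrix.toLpLin_apply] using congrFun (hP.mulVec_eigenvectorBasis i) j
  rw [← form_apply, form_comm hP, form_apply, heigen, inner_smul_right, real_inner_comm z,
    real_inner_comm (hP.eigenvectorBasis i) z]
  ring

theorem lambdaMin_mul_norm_sq_le {P : Matrix (Fin n) (Fin n) ℝ} (hP : P.IsHermitian) (z : E n) :
    lambdaMin P * ‖z‖ ^ 2 ≤ form P z z := by
  rw [form_self_eq_sum_eigenvalues hP, ← hP.eigenvectorBasis.sum_sq_inner_right z, Finset.mul_sum]
  refine Finset.sum_le_sum fun i _ => mul_le_mul_of_nonneg_right ?_ (sq_nonneg _)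
  rw [lambdaMin, hP.spectrum_real_eq_range_eigenvalues]
  exact csInf_le (Set.finite_range _).bddBelow ⟨i, rfl⟩

theorem lambdaMin_pos [Nonempty (Fin n)] {P : Matrix (Fin n) (Fin n) ℝ} (hP : P.PosDef) :
    0 < lambdaMin P := by
  rw [lambdaMin, hP.isHermitian.spectrum_real_eq_range_eigenvalues]
  obtain ⟨i, hi⟩ := (Set.range_nonempty hP.isHermitian.eigenvalues).csInf_mem (Set.finite_range _)
  rw [← hi]
  exact hP.eigenvalues_pos i

end Form

section LinearMatrixInequality

variable {n p : ℕ} {A : Matrix (Fin n) (Fin n) ℝ} {B : Matrix (Fin n) (Fin p) ℝ}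
  {τbar τhat δ γ ε : ℝ} {P Q R S S₁₂ M : Matrix (Fin n) (Fin n) ℝ} {Y : Matrix (Fin p) (Fin n) ℝ}

theorem dotProduct_comp_mulVec {ι : Type*} [Fintype ι]
    (Φ : Matrix ι ι (Matrix (Fin n) (Fin n) ℝ)) (x : ι → E n) :
    (fun k : ι × Fin n => x k.1 k.2) ⬝ᵥ
      (Matrix.comp ι ι (Fin n) (Fin n) ℝ Φ).mulVec (fun k => x k.1 k.2)
      = ∑ i, ∑ j, form (Φ i j) (x i) (x j) := by
  simp only [form_eq_dotProduct, dotProduct, Matrix.mulVec, Matrix.comp_apply,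
    Fintype.sum_prod_type, Finset.mul_sum]
  refine Finset.sum_congr rfl fun i _ => ?_
  rw [Finset.sum_comm]

theorem dotProduct_phi2_mulVec (hR : R.IsHermitian) (a b c d w : E n) :
    (fun k : Fin 5 × Fin n => (![a, b, c, d, w] : Fin 5 → E n) k.1 k.2) ⬝ᵥ
      (Phi2 A B τbar τhat δ γ ε P Q R S S₁₂ M Y).mulVec
        (fun k => (![a, b, c, d, w] : Fin 5 → E n) k.1 k.2)
      = 2 * δ * form P a a + 2 * form P a b + form S a a + form Q a a
        - Real.exp (-2 * δ * τbar) * form S c c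
        - (1 - τhat) * Real.exp (-2 * δ * τbar) * form Q d d + τbar ^ 2 * form R b b
        - Real.exp (-2 * δ * τbar) *
          (form R (a - d) (a - d) + 2 * form S₁₂ (a - d) (d - c) + form R (d - c) (d - c))
        - γ * ‖w‖ ^ 2
        + 2 * (form (A * M) a a + form (B * Y) a d + inner ℝ a w - form M a b)
        + 2 * ε * (form (A * M) b a + form (B * Y) b d + inner ℝ b w - form M b b) := by
  unfold Phi2
  rw [dotProduct_comp_mulVec]
  simp only [Fin.sum_univ_five, Matrix.of_apply, Matrix.cons_val, ← Matrix.transpose_mul,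
    form_add, form_sub, form_neg, form_smul, form_transpose, form_zero, form_one, map_sub,
    sub_apply, Matrix.transpose_add, Matrix.transpose_sub, Matrix.transpose_smul,
    Matrix.transpose_transpose, real_inner_self_eq_norm_sq]
  rw [form_comm hR d a, form_comm hR c d, real_inner_comm a w, real_inner_comm b w]
  ring

theorem LMISolution.isUnit_det (h : LMISolution A B τbar τhat δ γ ε P Q R S S₁₂ M Y) :
    IsUnit M.det := by
  rw [← Matrix.isUnit_iff_isUnit_det, ← Matrix.mulVec_injective_iff_isUnit]
  refine (injective_iff_map_eq_zero (Matrix.mulVecLin M)).2 fun v hv => ?_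
  by_contra hv0
  let b : E n := WithLp.toLp 2 v
  have hx : (fun k : Fin 5 × Fin n => (![0, b, 0, 0, 0] : Fin 5 → E n) k.1 k.2) ≠ 0 := by
    intro h0
    refine hv0 (funext fun i => ?_)
    simpa [b] using congrFun h0 (1, i)
  have hpos := h.phi2_neg.dotProduct_mulVec_pos hx
  have hM : form M b b = 0 := by
    rw [form_eq_dotProduct]
    have : M.mulVec v = 0 := hv
    simp [b, this]
  have hR : 0 ≤ τbar ^ 2 * form R b b :=
    mul_nonneg (sq_nonneg _) (form_self_nonneg h.posDef_R.posSemidef b)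
  rw [star_trivial, Matrix.neg_mulVec, dotProduct_neg,
    dotProduct_phi2_mulVec h.posDef_R.isHermitian] at hpos
  simp only [hM, map_zero, zero_apply, sub_self, inner_zero_right, norm_zero] at hpos
  linarith

theorem LMISolution.form_le (h : LMISolution A B τbar τhat δ γ ε P Q R S S₁₂ M Y)
    {a b c d w : E n} (hb : clm M b = clm (A * M) a + clm (B * Y) d + w) :
    2 * δ * form P a a + 2 * form P a b + form S a a + form Q a a
        - Real.exp (-2 * δ * τbar) * form S c c
        - (1 - τhat) * Real.exp (-2 * δ * τbar) * form Q d d + τbar ^ 2 * form R b b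
      ≤ Real.exp (-2 * δ * τbar) *
          (form R (a - d) (a - d) + 2 * form S₁₂ (a - d) (d - c) + form R (d - c) (d - c))
        + γ * ‖w‖ ^ 2 := by
  have hneg := h.phi2_neg.posSemidef.dotProduct_mulVec_nonneg
    (fun k : Fin 5 × Fin n => (![a, b, c, d, w] : Fin 5 → E n) k.1 k.2)
  have hdyn (y : E n) : form M y b = form (A * M) y a + form (B * Y) y d + inner ℝ y w := by
    rw [form_apply, hb, inner_add_right, inner_add_right]
    rfl
  rw [star_trivial, Matrix.neg_mulVec, dotProduct_neg,
    dotProduct_phi2_mulVec h.posDef_R.isHermitian, hdyn a, hdyn b] at hneg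
  linarith

theorem LMISolution.posSemidef_Q (h : LMISolution A B τbar τhat δ γ ε P Q R S S₁₂ M Y) :
    Q.PosSemidef := by
  rcases lt_or_ge τhat 1 with hτ | hτ
  · exact (h.posDef_Q hτ).posSemidef
  · rw [h.zero_Q hτ]
    exact Matrix.PosSemidef.zero

theorem LMISolution.posDef_unbar (h : LMISolution A B τbar τhat δ γ ε P Q R S S₁₂ M Y) :
    (unbar P M).PosDef := by
  have hconj := h.posDef_P.conjTranspose_mul_mul_same (B := M⁻¹) (by
    rw [Matrix.mulVec_injective_iff_isUnit]
    exact Matrix.isUnit_nonsing_inv_iff.2 ((Matrix.isUnit_iff_isUnit_det _).2 h.isUnit_det))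
  rwa [Matrix.conjTranspose_eq_transpose_of_trivial] at hconj

theorem form_add_two_mul_form_add_form_nonneg (hΦ : (Phi2' R S₁₂).PosSemidef) (b a : E n) :
    0 ≤ form R b b + 2 * form S₁₂ b a + form R a a := by
  have hnonneg := hΦ.dotProduct_mulVec_nonneg (Sum.elim b.ofLp a.ofLp)
  have hform : star (Sum.elim b.ofLp a.ofLp) ⬝ᵥ (Phi2' R S₁₂).mulVec (Sum.elim b.ofLp a.ofLp)
      = form R b b + form S₁₂ b a + form S₁₂.transpose a b + form R a a := by
    rw [star_trivial, Phi2', Matrix.fromBlocks_mulVec]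
    simp only [form_eq_dotProduct, sumElim_dotProduct_sumElim, dotProduct_add,
      Sum.elim_comp_inl, Sum.elim_comp_inr]
    ring
  rw [hform, form_transpose] at hnonneg
  linarith

theorem reciprocally_convex_form_le (hΦ : (Phi2' R S₁₂).PosSemidef) {a b : E n} {α β X Y : ℝ}
    (hα : 0 ≤ α) (hβ : 0 ≤ β) (hX : 0 ≤ X) (hY : 0 ≤ Y) (hb : form R b b ≤ α * X)
    (ha : form R a a ≤ β * Y) :
    form R b b + 2 * form S₁₂ b a + form R a a ≤ (α + β) * (X + Y) := by
  have hquad (s : ℝ) : 0 ≤ form R b b * (s * s) + 2 * form S₁₂ b a * s + form R a a := by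
    have hnonneg := form_add_two_mul_form_add_form_nonneg hΦ (s • b) a
    simp only [map_smul, smul_apply, smul_eq_mul] at hnonneg
    linarith
  have ha0 : 0 ≤ form R a a := by simpa using hquad 0
  have hcross_sq : form S₁₂ b a ^ 2 ≤ (α * X) * (β * Y) := by
    have hdiscrim := discrim_le_zero hquad
    rw [discrim] at hdiscrim
    have := mul_le_mul hb ha ha0 (mul_nonneg hα hX)
    linarith
  have hcross : 2 * form S₁₂ b a ≤ β * X + α * Y := by
    refine abs_le_of_sq_le_sq' ?_ (by positivity) |>.2
    linarith [sq_nonneg (β * X - α * Y)]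
  linarith

end LinearMatrixInequality

section Jensen

variable {F : Type*} [NormedAddCommGroup F] [NormedSpace ℝ F] [CompleteSpace F]

theorem bilin_integral_integral_le {B : F →L[ℝ] F →L[ℝ] ℝ} (hsymm : ∀ x y, B x y = B y x)
    (hB : ∀ x, 0 ≤ B x x) {g : ℝ → F} {a b : ℝ} (hab : a ≤ b)
    (hg : IntervalIntegrable g volume a b)
    (hq : IntervalIntegrable (fun s => B (g s) (g s)) volume a b) :
    B (∫ s in a..b, g s) (∫ s in a..b, g s) ≤ (b - a) * ∫ s in a..b, B (g s) (g s) := by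
  rcases hab.eq_or_lt with rfl | hlt
  · simp
  have hpos : 0 < b - a := sub_pos.2 hlt
  set d := ∫ s in a..b, g s with hd
  set c : F := (b - a)⁻¹ • d with hc
  have hlin : IntervalIntegrable (fun s => B c (g s)) volume a b :=
    ⟨(B c).integrable_comp hg.1, (B c).integrable_comp hg.2⟩
  have hdev : 0 ≤ ∫ s in a..b, (B (g s) (g s) - 2 * B c (g s) + B c c) := by
    refine intervalIntegral.integral_nonneg hab fun s _ => ?_
    have hsq := hB (g s - c)
    simp only [map_sub, sub_apply, hsymm (g s) c] at hsq
    linarith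
  rw [intervalIntegral.integral_add (hq.sub (hlin.const_mul 2)) (by simp),
    intervalIntegral.integral_sub hq (hlin.const_mul 2), intervalIntegral.integral_const_mul,
    (B c).intervalIntegral_comp_comm hg, intervalIntegral.integral_const, ← hd, hc] at hdev
  simp only [map_smul, smul_apply, smul_eq_mul] at hdev
  rw [← inv_mul_le_iff₀ hpos]
  have hcancel : (b - a) * ((b - a)⁻¹ * ((b - a)⁻¹ * B d d)) = (b - a)⁻¹ * B d d :=
    mul_inv_cancel_left₀ hpos.ne' _
  linarith

end Jensen

section Windows

variable {F : Type*} [NormedAddCommGroup F] [NormedSpace ℝ F] {φ : ℝ → F}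

theorem IsPrimitive.integral (hφ : ∀ a b, IntervalIntegrable φ volume a b) :
    IsPrimitive (fun t => ∫ s in (0 : ℝ)..t, φ s) φ :=
  fun t _ => ⟨hφ 0 t, by simp⟩

theorem hasDerivAt_integral_of_continuous [CompleteSpace F] (hφ : Continuous φ) (t : ℝ) :
    HasDerivAt (fun t => ∫ s in (0 : ℝ)..t, φ s) (φ t) t :=
  (hφ.integral_hasStrictDerivAt 0 t).hasDerivAt

theorem integral_sub_const_right_eq (hφ : ∀ a b, IntervalIntegrable φ volume a b) (θ t : ℝ) :
    ∫ s in (t - θ)..t, φ s = (∫ s in (0 : ℝ)..t, φ s) - ∫ s in (0 : ℝ)..(t - θ), φ s :=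
  (intervalIntegral.integral_interval_sub_left (hφ _ _) (hφ _ _)).symm

theorem IsPrimitive.integral_window [CompleteSpace F] (hφ : Continuous φ) (θ : ℝ) :
    IsPrimitive (fun t => ∫ s in (t - θ)..t, φ s) (fun t => φ t - φ (t - θ)) := by
  simp only [integral_sub_const_right_eq hφ.intervalIntegrable]
  refine IsPrimitive.of_hasDerivAt (fun t => ?_) (by fun_prop)
  exact (hasDerivAt_integral_of_continuous hφ t).sub
    ((hasDerivAt_integral_of_continuous hφ (t - θ)).comp_sub_const t θ)

theorem IsPrimitive.integral_integral_window {ρ : ℝ → ℝ}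
    (hρ : ∀ a b, IntervalIntegrable ρ volume a b) (θ : ℝ) :
    IsPrimitive (fun t => ∫ s in (t - θ)..t, ∫ r in s..t, ρ r)
      (fun t => θ * ρ t - ∫ r in (t - θ)..t, ρ r) := by
  have hcont : Continuous fun t => ∫ r in (0 : ℝ)..t, ρ r :=
    intervalIntegral.continuous_primitive hρ 0
  have hsplit (t : ℝ) : ∫ s in (t - θ)..t, ∫ r in s..t, ρ r
      = θ * (∫ r in (0 : ℝ)..t, ρ r) - ∫ s in (t - θ)..t, ∫ r in (0 : ℝ)..s, ρ r := by
    have hinner (s : ℝ) : ∫ r in s..t, ρ r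
        = (∫ r in (0 : ℝ)..t, ρ r) - ∫ r in (0 : ℝ)..s, ρ r :=
      (intervalIntegral.integral_interval_sub_left (hρ _ _) (hρ _ _)).symm
    rw [intervalIntegral.integral_congr fun s _ => hinner s,
      intervalIntegral.integral_sub intervalIntegrable_const (hcont.intervalIntegrable _ _),
      intervalIntegral.integral_const, sub_sub_cancel, smul_eq_mul]
  simp only [hsplit, integral_sub_const_right_eq hρ]
  exact ((IsPrimitive.integral hρ).const_mul θ).sub (IsPrimitive.integral_window hcont θ)

end Windows

section InputDelay

variable {τbar τhat : ℝ} {τ : ℝ → ℝ}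

/-- The input delay of a single agent: the condition that `InputDelays` imposes on each of its
components. -/
structure IsInputDelay (τbar τhat : ℝ) (τ : ℝ → ℝ) : Prop where
  nonneg : ∀ t, 0 ≤ t → 0 ≤ τ t
  le_bar : ∀ t, 0 ≤ t → τ t ≤ τbar
  differentiableOn : DifferentiableOn ℝ τ (Set.Ici 0)
  derivWithin_le : ∀ t, 0 ≤ t → derivWithin τ (Set.Ici 0) t ≤ τhat

theorem InputDelays.isInputDelay {N : ℕ} {τu : Fin N → ℝ → ℝ} (h : InputDelays τbar τhat τu)
    (i : Fin N) : IsInputDelay τbar τhat (τu i) :=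
  ⟨h.nonneg i, h.le_bar i, h.differentiable i, h.deriv_le i⟩

theorem IsInputDelay.bar_nonneg (hτ : IsInputDelay τbar τhat τ) : 0 ≤ τbar :=
  (hτ.nonneg 0 le_rfl).trans (hτ.le_bar 0 le_rfl)

theorem IsInputDelay.continuousOn_sub (hτ : IsInputDelay τbar τhat τ) {s t : ℝ} (hs : 0 ≤ s) :
    ContinuousOn (fun r => r - τ r) (Set.Icc s t) :=
  continuousOn_id.sub (hτ.differentiableOn.continuousOn.mono fun _ hr => hs.trans hr.1)

theorem IsInputDelay.integral_window_sub_le (hτ : IsInputDelay τbar τhat τ) {φ : ℝ → ℝ}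
    (hφ : Continuous φ) (hφ0 : ∀ t, 0 ≤ φ t) {s t : ℝ} (hs : 0 ≤ s) (hst : s ≤ t) :
    (∫ r in (t - τ t)..t, φ r) - ∫ r in (s - τ s)..s, φ r
      ≤ ∫ r in s..t, (φ r - (1 - τhat) * φ (r - τ r)) := by
  have hF : Continuous fun t => ∫ r in (0 : ℝ)..t, φ r :=
    intervalIntegral.continuous_primitive hφ.intervalIntegrable 0
  simp only [integral_sub_const_right_eq hφ.intervalIntegrable]
  refine intervalIntegral.sub_le_integral_of_hasDeriv_right_of_le
    (g := fun t => (∫ r in (0 : ℝ)..t, φ r) - ∫ r in (0 : ℝ)..(t - τ t), φ r)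
    (g' := fun r => φ r - φ (r - τ r) * (1 - derivWithin τ (Set.Ici 0) r)) hst
    (hF.continuousOn.sub (hF.comp_continuousOn (hτ.continuousOn_sub hs))) (fun r hr => ?_)
    (ContinuousOn.integrableOn_Icc <| hφ.continuousOn.sub <|
      continuousOn_const.mul (hφ.comp_continuousOn (hτ.continuousOn_sub hs))) fun r hr => ?_
  · have hr0 : 0 < r := hs.trans_lt hr.1
    have hτr : HasDerivAt τ (derivWithin τ (Set.Ici 0) r) r :=
      (hτ.differentiableOn r hr0.le).hasDerivWithinAt.hasDerivAt (Ici_mem_nhds hr0)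
    have hdelayed := (hasDerivAt_integral_of_continuous hφ (r - τ r)).comp r
      ((hasDerivAt_id r).sub hτr)
    exact ((hasDerivAt_integral_of_continuous hφ r).sub hdelayed).hasDerivWithinAt
  · have := mul_le_mul_of_nonneg_right (hτ.derivWithin_le r (hs.trans hr.1.le)) (hφ0 (r - τ r))
    linarith

end InputDelay

section RestingTrajectory

variable {n : ℕ} {η g : ℝ → E n}

/-- `η` is a primitive of `g` on the whole line, with `g` locally square integrable, and is at rest
up to time `0`. This makes the delayed values at negative times available to functionals that look
back over a window. -/
structure IsRestingTrajectory (η g : ℝ → E n) : Prop where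
  intervalIntegrable : ∀ a b, IntervalIntegrable g volume a b
  sub_eq_integral : ∀ a b, η b - η a = ∫ s in a..b, g s
  intervalIntegrable_sq : ∀ a b, IntervalIntegrable (fun s => ‖g s‖ ^ 2) volume a b
  eq_zero : ∀ s ≤ 0, g s = 0

namespace IsRestingTrajectory

theorem continuous (h : IsRestingTrajectory η g) : Continuous η := by
  have hη : η = fun t => η 0 + ∫ s in (0 : ℝ)..t, g s :=
    funext fun t => by rw [← h.sub_eq_integral, add_sub_cancel]
  rw [hη]
  exact continuous_const.add (intervalIntegral.continuous_primitive h.intervalIntegrable 0)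

theorem isPrimitive (h : IsRestingTrajectory η g) : IsPrimitive η g :=
  fun t _ => ⟨h.intervalIntegrable 0 t, by rw [← h.sub_eq_integral, add_sub_cancel]⟩

theorem eq_apply_zero (h : IsRestingTrajectory η g) {s : ℝ} (hs : s ≤ 0) : η s = η 0 := by
  have hint : ∫ r in s..0, g r = 0 := intervalIntegral.integral_zero_ae <|
    Eventually.of_forall fun r hr => h.eq_zero r (Set.uIoc_of_le hs ▸ hr).2
  exact (sub_eq_zero.1 ((h.sub_eq_integral s 0).trans hint)).symm

theorem intervalIntegrable_form (h : IsRestingTrajectory η g) (R : Matrix (Fin n) (Fin n) ℝ)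
    (a b : ℝ) : IntervalIntegrable (fun s => form R (g s) (g s)) volume a b := by
  have hg : AEStronglyMeasurable g (volume.restrict (Set.uIoc a b)) :=
    (intervalIntegrable_iff.1 (h.intervalIntegrable a b)).aestronglyMeasurable
  refine ((h.intervalIntegrable_sq a b).const_mul ‖form R‖).mono_fun'
    ((form R).aestronglyMeasurable_comp₂ hg hg) (Eventually.of_forall fun s => ?_)
  simpa only [sq, mul_assoc] using (form R).le_opNorm₂ (g s) (g s)

end IsRestingTrajectory

end RestingTrajectory

section LyapunovKrasovskii

variable {n p : ℕ} {A : Matrix (Fin n) (Fin n) ℝ} {B : Matrix (Fin n) (Fin p) ℝ}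
  {τbar τhat δ γ ε : ℝ} {P Q R S S₁₂ M : Matrix (Fin n) (Fin n) ℝ} {Y : Matrix (Fin p) (Fin n) ℝ}
  {τ : ℝ → ℝ} {η g w : ℝ → E n}

/-- The energy `xᵀ T x` along a trajectory, weighted by `e^{2δs}`. -/
def weightedEnergy (δ : ℝ) (T : Matrix (Fin n) (Fin n) ℝ) (x : ℝ → E n) (s : ℝ) : ℝ :=
  Real.exp (2 * δ * s) * form T (x s) (x s)

theorem weightedEnergy_nonneg {T : Matrix (Fin n) (Fin n) ℝ} (hT : T.PosSemidef) (x : ℝ → E n)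
    (s : ℝ) : 0 ≤ weightedEnergy δ T x s :=
  mul_nonneg (Real.exp_pos _).le (form_self_nonneg hT _)

theorem continuous_weightedEnergy {x : ℝ → E n} (hx : Continuous x)
    (T : Matrix (Fin n) (Fin n) ℝ) : Continuous (weightedEnergy δ T x) := by
  unfold weightedEnergy
  fun_prop

theorem exp_mul_form_le_weightedEnergy (hδ : 0 ≤ δ) {T : Matrix (Fin n) (Fin n) ℝ}
    (hT : T.PosSemidef) (x : ℝ → E n) {r s : ℝ} (hs : r - τbar ≤ s) :
    Real.exp (2 * δ * r) * (Real.exp (-2 * δ * τbar) * form T (x s) (x s))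
      ≤ weightedEnergy δ T x s := by
  rw [← mul_assoc, ← Real.exp_add]
  refine mul_le_mul_of_nonneg_right (Real.exp_le_exp.2 ?_) (form_self_nonneg hT _)
  linarith [mul_le_mul_of_nonneg_left hs (mul_nonneg zero_le_two hδ)]

theorem IsRestingTrajectory.intervalIntegrable_weightedEnergy (h : IsRestingTrajectory η g)
    (T : Matrix (Fin n) (Fin n) ℝ) (a b : ℝ) :
    IntervalIntegrable (weightedEnergy δ T g) volume a b :=
  (h.intervalIntegrable_form T a b).continuousOn_mul (by fun_prop)

theorem form_self_le (T : Matrix (Fin n) (Fin n) ℝ) (a : E n) :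
    form T a a ≤ ‖form T‖ * ‖a‖ ^ 2 := by
  simpa only [sq, mul_assoc] using (le_abs_self _).trans ((form T).le_opNorm₂ a a)

theorem IsRestingTrajectory.integral_weightedEnergy_le (h : IsRestingTrajectory η g) (hδ : 0 ≤ δ)
    {T : Matrix (Fin n) (Fin n) ℝ} (hT : T.PosSemidef) {θ : ℝ} (hθ0 : 0 ≤ θ) (hθ : θ ≤ τbar) :
    ∫ s in (0 - θ)..0, weightedEnergy δ T η s ≤ τbar * ‖form T‖ * ‖η 0‖ ^ 2 := by
  have hle : ∀ s ∈ Set.Icc (0 - θ) 0, weightedEnergy δ T η s ≤ ‖form T‖ * ‖η 0‖ ^ 2 := by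
    intro s hs
    rw [weightedEnergy, h.eq_apply_zero hs.2]
    have hexp : Real.exp (2 * δ * s) ≤ 1 :=
      Real.exp_le_one_iff.2 (mul_nonpos_of_nonneg_of_nonpos (by positivity) hs.2)
    exact (mul_le_of_le_one_left (form_self_nonneg hT _) hexp).trans (form_self_le T _)
  have hint := intervalIntegral.integral_mono_on (μ := volume) (by linarith)
    ((continuous_weightedEnergy h.continuous T).intervalIntegrable _ _)
    intervalIntegrable_const hle
  rw [intervalIntegral.integral_const, sub_sub_cancel, smul_eq_mul] at hint
  rw [mul_assoc]
  exact hint.trans (by gcongr)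

/-- The Lyapunov–Krasovskii functional of the closed loop with input delay `τ`, in the coordinates
`η = M⁻¹ z`. It is multiplied by `e^{2δt}`, so that exponential decay becomes monotonicity. -/
def lyapunovKrasovskii (δ τbar : ℝ) (τ : ℝ → ℝ) (P Q R S : Matrix (Fin n) (Fin n) ℝ)
    (η g : ℝ → E n) (t : ℝ) : ℝ :=
  weightedEnergy δ P η t + (∫ s in (t - τbar)..t, weightedEnergy δ S η s)
    + τbar * (∫ s in (t - τbar)..t, ∫ r in s..t, weightedEnergy δ R g r)
    + ∫ s in (t - τ t)..t, weightedEnergy δ Q η s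

theorem LMISolution.weightedEnergy_le_lyapunovKrasovskii
    (h : LMISolution A B τbar τhat δ γ ε P Q R S S₁₂ M Y) (hτ : IsInputDelay τbar τhat τ)
    (η g : ℝ → E n) {t : ℝ} (ht : 0 ≤ t) :
    weightedEnergy δ P η t ≤ lyapunovKrasovskii δ τbar τ P Q R S η g t := by
  have hbar := hτ.bar_nonneg
  have hS : 0 ≤ ∫ s in (t - τbar)..t, weightedEnergy δ S η s :=
    intervalIntegral.integral_nonneg (by linarith) fun s _ =>
      weightedEnergy_nonneg h.posDef_S.posSemidef _ _
  have hQ : 0 ≤ ∫ s in (t - τ t)..t, weightedEnergy δ Q η s :=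
    intervalIntegral.integral_nonneg (by linarith [hτ.nonneg t ht]) fun s _ =>
      weightedEnergy_nonneg h.posSemidef_Q _ _
  have hR : 0 ≤ ∫ s in (t - τbar)..t, ∫ r in s..t, weightedEnergy δ R g r :=
    intervalIntegral.integral_nonneg (by linarith) fun s hs =>
      intervalIntegral.integral_nonneg hs.2 fun r _ =>
        weightedEnergy_nonneg h.posDef_R.posSemidef _ _
  rw [lyapunovKrasovskii]
  linarith [mul_nonneg hbar hR]

theorem LMISolution.lyapunovKrasovskii_zero_le
    (h : LMISolution A B τbar τhat δ γ ε P Q R S S₁₂ M Y) (hδ : 0 ≤ δ)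
    (hτ : IsInputDelay τbar τhat τ) (hη : IsRestingTrajectory η g) :
    lyapunovKrasovskii δ τbar τ P Q R S η g 0
      ≤ (‖form P‖ + τbar * ‖form S‖ + τbar * ‖form Q‖) * ‖η 0‖ ^ 2 := by
  have hR : ∫ s in (0 - τbar)..0, ∫ r in s..0, weightedEnergy δ R g r = 0 := by
    refine intervalIntegral.integral_zero_ae (Eventually.of_forall fun s hs => ?_)
    rw [Set.uIoc_of_le (by linarith [hτ.bar_nonneg])] at hs
    refine intervalIntegral.integral_zero_ae (Eventually.of_forall fun r hr => ?_)
    rw [Set.uIoc_of_le hs.2] at hr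
    simp [weightedEnergy, hη.eq_zero r hr.2]
  have hP : weightedEnergy δ P η 0 ≤ ‖form P‖ * ‖η 0‖ ^ 2 := by
    simpa [weightedEnergy] using form_self_le P (η 0)
  have hS := hη.integral_weightedEnergy_le hδ h.posDef_S.posSemidef hτ.bar_nonneg le_rfl
  have hQ := hη.integral_weightedEnergy_le hδ h.posSemidef_Q (hτ.nonneg 0 le_rfl)
    (hτ.le_bar 0 le_rfl)
  rw [lyapunovKrasovskii, hR]
  linarith

theorem LMISolution.form_le_integral_weightedEnergy
    (h : LMISolution A B τbar τhat δ γ ε P Q R S S₁₂ M Y) (hδ : 0 ≤ δ)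
    (hη : IsRestingTrajectory η g) {r θ : ℝ} (hθ0 : 0 ≤ θ) (hθ : θ ≤ τbar) :
    Real.exp (2 * δ * r) * (Real.exp (-2 * δ * τbar) *
        (form R (η r - η (r - θ)) (η r - η (r - θ))
          + 2 * form S₁₂ (η r - η (r - θ)) (η (r - θ) - η (r - τbar))
          + form R (η (r - θ) - η (r - τbar)) (η (r - θ) - η (r - τbar))))
      ≤ τbar * ∫ s in (r - τbar)..r, weightedEnergy δ R g s := by
  have hR := h.posDef_R.posSemidef
  have hq := hη.intervalIntegrable_form R
  have hjensen {a b : ℝ} (hab : a ≤ b) :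
      form R (η b - η a) (η b - η a) ≤ (b - a) * ∫ s in a..b, form R (g s) (g s) := by
    rw [hη.sub_eq_integral a b]
    exact bilin_integral_integral_le (form_comm hR.isHermitian) (form_self_nonneg hR) hab
      (hη.intervalIntegrable a b) (hq a b)
  have hint_nonneg {a b : ℝ} (hab : a ≤ b) : 0 ≤ ∫ s in a..b, form R (g s) (g s) :=
    intervalIntegral.integral_nonneg hab fun s _ => form_self_nonneg hR _
  have hθr : r - θ ≤ r := by linarith
  have hbarθ : r - τbar ≤ r - θ := by linarith
  have hsplit := reciprocally_convex_form_le h.phi2'_nonneg (by linarith) (by linarith)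
    (hint_nonneg hθr) (hint_nonneg hbarθ) (hjensen hθr) (hjensen hbarθ)
  rw [add_comm (∫ s in (r - θ)..r, form R (g s) (g s)),
    intervalIntegral.integral_add_adjacent_intervals (hq _ _) (hq _ _)] at hsplit
  have hweight : Real.exp (2 * δ * r) * (Real.exp (-2 * δ * τbar)
      * ∫ s in (r - τbar)..r, form R (g s) (g s))
      ≤ ∫ s in (r - τbar)..r, weightedEnergy δ R g s := by
    simp only [← intervalIntegral.integral_const_mul]
    exact intervalIntegral.integral_mono_on (by linarith) (((hq _ _).const_mul _).const_mul _)
      (hη.intervalIntegrable_weightedEnergy R _ _) fun s hs =>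
        exp_mul_form_le_weightedEnergy hδ hR g hs.1
  calc _ ≤ Real.exp (2 * δ * r) * (Real.exp (-2 * δ * τbar) *
        ((r - (r - θ) + (r - θ - (r - τbar))) * ∫ s in (r - τbar)..r, form R (g s) (g s))) := by
        gcongr
    _ = τbar * (Real.exp (2 * δ * r) * (Real.exp (-2 * δ * τbar)
      * ∫ s in (r - τbar)..r, form R (g s) (g s))) := by ring
    _ ≤ _ := mul_le_mul_of_nonneg_left hweight (hθ0.trans hθ)

theorem LMISolution.exp_mul_form_Q_le
    (h : LMISolution A B τbar τhat δ γ ε P Q R S S₁₂ M Y) (hδ : 0 ≤ δ) (x : ℝ → E n) {r θ : ℝ}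
    (hθ : θ ≤ τbar) :
    Real.exp (2 * δ * r) * ((1 - τhat) * Real.exp (-2 * δ * τbar)
      * form Q (x (r - θ)) (x (r - θ))) ≤ (1 - τhat) * weightedEnergy δ Q x (r - θ) := by
  rcases lt_or_ge τhat 1 with hlt | hge
  · rw [mul_assoc (1 - τhat), mul_left_comm]
    exact mul_le_mul_of_nonneg_left (exp_mul_form_le_weightedEnergy hδ h.posSemidef_Q x
      (by linarith)) (by linarith)
  · simp [weightedEnergy, h.zero_Q hge, form_zero]

/-- The derivative of the first three terms of `lyapunovKrasovskii`. -/
def lyapunovKrasovskiiDeriv (δ τbar : ℝ) (P R S : Matrix (Fin n) (Fin n) ℝ) (η g : ℝ → E n)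
    (r : ℝ) : ℝ :=
  Real.exp (2 * δ * r) * (2 * δ * form P (η r) (η r) + 2 * form P (η r) (g r))
    + (weightedEnergy δ S η r - weightedEnergy δ S η (r - τbar))
    + τbar * (τbar * weightedEnergy δ R g r - ∫ s in (r - τbar)..r, weightedEnergy δ R g s)

theorem hasDerivAt_exp_const_mul (c t : ℝ) :
    HasDerivAt (fun s => Real.exp (c * s)) (Real.exp (c * t) * c) t := by
  simpa using! ((hasDerivAt_id t).const_mul c).exp

theorem IsRestingTrajectory.isPrimitive_lyapunovKrasovskii (hη : IsRestingTrajectory η g)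
    (hP : P.IsHermitian) (δ τbar : ℝ) (R S : Matrix (Fin n) (Fin n) ℝ) :
    IsPrimitive
      (fun t => weightedEnergy δ P η t + (∫ s in (t - τbar)..t, weightedEnergy δ S η s)
        + τbar * (∫ s in (t - τbar)..t, ∫ r in s..t, weightedEnergy δ R g r))
      (lyapunovKrasovskiiDeriv δ τbar P R S η g) := by
  have hexp : IsPrimitive (fun t => Real.exp (2 * δ * t)) fun t =>
      Real.exp (2 * δ * t) * (2 * δ) :=
    IsPrimitive.of_hasDerivAt (hasDerivAt_exp_const_mul _) (by fun_prop)
  have henergy := hexp.mul (hη.isPrimitive.bilin (form P) hη.isPrimitive)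
  have hS := IsPrimitive.integral_window (continuous_weightedEnergy (δ := δ) hη.continuous S) τbar
  have hR := IsPrimitive.integral_integral_window
    (hη.intervalIntegrable_weightedEnergy (δ := δ) R) τbar
  refine ((henergy.add hS).add (hR.const_mul τbar)).congr_right fun r _ => ?_
  simp only [lyapunovKrasovskiiDeriv, form_comm hP (g r) (η r)]
  ring

theorem LMISolution.lyapunovKrasovskiiDeriv_add_le
    (h : LMISolution A B τbar τhat δ γ ε P Q R S S₁₂ M Y) (hδ : 0 ≤ δ)
    (hη : IsRestingTrajectory η g) {r θ : ℝ} (hθ0 : 0 ≤ θ) (hθ : θ ≤ τbar) {v : E n}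
    (hdyn : clm M (g r) = clm (A * M) (η r) + clm (B * Y) (η (r - θ)) + v) :
    lyapunovKrasovskiiDeriv δ τbar P R S η g r
        + (weightedEnergy δ Q η r - (1 - τhat) * weightedEnergy δ Q η (r - θ))
      ≤ γ * ‖v‖ ^ 2 * Real.exp (2 * δ * r) := by
  have hlmi := mul_le_mul_of_nonneg_left (h.form_le (c := η (r - τbar)) hdyn)
    (Real.exp_pos (2 * δ * r)).le
  have hR := h.form_le_integral_weightedEnergy hδ hη (r := r) hθ0 hθ
  have hQ := h.exp_mul_form_Q_le hδ η (r := r) hθ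
  have hS := exp_mul_form_le_weightedEnergy hδ h.posDef_S.posSemidef η (le_refl (r - τbar))
  simp only [lyapunovKrasovskiiDeriv]
  simp only [weightedEnergy] at hR hQ hS ⊢
  linarith

theorem integral_exp_const_mul {c : ℝ} (hc : c ≠ 0) (s t : ℝ) :
    ∫ r in s..t, Real.exp (c * r) = (Real.exp (c * t) - Real.exp (c * s)) / c := by
  rw [eq_div_iff hc, ← intervalIntegral.integral_mul_const]
  exact intervalIntegral.integral_eq_sub_of_hasDerivAt (fun r _ => hasDerivAt_exp_const_mul c r)
    (Continuous.intervalIntegrable (by fun_prop) _ _)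

theorem LMISolution.lyapunovKrasovskii_sub_le
    (h : LMISolution A B τbar τhat δ γ ε P Q R S S₁₂ M Y) (hδ : 0 < δ) (hγ : 0 ≤ γ)
    (hτ : IsInputDelay τbar τhat τ) (hη : IsRestingTrajectory η g)
    (hdyn : ∀ᵐ t ∂(volume.restrict (Set.Ici (0 : ℝ))),
      clm M (g t) = clm (A * M) (η t) + clm (B * Y) (η (t - τ t)) + w t)
    {s t a : ℝ} (hs : 0 ≤ s) (hst : s ≤ t)
    (hw : ∀ᵐ r ∂(volume.restrict (Set.Icc s t)), ‖w r‖ ≤ a) :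
    lyapunovKrasovskii δ τbar τ P Q R S η g t - lyapunovKrasovskii δ τbar τ P Q R S η g s
      ≤ γ / (2 * δ) * a ^ 2 * (Real.exp (2 * δ * t) - Real.exp (2 * δ * s)) := by
  have hφQ := continuous_weightedEnergy (δ := δ) hη.continuous Q
  have hprim := hη.isPrimitive_lyapunovKrasovskii h.posDef_P.isHermitian δ τbar R S
  have hderiv := hprim.intervalIntegrable hs (hs.trans hst)
  have hwindow : IntervalIntegrable (fun r => weightedEnergy δ Q η r
      - (1 - τhat) * weightedEnergy δ Q η (r - τ r)) volume s t := by
    refine ContinuousOn.intervalIntegrable ?_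
    rw [Set.uIcc_of_le hst]
    exact hφQ.continuousOn.sub (continuousOn_const.mul
      (hφQ.comp_continuousOn (hτ.continuousOn_sub hs)))
  have hdissipation : ∫ r in s..t, (lyapunovKrasovskiiDeriv δ τbar P R S η g r
        + (weightedEnergy δ Q η r - (1 - τhat) * weightedEnergy δ Q η (r - τ r)))
      ≤ ∫ r in s..t, γ * a ^ 2 * Real.exp (2 * δ * r) := by
    refine intervalIntegral.integral_mono_ae_restrict hst (hderiv.add hwindow)
      (Continuous.intervalIntegrable (by fun_prop) _ _) ?_
    filter_upwards [hw, ae_restrict_of_ae_restrict_of_subset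
      (fun r hr => hs.trans hr.1 : Set.Icc s t ⊆ Set.Ici 0) hdyn,
      ae_restrict_mem measurableSet_Icc] with r hwr hdynr hr
    have hr0 : 0 ≤ r := hs.trans hr.1
    refine (h.lyapunovKrasovskiiDeriv_add_le hδ.le hη (hτ.nonneg r hr0) (hτ.le_bar r hr0)
      hdynr).trans ?_
    gcongr
  have hQ := hτ.integral_window_sub_le hφQ (weightedEnergy_nonneg h.posSemidef_Q η) hs hst
  have hrest := hprim.sub_eq_integral hs (hs.trans hst)
  rw [intervalIntegral.integral_add hderiv hwindow, ← hrest, intervalIntegral.integral_const_mul,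
    integral_exp_const_mul (by positivity)] at hdissipation
  calc _ ≤ γ * a ^ 2 * ((Real.exp (2 * δ * t) - Real.exp (2 * δ * s)) / (2 * δ)) := by
        simp only [lyapunovKrasovskii]
        linarith
    _ = _ := by ring

end LyapunovKrasovskii

section Dissipative

variable {F : Type*} [NormedAddCommGroup F] {μ q : ℝ} {w : ℝ → F} {V : ℝ → ℝ}

/-- `V` is a storage function with decay rate `μ` and squared gain `q` for the disturbance `w`.
Only essential bounds of `w` on intervals enter, which is all that the Lyapunov argument uses. -/
structure IsDissipative (μ q : ℝ) (w : ℝ → F) (V : ℝ → ℝ) : Prop where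
  nonneg : ∀ t, 0 ≤ t → 0 ≤ V t
  le_exp_mul_add : ∀ s t a, 0 ≤ s → s ≤ t →
    (∀ᵐ r ∂(volume.restrict (Set.Icc s t)), ‖w r‖ ≤ a) →
      V t ≤ Real.exp (-μ * (t - s)) * V s + q * a ^ 2

namespace IsDissipative

theorem le_zero_add (h : IsDissipative μ q w V) (hμ : 0 ≤ μ) {a t : ℝ}
    (hw : ∀ᵐ r ∂(volume.restrict (Set.Ici (0 : ℝ))), ‖w r‖ ≤ a) (ht : 0 ≤ t) :
    V t ≤ V 0 + q * a ^ 2 := by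
  have hexp : Real.exp (-μ * (t - 0)) ≤ 1 := Real.exp_le_one_iff.2 (by nlinarith)
  exact (h.le_exp_mul_add 0 t a le_rfl ht
    (ae_restrict_of_ae_restrict_of_subset (fun r hr => hr.1) hw)).trans
    (by gcongr; exact mul_le_of_le_one_left (h.nonneg 0 le_rfl) hexp)

-- On `[0, t / 2]` the disturbance is only bounded, on `[t / 2, t]` it is of order `e^{-κt/2}`.
theorem le_mul_exp (h : IsDissipative μ q w V) (hμ : 0 ≤ μ) (hq : 0 ≤ q) {a κ t : ℝ} (ha : 0 ≤ a)
    (hκ : 0 ≤ κ)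
    (hw : ∀ᵐ r ∂(volume.restrict (Set.Ici (0 : ℝ))), ‖w r‖ ≤ a * Real.exp (-κ * r))
    (ht : 0 ≤ t) : V t ≤ (V 0 + 2 * q * a ^ 2) * Real.exp (-min κ (μ / 2) * t) := by
  have hsub : Set.Icc (t / 2) t ⊆ Set.Ici 0 := fun r hr => (by linarith : (0:ℝ) ≤ t / 2).trans hr.1
  have hfirst : V (t / 2) ≤ V 0 + q * a ^ 2 := by
    refine h.le_zero_add hμ ?_ (by positivity)
    filter_upwards [hw, ae_restrict_mem measurableSet_Ici] with r hr (hr0 : 0 ≤ r)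
    exact hr.trans (mul_le_of_le_one_right ha (Real.exp_le_one_iff.2 (by nlinarith)))
  have hsecond := h.le_exp_mul_add (t / 2) t (a * Real.exp (-κ * (t / 2))) (by positivity)
    (by linarith) <| by
      filter_upwards [ae_restrict_of_ae_restrict_of_subset hsub hw,
        ae_restrict_mem measurableSet_Icc] with r hr hrt
      refine hr.trans (mul_le_mul_of_nonneg_left (Real.exp_le_exp.2 ?_) ha)
      nlinarith [hrt.1]
  have hdecay : Real.exp (-μ * (t - t / 2)) ≤ Real.exp (-min κ (μ / 2) * t) :=
    Real.exp_le_exp.2 (by nlinarith [min_le_right κ (μ / 2)])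
  have hdist : (a * Real.exp (-κ * (t / 2))) ^ 2 ≤ a ^ 2 * Real.exp (-min κ (μ / 2) * t) := by
    rw [mul_pow, ← Real.exp_nat_mul]
    refine mul_le_mul_of_nonneg_left (Real.exp_le_exp.2 ?_) (sq_nonneg a)
    push_cast
    nlinarith [min_le_left κ (μ / 2)]
  calc V t ≤ Real.exp (-μ * (t - t / 2)) * V (t / 2) + q * (a * Real.exp (-κ * (t / 2))) ^ 2 :=
        hsecond
    _ ≤ Real.exp (-min κ (μ / 2) * t) * (V 0 + q * a ^ 2)
          + q * (a ^ 2 * Real.exp (-min κ (μ / 2) * t)) := by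
        gcongr
        exact h.nonneg _ (by positivity)
    _ = _ := by ring

theorem eventually_le (h : IsDissipative μ q w V) (hμ : 0 < μ) {ρ : ℝ → ℝ} {T a b : ℝ}
    (hw : ∀ᵐ t ∂(volume.restrict (Set.Ici T)), ‖w t‖ ≤ ρ t) (hρ : Tendsto ρ atTop (𝓝 a))
    (hb : q * a ^ 2 < b) : ∀ᶠ t in atTop, V t ≤ b := by
  have hcont : ContinuousWithinAt (fun s : ℝ => q * s ^ 2) (Set.Ioi a) a := by fun_prop
  obtain ⟨s, hsb, has⟩ := ((hcont.eventually_lt_const hb).and self_mem_nhdsWithin).exists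
  obtain ⟨T₁, hT₁⟩ := eventually_atTop.1 (hρ.eventually_le_const has)
  obtain ⟨T₂, hT₂⟩ : ∃ T₂, T ≤ T₂ ∧ T₁ ≤ T₂ ∧ 0 ≤ T₂ := ⟨max T (max T₁ 0), by simp⟩
  have hlim : Tendsto (fun t => Real.exp (-μ * (t - T₂)) * V T₂ + q * s ^ 2) atTop
      (𝓝 (0 * V T₂ + q * s ^ 2)) := by
    refine ((Real.tendsto_exp_atBot.comp ?_).mul_const _).add_const _
    exact (tendsto_atTop_add_const_right _ _ tendsto_id).const_mul_atTop_of_neg (neg_neg_of_pos hμ)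
  rw [zero_mul, zero_add] at hlim
  filter_upwards [hlim.eventually_le_const hsb, eventually_ge_atTop T₂] with t htb htT
  refine (h.le_exp_mul_add T₂ t s hT₂.2.2 htT ?_).trans htb
  filter_upwards [ae_restrict_of_ae_restrict_of_subset
    (fun r hr => hT₂.1.trans hr.1 : Set.Icc T₂ t ⊆ Set.Ici T) hw,
    ae_restrict_mem measurableSet_Icc] with r hr hrt
  exact hr.trans (hT₁ r (hT₂.2.1.trans hrt.1))

end IsDissipative

end Dissipative

section LocallyEssBounded

variable {F G : Type*} [NormedAddCommGroup F] [NormedAddCommGroup G] {x f g : ℝ → F}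

/-- `f` is essentially bounded on every bounded interval of nonnegative times. -/
def LocallyEssBounded (f : ℝ → F) : Prop :=
  ∀ T : ℝ, ∃ C, ∀ᵐ t ∂(volume.restrict (Set.Icc 0 T)), ‖f t‖ ≤ C

theorem LocallyEssBounded.of_ae_norm_le {C : ℝ}
    (h : ∀ᵐ t ∂(volume.restrict (Set.Ici (0 : ℝ))), ‖f t‖ ≤ C) : LocallyEssBounded f :=
  fun _ => ⟨C, ae_restrict_of_ae_restrict_of_subset Set.Icc_subset_Ici_self h⟩

theorem LocallyEssBounded.add (hf : LocallyEssBounded f) (hg : LocallyEssBounded g) :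
    LocallyEssBounded fun t => f t + g t := by
  intro T
  obtain ⟨C, hC⟩ := hf T
  obtain ⟨C', hC'⟩ := hg T
  exact ⟨C + C', by filter_upwards [hC, hC'] with t ht ht' using norm_add_le_of_le ht ht'⟩

theorem intervalIntegrable_indicator_Ioi
    (h : ∀ t, 0 ≤ t → IntervalIntegrable f volume 0 t) (a b : ℝ) :
    IntervalIntegrable ((Set.Ioi 0).indicator f) volume a b := by
  suffices hzero : ∀ t, IntervalIntegrable ((Set.Ioi 0).indicator f) volume 0 t from
    (hzero a).symm.trans (hzero b)
  intro t
  rcases le_total 0 t with ht | ht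
  · refine (h t ht).congr fun s hs => ?_
    rw [Set.uIoc_of_le ht] at hs
    exact (Set.indicator_of_mem (s := Set.Ioi 0) hs.1 f).symm
  · refine (intervalIntegrable_const (c := (0 : F))).congr fun s hs => ?_
    rw [Set.uIoc_of_ge ht] at hs
    exact (Set.indicator_of_notMem (s := Set.Ioi 0) (not_lt.2 hs.2) f).symm

theorem LocallyEssBounded.intervalIntegrable_sq (h : LocallyEssBounded f)
    (hf : ∀ t, 0 ≤ t → IntervalIntegrable f volume 0 t) {t : ℝ} (ht : 0 ≤ t) :
    IntervalIntegrable (fun s => ‖f s‖ ^ 2) volume 0 t := by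
  obtain ⟨C, hC⟩ := h t
  have hmeas : AEStronglyMeasurable f (volume.restrict (Set.uIoc 0 t)) :=
    (intervalIntegrable_iff.1 (hf t ht)).aestronglyMeasurable
  refine ((hf t ht).norm.const_mul C).mono_fun' (by fun_prop) ?_
  have hsub : Set.uIoc 0 t ⊆ Set.Icc 0 t := Set.uIoc_of_le ht ▸ Set.Ioc_subset_Icc_self
  filter_upwards [ae_restrict_of_ae_restrict_of_subset hsub hC] with s hs
  rw [Real.norm_of_nonneg (by positivity), sq]
  gcongr

variable [NormedSpace ℝ F] [NormedSpace ℝ G]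

theorem LocallyEssBounded.map (hf : LocallyEssBounded f) (L : F →L[ℝ] G) :
    LocallyEssBounded fun t => L (f t) := by
  intro T
  obtain ⟨C, hC⟩ := hf T
  exact ⟨‖L‖ * C, hC.mono fun t ht => L.le_opNorm_of_le ht⟩

theorem IsPrimitive.locallyEssBounded_comp (h : IsPrimitive x f) {σ : ℝ → ℝ}
    (hσ : ∀ t, 0 ≤ t → 0 ≤ σ t ∧ σ t ≤ t) : LocallyEssBounded fun t => x (σ t) := by
  intro T
  obtain ⟨C, hC⟩ := isCompact_Icc.exists_bound_of_continuousOn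
    (h.continuousOn.mono (Set.Icc_subset_Ici_self : Set.Icc 0 T ⊆ Set.Ici 0))
  refine ⟨C, (ae_restrict_mem measurableSet_Icc).mono fun t ht => hC _ ?_⟩
  exact ⟨(hσ t ht.1).1, (hσ t ht.1).2.trans ht.2⟩

theorem IsPrimitive.isRestingTrajectory {n : ℕ} {x f : ℝ → E n} (h : IsPrimitive x f)
    (hf : LocallyEssBounded f) :
    IsRestingTrajectory (fun t => x (max t 0)) ((Set.Ioi 0).indicator f) := by
  have hint := intervalIntegrable_indicator_Ioi fun t ht => (h t ht).1
  have heq : ∀ t, x (max t 0) = x 0 + ∫ s in (0 : ℝ)..t, (Set.Ioi 0).indicator f s := by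
    intro t
    rcases le_total 0 t with ht | ht
    · rw [max_eq_left ht, (h t ht).2, intervalIntegral.integral_of_le ht,
        intervalIntegral.integral_of_le ht]
      refine congrArg _ (setIntegral_congr_fun measurableSet_Ioc fun s hs => ?_)
      exact (Set.indicator_of_mem (s := Set.Ioi 0) hs.1 f).symm
    · rw [max_eq_right ht, intervalIntegral.integral_zero_ae, add_zero]
      refine Eventually.of_forall fun s hs => Set.indicator_of_notMem ?_ f
      rw [Set.uIoc_of_ge ht] at hs
      exact not_lt.2 hs.2
  refine ⟨hint, fun a b => ?_, fun a b => ?_, fun s hs => ?_⟩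
  · rw [heq a, heq b, add_sub_add_left_eq_sub,
      intervalIntegral.integral_interval_sub_left (hint 0 b) (hint 0 a)]
  · refine (intervalIntegrable_indicator_Ioi (fun t ht =>
      hf.intervalIntegrable_sq (fun t ht => (h t ht).1) ht) a b).congr fun s _ => ?_
    by_cases hs : 0 < s <;> simp [Set.indicator, hs]
  · exact Set.indicator_of_notMem (s := Set.Ioi 0) (not_lt.2 hs) f

end LocallyEssBounded

section StateEstimates

variable {n p : ℕ} {A : Matrix (Fin n) (Fin n) ℝ} {B : Matrix (Fin n) (Fin p) ℝ}
  {τbar τhat δ γ ε : ℝ} {P Q R S S₁₂ M : Matrix (Fin n) (Fin n) ℝ}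
  {Y : Matrix (Fin p) (Fin n) ℝ} {τ : ℝ → ℝ} {z w : ℝ → E n}

/-- `z` satisfies `ż = A z + F z(t - τ) + w`, where `z` is extended by `z 0` to negative times. -/
structure IsDelayTrajectory (A F : Matrix (Fin n) (Fin n) ℝ) (τ : ℝ → ℝ) (z w : ℝ → E n) :
    Prop where
  isPrimitive : IsPrimitive z fun t => clm A (z t) + clm F (z (max (t - τ t) 0)) + w t
  locallyEssBounded : LocallyEssBounded w

theorem IsInputDelay.max_sub_mem (hτ : IsInputDelay τbar τhat τ) (t : ℝ) (ht : 0 ≤ t) :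
    0 ≤ max (t - τ t) 0 ∧ max (t - τ t) 0 ≤ t :=
  ⟨le_max_right _ _, max_le (by linarith [hτ.nonneg t ht]) ht⟩

theorem IsDelayTrajectory.locallyEssBounded_rhs {F : Matrix (Fin n) (Fin n) ℝ}
    (hz : IsDelayTrajectory A F τ z w) (hτ : IsInputDelay τbar τhat τ) :
    LocallyEssBounded fun t => clm A (z t) + clm F (z (max (t - τ t) 0)) + w t :=
  (((hz.isPrimitive.locallyEssBounded_comp fun _ ht => ⟨ht, le_rfl⟩).map (clm A)).add
    ((hz.isPrimitive.locallyEssBounded_comp hτ.max_sub_mem).map (clm F))).add hz.locallyEssBounded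

theorem LMISolution.isDissipative_lyapunovKrasovskii
    (h : LMISolution A B τbar τhat δ γ ε P Q R S S₁₂ M Y) (hδ : 0 < δ) (hγ : 0 ≤ γ)
    (hτ : IsInputDelay τbar τhat τ) {η g : ℝ → E n} (hη : IsRestingTrajectory η g)
    (hdyn : ∀ᵐ t ∂(volume.restrict (Set.Ici (0 : ℝ))),
      clm M (g t) = clm (A * M) (η t) + clm (B * Y) (η (t - τ t)) + w t) :
    IsDissipative (2 * δ) (γ / (2 * δ)) w fun t =>
      Real.exp (-(2 * δ) * t) * lyapunovKrasovskii δ τbar τ P Q R S η g t := by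
  refine ⟨fun t ht => mul_nonneg (Real.exp_pos _).le <|
    (weightedEnergy_nonneg h.posDef_P.posSemidef η t).trans
      (h.weightedEnergy_le_lyapunovKrasovskii hτ η g ht), fun s t a hs hst hw => ?_⟩
  have hgain := mul_le_mul_of_nonneg_left
    (h.lyapunovKrasovskii_sub_le hδ hγ hτ hη hdyn hs hst hw) (Real.exp_pos (-(2 * δ) * t)).le
  have hexp : Real.exp (-(2 * δ) * t) * Real.exp (2 * δ * t) = 1 := by
    rw [← Real.exp_add]
    simp
  have hsplit : Real.exp (-(2 * δ) * (t - s)) * Real.exp (-(2 * δ) * s)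
      = Real.exp (-(2 * δ) * t) := by
    rw [← Real.exp_add]
    ring_nf
  have hdrop : 0 ≤ γ / (2 * δ) * a ^ 2 * (Real.exp (-(2 * δ) * t) * Real.exp (2 * δ * s)) := by
    positivity
  rw [← mul_assoc, hsplit]
  linear_combination hgain + hdrop + γ / (2 * δ) * a ^ 2 * hexp

theorem LMISolution.exists_isDissipative
    (h : LMISolution A B τbar τhat δ γ ε P Q R S S₁₂ M Y)
    (hτbar : 0 ≤ τbar) (hδ : 0 < δ) (hγ : 0 ≤ γ) :
    ∃ c : ℝ, 0 ≤ c ∧ ∀ τ z w, IsInputDelay τbar τhat τ →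
      IsDelayTrajectory A (B * (Y * M⁻¹)) τ z w →
        ∃ V, IsDissipative (2 * δ) (γ / (2 * δ)) w V ∧
          (∀ t, 0 ≤ t → form (unbar P M) (z t) (z t) ≤ V t) ∧ V 0 ≤ c * ‖z 0‖ ^ 2 := by
  refine ⟨(‖form P‖ + τbar * ‖form S‖ + τbar * ‖form Q‖) * ‖clm M⁻¹‖ ^ 2, by positivity,
    fun τ z w hτ hz => ?_⟩
  have hη := (hz.isPrimitive.map (clm M⁻¹)).isRestingTrajectory
    ((hz.locallyEssBounded_rhs hτ).map (clm M⁻¹))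
  have hM (y : E n) : clm M (clm M⁻¹ y) = y := by
    rw [← clm_mul_apply, Matrix.mul_nonsing_inv _ h.isUnit_det, clm_one_apply]
  refine ⟨_, h.isDissipative_lyapunovKrasovskii hδ hγ hτ hη ?_, fun t ht => ?_, ?_⟩
  · rw [← restrict_Ioi_eq_restrict_Ici]
    filter_upwards [ae_restrict_mem measurableSet_Ioi] with t ht
    simp only [Set.indicator_of_mem ht, hM, clm_mul_apply, max_eq_left (Set.mem_Ioi.1 ht).le]
  · have hlow := h.weightedEnergy_le_lyapunovKrasovskii hτ (fun t => clm M⁻¹ (z (max t 0)))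
      ((Set.Ioi 0).indicator fun t => clm M⁻¹
        (clm A (z t) + clm (B * (Y * M⁻¹)) (z (max (t - τ t) 0)) + w t)) ht
    rw [weightedEnergy, max_eq_left ht, ← form_unbar] at hlow
    rw [neg_mul, Real.exp_neg, inv_mul_eq_div, le_div_iff₀' (Real.exp_pos _)]
    exact hlow
  · have hinit := h.lyapunovKrasovskii_zero_le hδ.le hτ hη
    have hnorm := (clm M⁻¹).le_opNorm (z 0)
    rw [mul_zero, Real.exp_zero, one_mul, mul_assoc, ← mul_pow]
    refine hinit.trans ?_
    rw [max_self]
    gcongr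

theorem exists_pos_mul_norm_sq_le_form (hP : P.PosDef) :
    ∃ l : ℝ, 0 < l ∧ ∀ z : E n, l * ‖z‖ ^ 2 ≤ form P z z := by
  rcases isEmpty_or_nonempty (Fin n) with hn | hn
  · exact ⟨1, one_pos, fun z => by simp [Subsingleton.elim z 0]⟩
  · exact ⟨_, lambdaMin_pos hP, lambdaMin_mul_norm_sq_le hP.isHermitian⟩

theorem le_sqrt_div_mul_of_mul_sq_le {l k x y : ℝ} (hl : 0 < l) (hk : 0 ≤ k) (hy : 0 ≤ y)
    (h : l * x ^ 2 ≤ k * y ^ 2) : x ≤ Real.sqrt (k / l) * y := by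
  refine le_of_sq_le_sq ?_ (by positivity)
  rw [mul_pow, Real.sq_sqrt (by positivity), div_mul_eq_mul_div, le_div_iff₀' hl]
  exact h

theorem LMISolution.exists_norm_le (h : LMISolution A B τbar τhat δ γ ε P Q R S S₁₂ M Y)
    (hτbar : 0 ≤ τbar) (hδ : 0 < δ) (hγ : 0 ≤ γ) :
    ∃ c : ℝ, 0 ≤ c ∧ ∀ τ z w a, IsInputDelay τbar τhat τ →
      IsDelayTrajectory A (B * (Y * M⁻¹)) τ z w → 0 ≤ a →
      (∀ᵐ t ∂(volume.restrict (Set.Ici (0 : ℝ))), ‖w t‖ ≤ a) →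
        ∀ t, 0 ≤ t → ‖z t‖ ≤ c * (‖z 0‖ + a) := by
  obtain ⟨c, hc, hdiss⟩ := h.exists_isDissipative hτbar hδ hγ
  obtain ⟨l, hl, hlow⟩ := exists_pos_mul_norm_sq_le_form h.posDef_unbar
  refine ⟨Real.sqrt ((c + γ / (2 * δ)) / l), by positivity, fun τ z w a hτ hz ha hw t ht => ?_⟩
  obtain ⟨V, hV, hform, hV0⟩ := hdiss τ z w hτ hz
  refine le_sqrt_div_mul_of_mul_sq_le hl (by positivity) (by positivity) ?_
  calc l * ‖z t‖ ^ 2 ≤ V t := (hlow (z t)).trans (hform t ht)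
    _ ≤ c * ‖z 0‖ ^ 2 + γ / (2 * δ) * a ^ 2 :=
        (hV.le_zero_add (by positivity) hw ht).trans (by gcongr)
    _ ≤ c * (‖z 0‖ + a) ^ 2 + γ / (2 * δ) * (‖z 0‖ + a) ^ 2 := by
        gcongr
        · exact le_add_of_nonneg_right ha
        · exact le_add_of_nonneg_left (norm_nonneg _)
    _ = (c + γ / (2 * δ)) * (‖z 0‖ + a) ^ 2 := by ring

theorem LMISolution.exists_norm_le_mul_exp
    (h : LMISolution A B τbar τhat δ γ ε P Q R S S₁₂ M Y)
    (hτbar : 0 ≤ τbar) (hδ : 0 < δ) (hγ : 0 ≤ γ) :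
    ∃ c : ℝ, 0 ≤ c ∧ ∀ τ z w a κ, IsInputDelay τbar τhat τ →
      IsDelayTrajectory A (B * (Y * M⁻¹)) τ z w → 0 ≤ κ → ‖z 0‖ ≤ a →
      (∀ᵐ t ∂(volume.restrict (Set.Ici (0 : ℝ))), ‖w t‖ ≤ a * Real.exp (-κ * t)) →
        ∀ t, 0 ≤ t → ‖z t‖ ≤ c * (a * Real.exp (-(min κ δ / 2) * t)) := by
  obtain ⟨c, hc, hdiss⟩ := h.exists_isDissipative hτbar hδ hγ
  obtain ⟨l, hl, hlow⟩ := exists_pos_mul_norm_sq_le_form h.posDef_unbar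
  refine ⟨Real.sqrt ((c + 2 * (γ / (2 * δ))) / l), by positivity,
    fun τ z w a κ hτ hz hκ hz0 hw t ht => ?_⟩
  obtain ⟨V, hV, hform, hV0⟩ := hdiss τ z w hτ hz
  have ha : 0 ≤ a := (norm_nonneg _).trans hz0
  have hsq : (a * Real.exp (-(min κ δ / 2) * t)) ^ 2 = a ^ 2 * Real.exp (-min κ δ * t) := by
    rw [mul_pow, ← Real.exp_nat_mul]
    push_cast
    ring_nf
  refine le_sqrt_div_mul_of_mul_sq_le hl (by positivity) (by positivity) ?_
  rw [hsq]
  calc l * ‖z t‖ ^ 2 ≤ V t := (hlow (z t)).trans (hform t ht)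
    _ ≤ (V 0 + 2 * (γ / (2 * δ)) * a ^ 2) * Real.exp (-min κ (2 * δ / 2) * t) :=
        hV.le_mul_exp (by positivity) (by positivity) ha hκ hw ht
    _ ≤ (c * a ^ 2 + 2 * (γ / (2 * δ)) * a ^ 2) * Real.exp (-min κ δ * t) := by
        rw [mul_div_cancel_left₀ δ two_ne_zero]
        gcongr
        exact hV0.trans (by gcongr)
    _ = _ := by ring

theorem LMISolution.eventually_norm_sq_le
    (h : LMISolution A B τbar τhat δ γ ε P Q R S S₁₂ M Y) (hδ : 0 < δ) (hγ : 0 ≤ γ)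
    (hτ : IsInputDelay τbar τhat τ) (hz : IsDelayTrajectory A (B * (Y * M⁻¹)) τ z w)
    {ρ : ℝ → ℝ} {T a : ℝ} (hw : ∀ᵐ t ∂(volume.restrict (Set.Ici T)), ‖w t‖ ≤ ρ t)
    (hρ : Tendsto ρ atTop (𝓝 a)) {η : ℝ} (hη : 0 < η) :
    ∀ᶠ t in atTop, ‖z t‖ ^ 2 ≤ γ / (2 * δ * lambdaMin (unbar P M)) * a ^ 2 + η := by
  rcases isEmpty_or_nonempty (Fin n) with hn | hn
  · have hmin : lambdaMin (unbar P M) = 0 := by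
      simp [lambdaMin, spectrum.of_subsingleton]
    refine Eventually.of_forall fun t => ?_
    simpa [Subsingleton.elim (z t) 0, hmin] using hη.le
  have hl : 0 < lambdaMin (unbar P M) := lambdaMin_pos h.posDef_unbar
  obtain ⟨c, -, hdiss⟩ := h.exists_isDissipative hτ.bar_nonneg hδ hγ
  obtain ⟨V, hV, hform, -⟩ := hdiss τ z w hτ hz
  have hV_le := hV.eventually_le (by positivity) hw hρ
    (lt_add_of_pos_right (γ / (2 * δ) * a ^ 2) (mul_pos hl hη))
  filter_upwards [hV_le, eventually_ge_atTop 0] with t hVt ht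
  have hbound : lambdaMin (unbar P M) * ‖z t‖ ^ 2
      ≤ γ / (2 * δ) * a ^ 2 + lambdaMin (unbar P M) * η :=
    (lambdaMin_mul_norm_sq_le h.posDef_unbar.isHermitian _).trans ((hform t ht).trans hVt)
  rw [← mul_le_mul_iff_right₀ hl]
  refine hbound.trans_eq ?_
  field_simp

end StateEstimates

section Regulation

variable {n m p : ℕ} {A₀ : Matrix (Fin n) (Fin n) ℝ} {A : Matrix (Fin m) (Fin m) ℝ}
  {B : Matrix (Fin m) (Fin p) ℝ} {K₁ : Matrix (Fin p) (Fin m) ℝ} {K₂ : Matrix (Fin p) (Fin n) ℝ}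
  {X : Matrix (Fin m) (Fin n) ℝ} {U : Matrix (Fin p) (Fin n) ℝ} {τbar τhat : ℝ} {τ : ℝ → ℝ}
  {x₀ : ℝ → E n}

/-- The disturbance that the leader exerts on the regulation error `x - X x₀` of a follower which
uses its exact delayed state: the mismatch between the feedforward `(K¹ X - K²) x₀(t - τ)` and the
required `U x₀(t)`, as seen through `B`. Times before `0` are replaced by `0`. -/
def leaderDisturbance (B : Matrix (Fin m) (Fin p) ℝ) (K₁ : Matrix (Fin p) (Fin m) ℝ)
    (K₂ : Matrix (Fin p) (Fin n) ℝ) (X : Matrix (Fin m) (Fin n) ℝ) (U : Matrix (Fin p) (Fin n) ℝ)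
    (τ : ℝ → ℝ) (x₀ : ℝ → E n) (t : ℝ) : E m :=
  clm (B * (K₁ * X - K₂)) (x₀ (max (t - τ t) 0)) - clm (B * U) (x₀ t)

theorem leaderDisturbance_one_zero (B : Matrix (Fin n) (Fin p) ℝ) (K : Matrix (Fin p) (Fin n) ℝ)
    (τ : ℝ → ℝ) (x₀ : ℝ → E n) (t : ℝ) : leaderDisturbance B K K 1 0 τ x₀ t = 0 := by
  simp [leaderDisturbance]

theorem eventually_leaderDisturbance_eq (hτ : IsInputDelay τbar τhat τ)
    (hK₂ : K₂ = K₁ * X - U) (B : Matrix (Fin m) (Fin p) ℝ) (x₀ : ℝ → E n) :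
    ∀ᶠ t in atTop, leaderDisturbance B K₁ K₂ X U τ x₀ t
      = -clm (B * U) (x₀ t - x₀ (t - τ t)) := by
  filter_upwards [eventually_ge_atTop τbar] with t ht
  have hpos : 0 ≤ t - τ t := sub_nonneg.2 ((hτ.le_bar t (hτ.bar_nonneg.trans ht)).trans ht)
  rw [leaderDisturbance, max_eq_left hpos, hK₂, sub_sub_cancel, ← map_sub, ← map_neg, neg_sub]

theorem IsPrimitive.locallyEssBounded_leaderDisturbance {f : ℝ → E n} (h : IsPrimitive x₀ f)
    (hτ : IsInputDelay τbar τhat τ) (B : Matrix (Fin m) (Fin p) ℝ) (K₁ : Matrix (Fin p) (Fin m) ℝ)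
    (K₂ : Matrix (Fin p) (Fin n) ℝ) (X : Matrix (Fin m) (Fin n) ℝ)
    (U : Matrix (Fin p) (Fin n) ℝ) :
    LocallyEssBounded (leaderDisturbance B K₁ K₂ X U τ x₀) := by
  have hnow := (h.locallyEssBounded_comp fun _ ht => ⟨ht, le_rfl⟩).map (-clm (B * U))
  have hpast := (h.locallyEssBounded_comp hτ.max_sub_mem).map (clm (B * (K₁ * X - K₂)))
  simpa only [neg_apply, ← sub_eq_add_neg] using! hpast.add hnow

theorem MarginallyStable.exists_norm_leaderDisturbance_le (hA₀ : MarginallyStable A₀)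
    (B : Matrix (Fin m) (Fin p) ℝ) (K₁ : Matrix (Fin p) (Fin m) ℝ)
    (K₂ : Matrix (Fin p) (Fin n) ℝ) (X : Matrix (Fin m) (Fin n) ℝ)
    (U : Matrix (Fin p) (Fin n) ℝ) :
    ∃ b : ℝ, ∀ x₀ : ℝ → E n, IsSolution x₀ (fun t => A₀.toEuclideanLin (x₀ t)) →
      ∀ τ t, 0 ≤ t → ‖leaderDisturbance B K₁ K₂ X U τ x₀ t‖ ≤ b * ‖x₀ 0‖ := by
  obtain ⟨k, -, hexp⟩ := hA₀.exists_norm_exp_le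
  refine ⟨‖clm (B * (K₁ * X - K₂))‖ * k + ‖clm (B * U)‖ * k, fun x₀ hx₀ τ t ht => ?_⟩
  have hlead : ∀ s, 0 ≤ s → ‖x₀ s‖ ≤ k * ‖x₀ 0‖ := fun s hs => by
    rw [IsPrimitive.eq_exp_smul (clm A₀) hx₀ hs]
    exact ContinuousLinearMap.le_of_opNorm_le _ (hexp s hs) _
  rw [add_mul, mul_assoc, mul_assoc]
  exact norm_sub_le_of_le ((clm _).le_opNorm_of_le (hlead _ (le_max_right _ _)))
    ((clm _).le_opNorm_of_le (hlead t ht))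

/-- The difference between the delayed input and the feedback law evaluated with the leader state in
place of the observer. Times before `0` are replaced by `0` in the latter. -/
def inputDeviation (K₁ : Matrix (Fin p) (Fin m) ℝ) (K₂ : Matrix (Fin p) (Fin n) ℝ) (τ : ℝ → ℝ)
    (x₀ : ℝ → E n) (x : ℝ → E m) (u : ℝ → E p) (t : ℝ) : E p :=
  u (t - τ t) - (clm K₁ (x (max (t - τ t) 0)) - clm K₂ (x₀ (max (t - τ t) 0)))

theorem norm_inputDeviation_le (hτ : IsInputDelay τbar τhat τ) {x : ℝ → E m} {ξ : ℝ → E n}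
    {u : ℝ → E p} {c κ D : ℝ} (hc : 0 ≤ c) (hκ : 0 ≤ κ)
    (hinput : ∀ t, 0 ≤ t → u t = clm K₁ (x t) - clm K₂ (ξ t))
    (hξ : ∀ t, 0 ≤ t → ‖ξ t - x₀ t‖ ≤ c * D * Real.exp (-κ * t))
    (hu : ∀ s ∈ Set.Ico (-τbar) 0, ‖u s‖ ≤ D) (hx : ‖x 0‖ ≤ D) (hx₀ : ‖x₀ 0‖ ≤ D)
    {t : ℝ} (ht : 0 ≤ t) :
    ‖inputDeviation K₁ K₂ τ x₀ x u t‖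
      ≤ (1 + ‖clm K₁‖ + (1 + c) * ‖clm K₂‖) * D * (Real.exp (κ * τbar) * Real.exp (-κ * t)) := by
  have hD : 0 ≤ D := (norm_nonneg _).trans hx
  suffices hdelayed : ‖inputDeviation K₁ K₂ τ x₀ x u t‖
      ≤ (1 + ‖clm K₁‖ + (1 + c) * ‖clm K₂‖) * D * Real.exp (-κ * (t - τ t)) by
    refine hdelayed.trans (mul_le_mul_of_nonneg_left ?_ (by positivity))
    rw [← Real.exp_add, Real.exp_le_exp]
    linarith [mul_le_mul_of_nonneg_left (hτ.le_bar t ht) hκ]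
  rw [inputDeviation]
  rcases le_or_gt 0 (t - τ t) with hpos | hneg
  · have hobserver := (clm K₂).le_opNorm_of_le (hξ _ hpos)
    rw [max_eq_left hpos, hinput _ hpos, sub_sub_sub_cancel_left, norm_sub_rev, ← map_sub]
    refine hobserver.trans ?_
    rw [← mul_assoc, ← mul_assoc]
    gcongr
    nlinarith [norm_nonneg (clm K₁), norm_nonneg (clm K₂)]
  · have hmem : t - τ t ∈ Set.Ico (-τbar) 0 := ⟨by linarith [hτ.le_bar t ht], hneg⟩
    rw [max_eq_right hneg.le]
    calc ‖u (t - τ t) - (clm K₁ (x 0) - clm K₂ (x₀ 0))‖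
        ≤ D + (‖clm K₁‖ * D + ‖clm K₂‖ * D) :=
          norm_sub_le_of_le (hu _ hmem)
            (norm_sub_le_of_le ((clm K₁).le_opNorm_of_le hx) ((clm K₂).le_opNorm_of_le hx₀))
      _ ≤ (1 + ‖clm K₁‖ + (1 + c) * ‖clm K₂‖) * D := by
          linarith [mul_nonneg (mul_nonneg hc (norm_nonneg (clm K₂))) hD]
      _ ≤ _ := le_mul_of_one_le_right (by positivity)
          (Real.one_le_exp (mul_nonneg_of_nonpos_of_nonpos (neg_nonpos.2 hκ) hneg.le))

theorem isPrimitive_regulationError (hXU : X * A₀ = A * X + B * U)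
    (hx₀ : IsSolution x₀ fun t => A₀.toEuclideanLin (x₀ t)) {x v : ℝ → E m} {u : ℝ → E p}
    (hx : IsSolution x fun t => A.toEuclideanLin (x t) + B.toEuclideanLin (u (t - τ t)) + v t)
    (K₁ : Matrix (Fin p) (Fin m) ℝ) (K₂ : Matrix (Fin p) (Fin n) ℝ) :
    IsPrimitive (fun t => x t - clm X (x₀ t)) fun t =>
      clm A (x t - clm X (x₀ t))
        + clm (B * K₁) (x (max (t - τ t) 0) - clm X (x₀ (max (t - τ t) 0)))
        + (v t + leaderDisturbance B K₁ K₂ X U τ x₀ t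
          + clm B (inputDeviation K₁ K₂ τ x₀ x u t)) := by
  refine (hx.isPrimitive.sub (hx₀.isPrimitive.map (clm X))).congr_right fun t _ => ?_
  have hreg : clm X (clm A₀ (x₀ t)) = clm A (clm X (x₀ t)) + clm (B * U) (x₀ t) := by
    rw [← clm_mul_apply, hXU, ← clm_mul_apply]
    simp [clm_apply]
  have hfeed : clm (B * (K₁ * X - K₂)) (x₀ (max (t - τ t) 0))
      = clm B (clm K₁ (clm X (x₀ (max (t - τ t) 0)))) - clm B (clm K₂ (x₀ (max (t - τ t) 0))) := by
    simp [clm_apply, Matrix.mul_sub]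
  simp only [← clm_apply, leaderDisturbance, inputDeviation, map_sub, hreg, hfeed, clm_mul_apply]
  abel

end Regulation

section ClosedLoop

variable {N n : ℕ} {nn pp : Fin N → ℕ} {G : Digraph (Fin (N + 1))} {ϵ τbar τhat τcbar : ℝ}
  {τu : Fin N → ℝ → ℝ} {τc : Fin N → Fin (N + 1) → ℝ → ℝ} {A₀ : Matrix (Fin n) (Fin n) ℝ}
  {A : ∀ i, Matrix (Fin (nn i)) (Fin (nn i)) ℝ} {B : ∀ i, Matrix (Fin (nn i)) (Fin (pp i)) ℝ}
  {X : ∀ i, Matrix (Fin (nn i)) (Fin n) ℝ} {U : ∀ i, Matrix (Fin (pp i)) (Fin n) ℝ}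

theorem EssBoundedBy.nonneg {v : ℝ → E n} {Δ : ℝ} (h : EssBoundedBy v Δ) : 0 ≤ Δ := by
  have : (ae (volume.restrict (Set.Ici (0 : ℝ)))).NeBot := by
    rw [ae_restrict_neBot]
    simp
  obtain ⟨t, ht⟩ := h.2.exists
  exact (norm_nonneg _).trans ht

theorem exists_pos_forall_le {ι : Type*} [Finite ι] (f : ι → ℝ) : ∃ M, 0 < M ∧ ∀ i, f i ≤ M := by
  obtain ⟨M, hM⟩ := Finite.bddAbove_range f
  exact ⟨max M 1, lt_max_of_lt_right one_pos, fun i => (hM ⟨i, rfl⟩).trans (le_max_left _ _)⟩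

theorem HomClosedLoop.hetClosedLoop {p : ℕ} {A : Matrix (Fin n) (Fin n) ℝ}
    {B : Matrix (Fin n) (Fin p) ℝ} {K : Matrix (Fin p) (Fin n) ℝ} {v : Fin N → ℝ → E n}
    {x₀ : ℝ → E n} {x ξ : Fin N → ℝ → E n} {u : Fin N → ℝ → E p}
    (h : HomClosedLoop G ϵ τu τc A B K v x₀ x ξ u) :
    HetClosedLoop G ϵ τu τc A (fun _ => A) (fun _ => B) (fun _ => K) (fun _ => K) v x₀ x ξ u where
  leader := h.leader
  follower := h.follower
  observer_init := h.observer_init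
  observer := h.observer
  input i t ht := (h.input i t ht).trans (map_sub _ _ _)

theorem InitialDataBound.nonneg {x₀ : ℝ → E n} {x : ∀ i, ℝ → E (nn i)} {u : ∀ i, ℝ → E (pp i)}
    {D : ℝ} (h : InitialDataBound τbar τcbar x₀ x u D) (i : Fin N) : 0 ≤ D :=
  (norm_nonneg _).trans (h.state i)

theorem InitialDataBound.norm_leader_zero_le {x₀ : ℝ → E n} {x : ∀ i, ℝ → E (nn i)}
    {u : ∀ i, ℝ → E (pp i)} {D : ℝ} (h : InitialDataBound τbar τcbar x₀ x u D)
    (hτcbar : 0 ≤ τcbar) : ‖x₀ 0‖ ≤ D :=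
  h.leader 0 ⟨neg_nonpos.2 hτcbar, le_rfl⟩

theorem InitialDataBound.norm_regulationError_zero_le {x₀ : ℝ → E n} {x : ∀ i, ℝ → E (nn i)}
    {u : ∀ i, ℝ → E (pp i)} {D : ℝ} (h : InitialDataBound τbar τcbar x₀ x u D)
    (hτcbar : 0 ≤ τcbar) (i : Fin N) (X : Matrix (Fin (nn i)) (Fin n) ℝ) :
    ‖x i 0 - clm X (x₀ 0)‖ ≤ (1 + ‖clm X‖) * D := by
  rw [add_mul, one_mul]
  exact norm_sub_le_of_le (h.state i) ((clm X).le_opNorm_of_le (h.norm_leader_zero_le hτcbar))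

theorem exists_isDelayTrajectory_regulationError (hG : LeaderRooted G) (hϵ : 0 < ϵ)
    (hτu : InputDelays τbar τhat τu) (hτc : CommDelays G τcbar τc) (hA₀ : NoUnstableEigenvalue A₀)
    (hX : ∀ i, X i * A₀ = A i * X i + B i * U i)
    (K₁ : ∀ i, Matrix (Fin (pp i)) (Fin (nn i)) ℝ) (K₂ : ∀ i, Matrix (Fin (pp i)) (Fin n) ℝ) :
    ∃ C κ : ℝ, 0 ≤ C ∧ 0 < κ ∧
      ∀ (v : ∀ i, ℝ → E (nn i)) (x₀ : ℝ → E n) (x : ∀ i, ℝ → E (nn i)) (ξ : Fin N → ℝ → E n)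
        (u : ∀ i, ℝ → E (pp i)) (D : ℝ), HetClosedLoop G ϵ τu τc A₀ A B K₁ K₂ v x₀ x ξ u →
        InitialDataBound τbar τcbar x₀ x u D → ∀ i, LocallyEssBounded (v i) →
          ∃ w, IsDelayTrajectory (A i) (B i * K₁ i) (τu i) (fun t => x i t - clm (X i) (x₀ t)) w ∧
            ∀ t, 0 ≤ t → ‖w t‖ ≤ ‖v i t‖
              + ‖leaderDisturbance (B i) (K₁ i) (K₂ i) (X i) (U i) (τu i) x₀ t‖
              + C * D * Real.exp (-κ * t) := by
  obtain ⟨c, κ, hc, hκ, hobs⟩ := exists_observer_error_bound hG hϵ hτc hA₀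
  obtain ⟨C, hC, hCi⟩ := exists_pos_forall_le fun i => ‖clm (B i)‖
    * ((1 + ‖clm (K₁ i)‖ + (1 + c) * ‖clm (K₂ i)‖) * Real.exp (κ * τbar))
  refine ⟨C, κ, hC.le, hκ, fun v x₀ x ξ u D hloop hinit i hv => ?_⟩
  have hD := hinit.nonneg i
  have hτ := hτu.isInputDelay i
  have hdeviation : ∀ t, 0 ≤ t →
      ‖clm (B i) (inputDeviation (K₁ i) (K₂ i) (τu i) x₀ (x i) (u i) t)‖
        ≤ C * D * Real.exp (-κ * t) := fun t ht => by
    refine ((clm (B i)).le_opNorm_of_le (norm_inputDeviation_le hτ hc hκ.le (hloop.input i)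
      (hobs x₀ ξ D hloop.leader hloop.observer_init hloop.observer hinit.leader i) (hinit.input i)
      (hinit.state i) (hinit.norm_leader_zero_le (hτc.bar_nonneg hG i)) ht)).trans ?_
    have := mul_le_mul_of_nonneg_right (hCi i) (mul_nonneg hD (Real.exp_nonneg (-κ * t)))
    linarith
  refine ⟨_, ⟨isPrimitive_regulationError (hX i) hloop.leader (hloop.follower i) (K₁ i) (K₂ i),
    (hv.add (hloop.leader.isPrimitive.locallyEssBounded_leaderDisturbance hτ _ _ _ _ _)).add
      (.of_ae_norm_le (C := C * D) ?_)⟩, fun t ht => ?_⟩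
  · filter_upwards [ae_restrict_mem measurableSet_Ici] with t (ht : 0 ≤ t)
    refine (hdeviation t ht).trans (mul_le_of_le_one_right (by positivity)
      (Real.exp_le_one_iff.2 ?_))
    exact mul_nonpos_of_nonpos_of_nonneg (neg_nonpos.2 hκ.le) ht
  · exact (norm_add_le _ _).trans (add_le_add (norm_add_le _ _) (hdeviation t ht))

end ClosedLoop

section Consensus

variable {N n q : ℕ} {nn pp : Fin N → ℕ} {G : Digraph (Fin (N + 1))}
  {ϵ τbar τhat τcbar δ γ ε : ℝ} {τu : Fin N → ℝ → ℝ} {τc : Fin N → Fin (N + 1) → ℝ → ℝ}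
  {A₀ : Matrix (Fin n) (Fin n) ℝ}
  {A P Q R S S₁₂ M : ∀ i, Matrix (Fin (nn i)) (Fin (nn i)) ℝ}
  {B : ∀ i, Matrix (Fin (nn i)) (Fin (pp i)) ℝ} {Y : ∀ i, Matrix (Fin (pp i)) (Fin (nn i)) ℝ}
  {X : ∀ i, Matrix (Fin (nn i)) (Fin n) ℝ} {U K₂ : ∀ i, Matrix (Fin (pp i)) (Fin n) ℝ}

theorem exists_norm_regulationError_le_mul_exp (hG : LeaderRooted G) (hϵ : 0 < ϵ)
    (hδ : 0 < δ) (hγ : 0 ≤ γ) (hτbar : 0 ≤ τbar)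
    (hτu : InputDelays τbar τhat τu) (hτc : CommDelays G τcbar τc) (hA₀ : NoUnstableEigenvalue A₀)
    (hX : ∀ i, X i * A₀ = A i * X i + B i * U i)
    (hL : ∀ i, LMISolution (A i) (B i) τbar τhat δ γ ε (P i) (Q i) (R i) (S i) (S₁₂ i) (M i) (Y i))
    (hzero : ∀ i x₀ t,
      leaderDisturbance (B i) (Y i * (M i)⁻¹) (K₂ i) (X i) (U i) (τu i) x₀ t = 0) :
    ∃ c κ : ℝ, 0 < c ∧ 0 < κ ∧
      ∀ (v : ∀ i, ℝ → E (nn i)) (x₀ : ℝ → E n) (x : ∀ i, ℝ → E (nn i)) (ξ : Fin N → ℝ → E n)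
        (u : ∀ i, ℝ → E (pp i)) (D : ℝ),
        HetClosedLoop G ϵ τu τc A₀ A B (fun i => Y i * (M i)⁻¹) K₂ v x₀ x ξ u →
        InitialDataBound τbar τcbar x₀ x u D →
        ∀ i, (∀ᵐ t ∂(volume.restrict (Set.Ici (0 : ℝ))), v i t = 0) →
          ∀ t : ℝ, 0 ≤ t → ‖x i t - clm (X i) (x₀ t)‖ ≤ c * D * Real.exp (-κ * t) := by
  obtain ⟨C, κ, hC, hκ, herror⟩ :=
    exists_isDelayTrajectory_regulationError hG hϵ hτu hτc hA₀ hX (fun i => Y i * (M i)⁻¹) K₂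
  choose c _ hstate using fun i => (hL i).exists_norm_le_mul_exp hτbar hδ hγ
  obtain ⟨k, hk, hck⟩ := exists_pos_forall_le fun i => c i * (C + (1 + ‖clm (X i)‖))
  refine ⟨k, min κ δ / 2, hk, by positivity, fun v x₀ x ξ u D hloop hinit i hv t ht => ?_⟩
  have hD := hinit.nonneg i
  have hinitial := hinit.norm_regulationError_zero_le (hτc.bar_nonneg hG i) i (X i)
  obtain ⟨w, hz, hw⟩ := herror v x₀ x ξ u D hloop hinit i
    (.of_ae_norm_le (C := 0) (hv.mono fun s hs => by simp [hs]))
  have hdecay : ∀ᵐ s ∂(volume.restrict (Set.Ici (0 : ℝ))),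
      ‖w s‖ ≤ (C + (1 + ‖clm (X i)‖)) * D * Real.exp (-κ * s) := by
    filter_upwards [hv, ae_restrict_mem measurableSet_Ici] with s hvs hs
    have hws := hw s hs
    simp only [hvs, hzero, norm_zero, zero_add] at hws
    refine hws.trans ?_
    gcongr
    exact le_add_of_nonneg_right (by positivity)
  refine (hstate i (τu i) _ w _ κ (hτu.isInputDelay i) hz hκ.le (hinitial.trans ?_) hdecay
    t ht).trans ?_
  · exact mul_le_mul_of_nonneg_right (le_add_of_nonneg_left hC) hD
  · rw [← mul_assoc, ← mul_assoc]
    gcongr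
    exact hck i

theorem exists_norm_regulationError_le (hG : LeaderRooted G) (hϵ : 0 < ϵ)
    (hδ : 0 < δ) (hγ : 0 ≤ γ) (hτbar : 0 ≤ τbar)
    (hτu : InputDelays τbar τhat τu) (hτc : CommDelays G τcbar τc) (hA₀ : NoUnstableEigenvalue A₀)
    (hX : ∀ i, X i * A₀ = A i * X i + B i * U i)
    (hL : ∀ i, LMISolution (A i) (B i) τbar τhat δ γ ε (P i) (Q i) (R i) (S i) (S₁₂ i) (M i) (Y i))
    (hbound : ∀ i, ∃ b : ℝ, ∀ x₀ : ℝ → E n, IsSolution x₀ (fun t => A₀.toEuclideanLin (x₀ t)) →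
      ∀ τ t, 0 ≤ t →
        ‖leaderDisturbance (B i) (Y i * (M i)⁻¹) (K₂ i) (X i) (U i) τ x₀ t‖ ≤ b * ‖x₀ 0‖) :
    ∃ c : ℝ, 0 < c ∧
      ∀ (v : ∀ i, ℝ → E (nn i)) (x₀ : ℝ → E n) (x : ∀ i, ℝ → E (nn i)) (ξ : Fin N → ℝ → E n)
        (u : ∀ i, ℝ → E (pp i)) (D : ℝ),
        HetClosedLoop G ϵ τu τc A₀ A B (fun i => Y i * (M i)⁻¹) K₂ v x₀ x ξ u →
        InitialDataBound τbar τcbar x₀ x u D → ∀ (i : Fin N) (Δ : ℝ), EssBoundedBy (v i) Δ →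
          ∀ t : ℝ, 0 ≤ t → ‖x i t - clm (X i) (x₀ t)‖ ≤ c * (D + Δ) := by
  obtain ⟨C, κ, hC, hκ, herror⟩ :=
    exists_isDelayTrajectory_regulationError hG hϵ hτu hτc hA₀ hX (fun i => Y i * (M i)⁻¹) K₂
  choose c hc hstate using fun i => (hL i).exists_norm_le hτbar hδ hγ
  choose b hb using hbound
  obtain ⟨k, hk, hck⟩ := exists_pos_forall_le fun i => c i * (1 + ‖clm (X i)‖ + |b i| + C)
  refine ⟨k, hk, fun v x₀ x ξ u D hloop hinit i Δ hv t ht => ?_⟩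
  have hD := hinit.nonneg i
  have hΔ := hv.nonneg
  have hτcbar := hτc.bar_nonneg hG i
  obtain ⟨w, hz, hw⟩ := herror v x₀ x ξ u D hloop hinit i (.of_ae_norm_le hv.2)
  have hdisturbance : ∀ᵐ s ∂(volume.restrict (Set.Ici (0 : ℝ))), ‖w s‖ ≤ Δ + |b i| * D + C * D := by
    filter_upwards [hv.2, ae_restrict_mem measurableSet_Ici] with s hvs (hs : 0 ≤ s)
    refine (hw s hs).trans (add_le_add (add_le_add hvs ?_) ?_)
    · exact (hb i x₀ hloop.leader (τu i) s hs).trans (mul_le_mul (le_abs_self _)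
        (hinit.norm_leader_zero_le hτcbar) (norm_nonneg _) (abs_nonneg _))
    · exact mul_le_of_le_one_right (by positivity)
        (Real.exp_le_one_iff.2 (mul_nonpos_of_nonpos_of_nonneg (neg_nonpos.2 hκ.le) hs))
  calc ‖x i t - clm (X i) (x₀ t)‖
      ≤ c i * (‖x i 0 - clm (X i) (x₀ 0)‖ + (Δ + |b i| * D + C * D)) :=
        hstate i (τu i) _ w _ (hτu.isInputDelay i) hz (by positivity) hdisturbance t ht
    _ ≤ c i * ((1 + ‖clm (X i)‖) * D + (Δ + |b i| * D + C * D)) :=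
        mul_le_mul_of_nonneg_left
          (add_le_add_left (hinit.norm_regulationError_zero_le hτcbar i (X i)) _) (hc i)
    _ ≤ c i * ((1 + ‖clm (X i)‖ + |b i| + C) * (D + Δ)) := by
        have : 0 ≤ (‖clm (X i)‖ + |b i| + C) * Δ := by positivity
        exact mul_le_mul_of_nonneg_left (by linarith) (hc i)
    _ ≤ k * (D + Δ) := by
        rw [← mul_assoc]
        exact mul_le_mul_of_nonneg_right (hck i) (add_nonneg hD hΔ)

theorem eventually_norm_regulationError_sq_le (hG : LeaderRooted G) (hϵ : 0 < ϵ)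
    (hδ : 0 < δ) (hγ : 0 ≤ γ)
    (hτu : InputDelays τbar τhat τu) (hτc : CommDelays G τcbar τc) (hA₀ : NoUnstableEigenvalue A₀)
    (hX : ∀ i, X i * A₀ = A i * X i + B i * U i) {i : Fin N}
    (hL : ∀ i, LMISolution (A i) (B i) τbar τhat δ γ ε (P i) (Q i) (R i) (S i) (S₁₂ i) (M i) (Y i))
    {v : ∀ i, ℝ → E (nn i)} {x₀ : ℝ → E n} {x : ∀ i, ℝ → E (nn i)} {ξ : Fin N → ℝ → E n}
    {u : ∀ i, ℝ → E (pp i)} {D Δ β η : ℝ}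
    (hloop : HetClosedLoop G ϵ τu τc A₀ A B (fun i => Y i * (M i)⁻¹) K₂ v x₀ x ξ u)
    (hinit : InitialDataBound τbar τcbar x₀ x u D) (hv : EssBoundedBy (v i) Δ)
    (hβ : ∀ᶠ t in atTop,
      ‖leaderDisturbance (B i) (Y i * (M i)⁻¹) (K₂ i) (X i) (U i) (τu i) x₀ t‖ ≤ β) (hη : 0 < η) :
    ∀ᶠ t in atTop, ‖x i t - clm (X i) (x₀ t)‖ ^ 2
      ≤ γ / (2 * δ * lambdaMin (unbar (P i) (M i))) * (Δ + β) ^ 2 + η := by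
  obtain ⟨C, κ, -, hκ, herror⟩ :=
    exists_isDelayTrajectory_regulationError hG hϵ hτu hτc hA₀ hX (fun i => Y i * (M i)⁻¹) K₂
  obtain ⟨w, hz, hw⟩ := herror v x₀ x ξ u D hloop hinit i (.of_ae_norm_le hv.2)
  obtain ⟨T, hT⟩ := eventually_atTop.1 hβ
  have hdisturbance : ∀ᵐ t ∂(volume.restrict (Set.Ici (max T 0))),
      ‖w t‖ ≤ Δ + β + C * D * Real.exp (-κ * t) := by
    filter_upwards [ae_restrict_of_ae_restrict_of_subset
      (Set.Ici_subset_Ici.2 (le_max_right T 0)) hv.2, ae_restrict_mem measurableSet_Ici]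
      with t hvt ht
    exact (hw t ((le_max_right T 0).trans ht)).trans
      (add_le_add_left (add_le_add hvt (hT t ((le_max_left T 0).trans ht))) _)
  have hlimit : Tendsto (fun t => Δ + β + C * D * Real.exp (-κ * t)) atTop (𝓝 (Δ + β)) := by
    have hexp : Tendsto (fun t : ℝ => Real.exp (-κ * t)) atTop (𝓝 0) :=
      Real.tendsto_exp_atBot.comp (tendsto_id.const_mul_atTop_of_neg (neg_neg_of_pos hκ))
    simpa using (hexp.const_mul (C * D)).const_add (Δ + β)
  exact (hL i).eventually_norm_sq_le hδ hγ (hτu.isInputDelay i) hz hdisturbance hlimit hη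

theorem output_sub_output_eq {m : ℕ} {C₀ : Matrix (Fin q) (Fin n) ℝ} {C : Matrix (Fin q) (Fin m) ℝ}
    {X : Matrix (Fin m) (Fin n) ℝ} (hC : C₀ = C * X) (y : E m) (y₀ : E n) :
    C.toEuclideanLin y - C₀.toEuclideanLin y₀ = clm C (y - clm X y₀) := by
  rw [← clm_apply, ← clm_apply, hC, clm_mul_apply, map_sub]

theorem exists_norm_outputError_le (hG : LeaderRooted G) (hϵ : 0 < ϵ)
    (hδ : 0 < δ) (hγ : 0 ≤ γ) (hτbar : 0 ≤ τbar)
    (hτu : InputDelays τbar τhat τu) (hτc : CommDelays G τcbar τc) (hA₀ : MarginallyStable A₀)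
    {C₀ : Matrix (Fin q) (Fin n) ℝ} {C : ∀ i, Matrix (Fin q) (Fin (nn i)) ℝ}
    (hX : ∀ i, X i * A₀ = A i * X i + B i * U i ∧ C₀ = C i * X i)
    (hL : ∀ i, LMISolution (A i) (B i) τbar τhat δ γ ε (P i) (Q i) (R i) (S i) (S₁₂ i) (M i) (Y i))
    (K₂ : ∀ i, Matrix (Fin (pp i)) (Fin n) ℝ) :
    ∃ c : ℝ, 0 < c ∧
      ∀ (v : ∀ i, ℝ → E (nn i)) (x₀ : ℝ → E n) (x : ∀ i, ℝ → E (nn i)) (ξ : Fin N → ℝ → E n)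
        (u : ∀ i, ℝ → E (pp i)) (D : ℝ),
        HetClosedLoop G ϵ τu τc A₀ A B (fun i => Y i * (M i)⁻¹) K₂ v x₀ x ξ u →
        InitialDataBound τbar τcbar x₀ x u D → ∀ (i : Fin N) (Δ : ℝ), EssBoundedBy (v i) Δ →
          ∀ t : ℝ, 0 ≤ t →
            ‖(C i).toEuclideanLin (x i t) - C₀.toEuclideanLin (x₀ t)‖ ≤ c * (D + Δ) := by
  obtain ⟨c, hc, herror⟩ := exists_norm_regulationError_le hG hϵ hδ hγ hτbar hτu hτc
    hA₀.noUnstableEigenvalue (fun i => (hX i).1) hL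
    fun i => hA₀.exists_norm_leaderDisturbance_le (B i) (Y i * (M i)⁻¹) (K₂ i) (X i) (U i)
  obtain ⟨k, hk, hCk⟩ := exists_pos_forall_le fun i => ‖clm (C i)‖
  refine ⟨k * c, mul_pos hk hc, fun v x₀ x ξ u D hloop hinit i Δ hv t ht => ?_⟩
  rw [output_sub_output_eq (hX i).2, mul_assoc]
  exact ContinuousLinearMap.le_of_opNorm_le_of_le _ (hCk i)
    (herror v x₀ x ξ u D hloop hinit i Δ hv t ht)

theorem norm_map_sq_le_of_norm_sq_le {V W : Type*} [SeminormedAddCommGroup V] [NormedSpace ℝ V]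
    [SeminormedAddCommGroup W] [NormedSpace ℝ W] (L : V →L[ℝ] W) {z : V} {a η : ℝ} (hη : 0 ≤ η)
    (h : ‖z‖ ^ 2 ≤ a + η / (‖L‖ ^ 2 + 1)) : ‖L z‖ ^ 2 ≤ ‖L‖ ^ 2 * a + η := by
  have hslack : ‖L‖ ^ 2 * (η / (‖L‖ ^ 2 + 1)) ≤ η := by
    rw [mul_div_assoc', div_le_iff₀ (by positivity)]
    linarith
  calc ‖L z‖ ^ 2 ≤ (‖L‖ * ‖z‖) ^ 2 := by gcongr; exact L.le_opNorm z
    _ = ‖L‖ ^ 2 * ‖z‖ ^ 2 := mul_pow _ _ _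
    _ ≤ ‖L‖ ^ 2 * (a + η / (‖L‖ ^ 2 + 1)) := by gcongr
    _ ≤ ‖L‖ ^ 2 * a + η := by rw [mul_add]; gcongr

theorem eventually_norm_outputError_sq_le (hG : LeaderRooted G) (hϵ : 0 < ϵ)
    (hδ : 0 < δ) (hγ : 0 ≤ γ)
    (hτu : InputDelays τbar τhat τu) (hτc : CommDelays G τcbar τc) (hA₀ : NoUnstableEigenvalue A₀)
    {C₀ : Matrix (Fin q) (Fin n) ℝ} {i : Fin N} {C : Matrix (Fin q) (Fin (nn i)) ℝ}
    (hX : ∀ i, X i * A₀ = A i * X i + B i * U i) (hC : C₀ = C * X i)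
    (hL : ∀ i, LMISolution (A i) (B i) τbar τhat δ γ ε (P i) (Q i) (R i) (S i) (S₁₂ i) (M i) (Y i))
    (hK₂ : K₂ i = Y i * (M i)⁻¹ * X i - U i)
    {v : ∀ i, ℝ → E (nn i)} {x₀ : ℝ → E n} {x : ∀ i, ℝ → E (nn i)} {ξ : Fin N → ℝ → E n}
    {u : ∀ i, ℝ → E (pp i)} {D Δ β η : ℝ}
    (hloop : HetClosedLoop G ϵ τu τc A₀ A B (fun i => Y i * (M i)⁻¹) K₂ v x₀ x ξ u)
    (hinit : InitialDataBound τbar τcbar x₀ x u D) (hv : EssBoundedBy (v i) Δ)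
    (hβ : ∀ᶠ t in atTop, ‖(B i * U i).toEuclideanLin (x₀ t - x₀ (t - τu i t))‖ ≤ β) (hη : 0 < η) :
    ∀ᶠ t in atTop, ‖C.toEuclideanLin (x i t) - C₀.toEuclideanLin (x₀ t)‖ ^ 2
      ≤ γ * opNorm C ^ 2 / (2 * δ * lambdaMin (unbar (P i) (M i))) * (Δ + β) ^ 2 + η := by
  have hleader : ∀ᶠ t in atTop,
      ‖leaderDisturbance (B i) (Y i * (M i)⁻¹) (K₂ i) (X i) (U i) (τu i) x₀ t‖ ≤ β := by
    filter_upwards [hβ, eventually_leaderDisturbance_eq (hτu.isInputDelay i) hK₂ (B i) x₀]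
      with t hβt ht
    rwa [ht, norm_neg]
  filter_upwards [eventually_norm_regulationError_sq_le hG hϵ hδ hγ hτu hτc hA₀ hX hL hloop hinit hv
    hleader (div_pos hη (by positivity : 0 < ‖clm C‖ ^ 2 + 1))] with t ht
  rw [output_sub_output_eq hC]
  refine (norm_map_sq_le_of_norm_sq_le (clm C) hη.le ht).trans_eq ?_
  rw [show opNorm C = ‖clm C‖ from rfl]
  ring

end Consensus

section Homogeneous

variable {N n p : ℕ} {G : Digraph (Fin (N + 1))} {ϵ τbar τhat τcbar δ γ ε : ℝ}
  {τu : Fin N → ℝ → ℝ} {τc : Fin N → Fin (N + 1) → ℝ → ℝ}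
  {A P Q R S S₁₂ M : Matrix (Fin n) (Fin n) ℝ} {B : Matrix (Fin n) (Fin p) ℝ}
  {Y : Matrix (Fin p) (Fin n) ℝ}

theorem exists_norm_trackingError_le_mul_exp (hG : LeaderRooted G) (hϵ : 0 < ϵ)
    (hδ : 0 < δ) (hγ : 0 ≤ γ) (hτbar : 0 ≤ τbar)
    (hτu : InputDelays τbar τhat τu) (hτc : CommDelays G τcbar τc) (hA : NoUnstableEigenvalue A)
    (hL : LMISolution A B τbar τhat δ γ ε P Q R S S₁₂ M Y) :
    ∃ c κ : ℝ, 0 < c ∧ 0 < κ ∧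
      ∀ (v : Fin N → ℝ → E n) (x₀ : ℝ → E n) (x ξ : Fin N → ℝ → E n) (u : Fin N → ℝ → E p)
        (D : ℝ), HomClosedLoop G ϵ τu τc A B (Y * M⁻¹) v x₀ x ξ u →
        InitialDataBound τbar τcbar x₀ x u D →
        ∀ i, (∀ᵐ t ∂(volume.restrict (Set.Ici (0 : ℝ))), v i t = 0) →
          ∀ t : ℝ, 0 ≤ t → ‖x i t - x₀ t‖ ≤ c * D * Real.exp (-κ * t) := by
  obtain ⟨c, κ, hc, hκ, herror⟩ := exists_norm_regulationError_le_mul_exp (A := fun _ => A)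
    (X := fun _ => 1) (U := fun _ => 0) hG hϵ hδ hγ hτbar hτu hτc hA (by simp) (fun _ => hL)
    fun i => leaderDisturbance_one_zero B (Y * M⁻¹) (τu i)
  refine ⟨c, κ, hc, hκ, fun v x₀ x ξ u D hloop hinit => ?_⟩
  simpa only [clm_one_apply] using herror v x₀ x ξ u D hloop.hetClosedLoop hinit

theorem exists_norm_trackingError_le (hG : LeaderRooted G) (hϵ : 0 < ϵ)
    (hδ : 0 < δ) (hγ : 0 ≤ γ) (hτbar : 0 ≤ τbar)
    (hτu : InputDelays τbar τhat τu) (hτc : CommDelays G τcbar τc) (hA : NoUnstableEigenvalue A)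
    (hL : LMISolution A B τbar τhat δ γ ε P Q R S S₁₂ M Y) :
    ∃ c : ℝ, 0 < c ∧
      ∀ (v : Fin N → ℝ → E n) (x₀ : ℝ → E n) (x ξ : Fin N → ℝ → E n) (u : Fin N → ℝ → E p)
        (D : ℝ), HomClosedLoop G ϵ τu τc A B (Y * M⁻¹) v x₀ x ξ u →
        InitialDataBound τbar τcbar x₀ x u D → ∀ (i : Fin N) (Δ : ℝ), EssBoundedBy (v i) Δ →
          ∀ t : ℝ, 0 ≤ t → ‖x i t - x₀ t‖ ≤ c * (D + Δ) := by
  obtain ⟨c, hc, herror⟩ := exists_norm_regulationError_le (A := fun _ => A)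
    (K₂ := fun _ => Y * M⁻¹) (X := fun _ => 1) (U := fun _ => 0)
    hG hϵ hδ hγ hτbar hτu hτc hA (by simp) (fun _ => hL)
    fun _ => ⟨0, fun x₀ _ τ t _ => by simp [leaderDisturbance_one_zero B (Y * M⁻¹) τ x₀ t]⟩
  refine ⟨c, hc, fun v x₀ x ξ u D hloop hinit => ?_⟩
  simpa only [clm_one_apply] using herror v x₀ x ξ u D hloop.hetClosedLoop hinit

theorem eventually_norm_trackingError_sq_le (hG : LeaderRooted G) (hϵ : 0 < ϵ)
    (hδ : 0 < δ) (hγ : 0 ≤ γ)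
    (hτu : InputDelays τbar τhat τu) (hτc : CommDelays G τcbar τc) (hA : NoUnstableEigenvalue A)
    (hL : LMISolution A B τbar τhat δ γ ε P Q R S S₁₂ M Y)
    {v : Fin N → ℝ → E n} {x₀ : ℝ → E n} {x ξ : Fin N → ℝ → E n} {u : Fin N → ℝ → E p}
    {i : Fin N} {D Δ η : ℝ} (hloop : HomClosedLoop G ϵ τu τc A B (Y * M⁻¹) v x₀ x ξ u)
    (hinit : InitialDataBound τbar τcbar x₀ x u D) (hv : EssBoundedBy (v i) Δ) (hη : 0 < η) :
    ∀ᶠ t in atTop,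
      ‖x i t - x₀ t‖ ^ 2 ≤ γ / (2 * δ * lambdaMin (unbar P M)) * Δ ^ 2 + η := by
  have herror := eventually_norm_regulationError_sq_le (A := fun _ => A) (X := fun _ => 1)
    (U := fun _ => 0) (β := 0)
    hG hϵ hδ hγ hτu hτc hA (by simp) (fun _ => hL) hloop.hetClosedLoop hinit hv
    (.of_forall fun t => by simp [leaderDisturbance_one_zero B (Y * M⁻¹) (τu i) x₀ t]) hη
  simpa only [clm_one_apply, add_zero] using herror

end Homogeneous

end DelayMAS

end

open DelayMAS in
theorem lemma2_general {N : ℕ} (G : Digraph (Fin (N + 1))) (hG : LeaderRooted G)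
    (ϵ : ℝ) (hϵ : 0 < ϵ)
    (τbar τhat δ γ ε : ℝ) (hτbar : 0 ≤ τbar) (hδ : 0 < δ) (hγ : 0 ≤ γ)
    (τu : Fin N → ℝ → ℝ) (hτu : InputDelays τbar τhat τu)
    (τcbar : ℝ) (τc : Fin N → Fin (N + 1) → ℝ → ℝ) (hτc : CommDelays G τcbar τc) :
    (∀ (n p : ℕ) (A : Matrix (Fin n) (Fin n) ℝ) (B : Matrix (Fin n) (Fin p) ℝ)
        (P Q R S S₁₂ M : Matrix (Fin n) (Fin n) ℝ) (Y K : Matrix (Fin p) (Fin n) ℝ),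
      NoUnstableEigenvalue A →
      LMISolution A B τbar τhat δ γ ε P Q R S S₁₂ M Y →
      K = Y * M⁻¹ →
      (∃ c κ : ℝ, 0 < c ∧ 0 < κ ∧
        ∀ (v : Fin N → ℝ → E n) (x₀ : ℝ → E n) (x ξ : Fin N → ℝ → E n) (u : Fin N → ℝ → E p)
          (D : ℝ), HomClosedLoop G ϵ τu τc A B K v x₀ x ξ u →
          InitialDataBound τbar τcbar x₀ x u D →
          ∀ i, (∀ᵐ t ∂(volume.restrict (Set.Ici (0 : ℝ))), v i t = 0) →
            ∀ t : ℝ, 0 ≤ t → ‖x i t - x₀ t‖ ≤ c * D * Real.exp (-κ * t)) ∧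
      (∃ c : ℝ, 0 < c ∧
        ∀ (v : Fin N → ℝ → E n) (x₀ : ℝ → E n) (x ξ : Fin N → ℝ → E n) (u : Fin N → ℝ → E p)
          (D : ℝ), HomClosedLoop G ϵ τu τc A B K v x₀ x ξ u →
          InitialDataBound τbar τcbar x₀ x u D →
          ∀ (i : Fin N) (Δ : ℝ), EssBoundedBy (v i) Δ →
            ∀ t : ℝ, 0 ≤ t → ‖x i t - x₀ t‖ ≤ c * (D + Δ)) ∧
      (∀ (v : Fin N → ℝ → E n) (x₀ : ℝ → E n) (x ξ : Fin N → ℝ → E n) (u : Fin N → ℝ → E p)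
          (D : ℝ), HomClosedLoop G ϵ τu τc A B K v x₀ x ξ u →
          InitialDataBound τbar τcbar x₀ x u D →
          ∀ (i : Fin N) (Δ : ℝ), EssBoundedBy (v i) Δ →
            ∀ η : ℝ, 0 < η → ∀ᶠ t in atTop,
              ‖x i t - x₀ t‖ ^ 2 ≤ γ / (2 * δ * lambdaMin (unbar P M)) * Δ ^ 2 + η)) ∧
    (∀ (n q : ℕ) (nn pp : Fin N → ℕ)
        (A₀ : Matrix (Fin n) (Fin n) ℝ) (C₀ : Matrix (Fin q) (Fin n) ℝ)
        (A : ∀ i, Matrix (Fin (nn i)) (Fin (nn i)) ℝ) (B : ∀ i, Matrix (Fin (nn i)) (Fin (pp i)) ℝ)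
        (C : ∀ i, Matrix (Fin q) (Fin (nn i)) ℝ)
        (X : ∀ i, Matrix (Fin (nn i)) (Fin n) ℝ) (U : ∀ i, Matrix (Fin (pp i)) (Fin n) ℝ)
        (P Q R S S₁₂ M : ∀ i, Matrix (Fin (nn i)) (Fin (nn i)) ℝ)
        (Y K₁ : ∀ i, Matrix (Fin (pp i)) (Fin (nn i)) ℝ),
      NoUnstableEigenvalue A₀ →
      (∀ i, X i * A₀ = A i * X i + B i * U i ∧ C₀ = C i * X i) →
      (∀ i, LMISolution (A i) (B i) τbar τhat δ γ ε
        (P i) (Q i) (R i) (S i) (S₁₂ i) (M i) (Y i)) →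
      (∀ i, K₁ i = Y i * (M i)⁻¹) →
      (MarginallyStable A₀ → ∀ K₂ : ∀ i, Matrix (Fin (pp i)) (Fin n) ℝ,
        ∃ c : ℝ, 0 < c ∧
          ∀ (v : ∀ i, ℝ → E (nn i)) (x₀ : ℝ → E n) (x : ∀ i, ℝ → E (nn i)) (ξ : Fin N → ℝ → E n)
            (u : ∀ i, ℝ → E (pp i)) (D : ℝ), HetClosedLoop G ϵ τu τc A₀ A B K₁ K₂ v x₀ x ξ u →
            InitialDataBound τbar τcbar x₀ x u D →
            ∀ (i : Fin N) (Δ : ℝ), EssBoundedBy (v i) Δ →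
              ∀ t : ℝ, 0 ≤ t →
                ‖(C i).toEuclideanLin (x i t) - C₀.toEuclideanLin (x₀ t)‖ ≤ c * (D + Δ)) ∧
      (∀ K₂ : ∀ i, Matrix (Fin (pp i)) (Fin n) ℝ, (∀ i, K₂ i = K₁ i * X i - U i) →
          ∀ (v : ∀ i, ℝ → E (nn i)) (x₀ : ℝ → E n) (x : ∀ i, ℝ → E (nn i)) (ξ : Fin N → ℝ → E n)
            (u : ∀ i, ℝ → E (pp i)) (D : ℝ), HetClosedLoop G ϵ τu τc A₀ A B K₁ K₂ v x₀ x ξ u →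
            InitialDataBound τbar τcbar x₀ x u D →
            ∀ (i : Fin N) (Δ β : ℝ), EssBoundedBy (v i) Δ →
              (∀ᶠ t in atTop, ‖(B i * U i).toEuclideanLin (x₀ t - x₀ (t - τu i t))‖ ≤ β) →
              ∀ η : ℝ, 0 < η → ∀ᶠ t in atTop,
                ‖(C i).toEuclideanLin (x i t) - C₀.toEuclideanLin (x₀ t)‖ ^ 2 ≤
                  γ * opNorm (C i) ^ 2 / (2 * δ * lambdaMin (unbar (P i) (M i))) * (Δ + β) ^ 2
                    + η)) := by
  refine ⟨fun n p A B P Q R S S₁₂ M Y K hA hL hK => ?_,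
    fun n q nn pp A₀ C₀ A B C X U P Q R S S₁₂ M Y K₁ hA₀ hX hL hK => ?_⟩
  · subst hK
    exact ⟨exists_norm_trackingError_le_mul_exp hG hϵ hδ hγ hτbar hτu hτc hA hL,
      exists_norm_trackingError_le hG hϵ hδ hγ hτbar hτu hτc hA hL,
      fun v x₀ x ξ u D hloop hinit i Δ hv η hη =>
        eventually_norm_trackingError_sq_le hG hϵ hδ hγ hτu hτc hA hL hloop hinit hv hη⟩
  · obtain rfl : K₁ = fun i => Y i * (M i)⁻¹ := funext hK
    exact ⟨fun hstable => exists_norm_outputError_le hG hϵ hδ hγ hτbar hτu hτc hstable hX hL,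
      fun K₂ hK₂ v x₀ x ξ u D hloop hinit i Δ β hv hβ η hη =>
        eventually_norm_outputError_sq_le hG hϵ hδ hγ hτu hτc hA₀ (fun j => (hX j).1) (hX i).2 hL
          (hK₂ i) hloop hinit hv hβ hη⟩

open DelayMAS in
theorem lemma2 {N : ℕ} (G : Digraph (Fin (N + 1))) (hG : LeaderRooted G)
    (ϵ : ℝ) (hϵ : 0 < ϵ)
    (τbar τhat δ γ ε : ℝ) (hτbar : 0 ≤ τbar) (hτhat : 0 ≤ τhat) (hδ : 0 < δ) (hγ : 0 < γ)
    (τu : Fin N → ℝ → ℝ) (hτu : InputDelays τbar τhat τu)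
    (τcbar : ℝ) (τc : Fin N → Fin (N + 1) → ℝ → ℝ) (hτc : CommDelays G τcbar τc) :
    -- homogeneous agents
    (∀ (n p : ℕ) (A : Matrix (Fin n) (Fin n) ℝ) (B : Matrix (Fin n) (Fin p) ℝ)
        (P Q R S S₁₂ M : Matrix (Fin n) (Fin n) ℝ) (Y K : Matrix (Fin p) (Fin n) ℝ),
      NoUnstableEigenvalue A →
      LMISolution A B τbar τhat δ γ ε P Q R S S₁₂ M Y →
      K = Y * M⁻¹ →
      -- exponential stability of the tracking error without disturbance
      (∃ c κ : ℝ, 0 < c ∧ 0 < κ ∧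
        ∀ (v : Fin N → ℝ → E n) (x₀ : ℝ → E n) (x ξ : Fin N → ℝ → E n) (u : Fin N → ℝ → E p)
          (D : ℝ), HomClosedLoop G ϵ τu τc A B K v x₀ x ξ u →
          InitialDataBound τbar τcbar x₀ x u D →
          ∀ i, (∀ᵐ t ∂(volume.restrict (Set.Ici (0 : ℝ))), v i t = 0) →
            ∀ t : ℝ, 0 ≤ t → ‖x i t - x₀ t‖ ≤ c * D * Real.exp (-κ * t)) ∧
      -- boundedness of the tracking error under bounded disturbances
      (∃ c : ℝ, 0 < c ∧
        ∀ (v : Fin N → ℝ → E n) (x₀ : ℝ → E n) (x ξ : Fin N → ℝ → E n) (u : Fin N → ℝ → E p)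
          (D : ℝ), HomClosedLoop G ϵ τu τc A B K v x₀ x ξ u →
          InitialDataBound τbar τcbar x₀ x u D →
          ∀ (i : Fin N) (Δ : ℝ), EssBoundedBy (v i) Δ →
            ∀ t : ℝ, 0 ≤ t → ‖x i t - x₀ t‖ ≤ c * (D + Δ)) ∧
      -- ultimate bound
      (∀ (v : Fin N → ℝ → E n) (x₀ : ℝ → E n) (x ξ : Fin N → ℝ → E n) (u : Fin N → ℝ → E p)
          (D : ℝ), HomClosedLoop G ϵ τu τc A B K v x₀ x ξ u →
          InitialDataBound τbar τcbar x₀ x u D →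
          ∀ (i : Fin N) (Δ : ℝ), EssBoundedBy (v i) Δ →
            ∀ η : ℝ, 0 < η → ∀ᶠ t in atTop,
              ‖x i t - x₀ t‖ ^ 2 ≤ γ / (2 * δ * lambdaMin (unbar P M)) * Δ ^ 2 + η)) ∧
    -- heterogeneous agents
    (∀ (n q : ℕ) (nn pp : Fin N → ℕ)
        (A₀ : Matrix (Fin n) (Fin n) ℝ) (C₀ : Matrix (Fin q) (Fin n) ℝ)
        (A : ∀ i, Matrix (Fin (nn i)) (Fin (nn i)) ℝ) (B : ∀ i, Matrix (Fin (nn i)) (Fin (pp i)) ℝ)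
        (C : ∀ i, Matrix (Fin q) (Fin (nn i)) ℝ)
        (X : ∀ i, Matrix (Fin (nn i)) (Fin n) ℝ) (U : ∀ i, Matrix (Fin (pp i)) (Fin n) ℝ)
        (P Q R S S₁₂ M : ∀ i, Matrix (Fin (nn i)) (Fin (nn i)) ℝ)
        (Y K₁ : ∀ i, Matrix (Fin (pp i)) (Fin (nn i)) ℝ),
      MarginallyStable A₀ →
      (∀ i, X i * A₀ = A i * X i + B i * U i ∧ C₀ = C i * X i) →
      (∀ i, LMISolution (A i) (B i) τbar τhat δ γ ε
        (P i) (Q i) (R i) (S i) (S₁₂ i) (M i) (Y i)) →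
      (∀ i, K₁ i = Y i * (M i)⁻¹) →
      -- boundedness of the output consensus error, for either sign of the observer gain
      (∀ K₂ : ∀ i, Matrix (Fin (pp i)) (Fin n) ℝ,
        ((∀ i, K₂ i = U i - K₁ i * X i) ∨ (∀ i, K₂ i = K₁ i * X i - U i)) →
        ∃ c : ℝ, 0 < c ∧
          ∀ (v : ∀ i, ℝ → E (nn i)) (x₀ : ℝ → E n) (x : ∀ i, ℝ → E (nn i)) (ξ : Fin N → ℝ → E n)
            (u : ∀ i, ℝ → E (pp i)) (D : ℝ), HetClosedLoop G ϵ τu τc A₀ A B K₁ K₂ v x₀ x ξ u →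
            InitialDataBound τbar τcbar x₀ x u D →
            ∀ (i : Fin N) (Δ : ℝ), EssBoundedBy (v i) Δ →
              ∀ t : ℝ, 0 ≤ t →
                ‖(C i).toEuclideanLin (x i t) - C₀.toEuclideanLin (x₀ t)‖ ≤ c * (D + Δ)) ∧
      -- ultimate bound
      (∀ K₂ : ∀ i, Matrix (Fin (pp i)) (Fin n) ℝ, (∀ i, K₂ i = K₁ i * X i - U i) →
          ∀ (v : ∀ i, ℝ → E (nn i)) (x₀ : ℝ → E n) (x : ∀ i, ℝ → E (nn i)) (ξ : Fin N → ℝ → E n)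
            (u : ∀ i, ℝ → E (pp i)) (D : ℝ), HetClosedLoop G ϵ τu τc A₀ A B K₁ K₂ v x₀ x ξ u →
            InitialDataBound τbar τcbar x₀ x u D →
            ∀ (i : Fin N) (Δ β : ℝ), EssBoundedBy (v i) Δ →
              (∀ᶠ t in atTop, ‖(B i * U i).toEuclideanLin (x₀ t - x₀ (t - τu i t))‖ ≤ β) →
              ∀ η : ℝ, 0 < η → ∀ᶠ t in atTop,
                ‖(C i).toEuclideanLin (x i t) - C₀.toEuclideanLin (x₀ t)‖ ^ 2 ≤
                  γ * opNorm (C i) ^ 2 / (2 * δ * lambdaMin (unbar (P i) (M i))) * (Δ + β) ^ 2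
                    + η)) :=
  (lemma2_general G hG ϵ hϵ τbar τhat δ γ ε hτbar hδ hγ.le τu hτu τcbar τc hτc).imp id
    fun hhet n q nn pp A₀ C₀ A B C X U P Q R S S₁₂ M Y K₁ hA₀ hX hL hK =>
      (hhet n q nn pp A₀ C₀ A B C X U P Q R S S₁₂ M Y K₁ hA₀.noUnstableEigenvalue hX hL hK).imp
        (fun hbound K₂ _ => hbound hA₀ K₂) id
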